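/- Let $\mathbb K$ be a field. An operad here is a finitely generated binary quadratic symmetric operad over $\mathbb K$, i.e. $\mathcal P(E,R)$ with $E$ a finite-dimensional $S_2$-module of generators and $R$ an $S_3$-stable subspace of the arity-three part of the free operad on $E$; isomorphisms are equivariant isomorphisms of generators that identify the relators. A commutative (anti-commutative) generator is one with $\mu^{op}=\mu$ ($\mu^{op}=-\mu$). The Manin black product is $\mathcal P(E,R)\bullet\mathcal P(F,S)=\mathcal P(E\otimes F\otimes\mathrm{sgn},\Psi(R\otimes S))$, where $\Psi$ multiplies ternary composites shape by shape: writing $\mu\circ_u\nu$, $u=1,2,3$, for $\mu(\nu(x,y),z)$, $\mu(\nu(y,z),x)$, $\mu(\nu(z,x),y)$, one has $\Psi(\mu\circ_u\nu\otimes\mu'\circ_v\nu')=\delta_{uv}(\mu\otimes\mu')\circ_u(\nu\otimes\nu')$. The operad $\mathcal O\times\mathcal P$ has the operations and relations of both, and all composites of an operation of one with an operation of the other vanish. Let $C^*(\Delta_1;V)$ be the complex of non-degenerate cochains on the interval, with $0$-cochains ${}_x\!\to_y$ (value $x$ at the left vertex $v_l$, $y$ at the right vertex $v_r$; ${}_x\!\to$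 and $\to_y$ if the other value is $0$), $1$-cochains $\xrightarrow{x}$ and $d({}_x\!\to_y)=\xrightarrow{y-x}$. An $\mathrm{Ass}_\bullet(\mathcal O)$-algebra structure on $V$ is a dg $\mathcal O$-algebra structure on $C^*(\Delta_1;V)$ for which the cochains relative to $v_l$, to $v_r$ and to $\{v_l,v_r\}$ are dg ideals; it is a $\mathrm{Com}_\bullet(\mathcal O)$-algebra structure if the induced $\mathcal O$-algebra structure on $V$ (given by $\to_x\cdot\to_y\,=\,\to_{x\cdot y}$) is trivial. A $\mathrm{preLie}_\bullet(\mathcal O)$-algebra structure on $V$ is a dg $\mathcal O$-algebra structure on $C^*(\Delta_1,v_l;V)$. An operation $\cdot$ of $\mathcal O$ gives operations on $V$ by $\xrightarrow{x}\cdot\to_y\,=\,\xrightarrow{x\prec y}$ and $\to_x\cdot\xrightarrow{y}\,=\,-\xrightarrow{y\succ x}$; write $\circ$ (resp. $\ast$) for $\prec$ if the operation is a commutative product $\bullet$ (resp. an anti-commutative bracket $[-,-]$). Let $\mathcal Pois$ be the operad of commutative Poisson algebras $(\bullet,[-,-])$, $post\mathcal Lie$ that of right post-Lie algebras $(\cdot,[-,-])$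 ($[-,-]$ a Lie bracket, $[x,y]\cdot z=[x,y\cdot z]+[x\cdot z,y]$, $x\cdot(y\cdot z-z\cdot y+[y,z])=(x\cdot y)\cdot z-(x\cdot z)\cdot y$), and $\mathcal Lie_{adm}$ that of Lie admissible algebras (one product whose commutator is a Lie bracket); pre-Lie means right pre-Lie. Then the following operads are isomorphic, and moreover for every vector space $V$ the indicated operations give a bijection from the structures of $\mathrm{Ass}_\bullet(\mathcal O)$-, $\mathrm{Com}_\bullet(\mathcal O)$-, $\mathrm{preLie}_\bullet(\mathcal O)$-algebra on $V$ (for $\mathcal Ass\bullet\mathcal O$, $\mathcal Com\bullet\mathcal O$, $pre\mathcal Lie\bullet\mathcal O$ respectively) onto the algebra structures on $V$ over the operad on the right-hand side. 1. $\mathcal Ass\bullet\mathcal Pois$ is generated by two non-symmetric operations $\circ,\ast$ with relations $(x\circ y)\circ z=x\circ(y\circ z)=0$, $\ast$ associative, and $(x\ast y)\circ z=x\ast(y\circ z)=x\circ(y\ast z)=(x\circ y)\ast z$. 2. If $\operatorname{char}\mathbb K\neq2$, $\mathcal Com\bullet\mathcal Pois=nil\mathcal Lie\times\mathcal Com$,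 where $nil\mathcal Lie$ is the operad of an anti-commutative bracket with $\{\{x,y\},z\}=0$; the bracket is $\circ$ and the commutative product is $\ast$. 3. $pre\mathcal Lie\bullet\mathcal Pois=pre\mathcal Pois$, right pre-Poisson algebras: $x\circ(y\circ z+z\circ y)=(x\circ y)\circ z$, $\ast$ pre-Lie, $x\ast(y\circ z+z\circ y)=(x\ast y)\circ z+(x\ast z)\circ y$ and $y\circ(x\ast z-z\ast x)=(y\ast x)\circ z-(y\circ z)\ast x$. 4. $\mathcal Ass\bullet post\mathcal Lie=\mathcal Tridend$, dendriform trialgebras $(\prec,\succ,\ast)$: with $x\cup y=x\prec y+x\succ y+x\ast y$, $(x\prec y)\prec z=x\prec(y\cup z)$, $(x\succ y)\prec z=x\succ(y\prec z)$, $(x\cup y)\succ z=x\succ(y\succ z)$, $(x\succ y)\ast z=x\succ(y\ast z)$, $(x\prec y)\ast z=x\ast(y\succ z)$, $(x\ast y)\prec z=x\ast(y\prec z)$, and $\ast$ associative. 5. $\mathcal Com\bullet post\mathcal Lie=post\mathcal Com$, generated by a non-symmetric $\star$ (given by $\prec$) and a commutative $\circledast$ (given by $\ast$) with $(x\circledast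 y)\circledast z=x\circledast(y\circledast z)$, $(x\circledast y)\star z=x\circledast(y\star z)$, $(x\star y)\star z=x\star(y\star z+z\star y+y\circledast z)$. 6. There are morphisms of operads $\mathcal Lie\to post\mathcal Lie$, $\mathcal Ass\to\mathcal Tridend$, $\mathcal Com\to post\mathcal Com$ sending the generator to $\cdot-\cdot^{op}+[-,-]$, to $\prec+\succ+\ast$ and to $\star+\star^{op}+\circledast$ respectively. 7. $\mathcal Ass\bullet\mathcal Lie_{adm}=\mathcal Ass_{adm}$ (two operations $\prec,\succ$ with $x\prec y+x\succ y$ associative), $\mathcal Com\bullet\mathcal Lie_{adm}=\mathcal Com_{adm}$ (one operation $\star$, given by $\prec$, with $x\star y+y\star x$ associative) and $pre\mathcal Lie\bullet\mathcal Lie_{adm}=pre\mathcal Lie_{adm}$ (two operations $\prec,\succ$ with $x\prec y+x\succ y$ pre-Lie). -/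

import Mathlib

open TensorProduct

universe u v w

noncomputable section

namespace BinaryOperad

/-! ### Ternary part of the free operad on binary generators -/

section Free

variable {K : Type u} [Field K] {E : Type v} [AddCommGroup E] [Module K E]

/-- The arity-three part of the free symmetric operad on a space `E` of binary operations.
The components of `t` are the coefficients of the three shapes of composites:
`t 0` of `μ(ν(x₀,x₁),x₂)`, `t 1` of `μ(ν(x₁,x₂),x₀)`, `t 2` of `μ(ν(x₂,x₀),x₁)`,
where a pure tensor `μ ⊗ ν` stands for outer operation `μ` and inner operation `ν`. -/
abbrev Tern (K : Type u) [Field K] (E : Type v) [AddCommGroup E] [Module K E] : Type v :=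
  Fin 3 → E ⊗[K] E

/-- Cyclic relabelling `x_i ↦ x_{i+1}` of the variables. -/
def rot (t : Tern K E) : Tern K E := fun i => t (i - 1)

/-- Exchange of the variables `x₀` and `x₁`; `σ` is the map `e ↦ e^op`. -/
def flip (σ : E →ₗ[K] E) (t : Tern K E) : Tern K E :=
  fun i => TensorProduct.map LinearMap.id σ (t (-i))

/-- Stability under the action of the symmetric group on the three variables. -/
def IsStable (σ : E →ₗ[K] E) (R : Submodule K (Tern K E)) : Prop :=
  (∀ r ∈ R, rot r ∈ R) ∧ ∀ r ∈ R, flip σ r ∈ R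

/-- The smallest stable subspace containing given relators. -/
def stableSpan (σ : E →ₗ[K] E) (S : Set (Tern K E)) : Submodule K (Tern K E) :=
  sInf {R | S ⊆ R ∧ IsStable σ R}

theorem isStable_stableSpan (σ : E →ₗ[K] E) (S : Set (Tern K E)) :
    IsStable σ (stableSpan σ S) := by
  constructor
  · intro r hr
    refine Submodule.mem_sInf.2 fun R hR => hR.2.1 r (Submodule.mem_sInf.1 hr R hR)
  · intro r hr
    refine Submodule.mem_sInf.2 fun R hR => hR.2.2 r (Submodule.mem_sInf.1 hr R hR)

/-- The composite `μ(ν(x_i,x_j),x_k)`, where `(i,j,k)` is a permutation of `(0,1,2)`. -/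
def treeL (σ : E →ₗ[K] E) (μ ν : E) (i j _k : Fin 3) : Tern K E :=
  if j = i + 1 then Pi.single i (μ ⊗ₜ ν) else Pi.single j (μ ⊗ₜ σ ν)

/-- The composite `μ(x_i,ν(x_j,x_k))`, where `(i,j,k)` is a permutation of `(0,1,2)`. -/
def treeR (σ : E →ₗ[K] E) (μ ν : E) (i j k : Fin 3) : Tern K E :=
  treeL σ (σ μ) ν j k i

/-- The map induced on ternary composites by a linear map on generators. -/
def ternMap {F : Type w} [AddCommGroup F] [Module K F] (φ : E →ₗ[K] F) :
    Tern K E →ₗ[K] Tern K F :=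
  LinearMap.pi fun i => TensorProduct.map φ φ ∘ₗ LinearMap.proj i

end Free

/-! ### Binary quadratic operads -/

/-- A finitely generated binary quadratic symmetric operad over `K`, given by its space `E` of
generators, the map `swap : e ↦ e^op` giving the action of the transposition on `E`, and the
`S₃`-stable subspace `R` of quadratic relators: it stands for the quotient of the free operad
on `E` by the ideal generated by `R`. -/
structure Quad (K : Type u) [Field K] where
  E : Type u
  [grp : AddCommGroup E]
  [mod : Module K E]
  [fin : Module.Finite K E]
  swap : E →ₗ[K] E
  swap_swap : ∀ e, swap (swap e) = e
  R : Submodule K (Tern K E)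
  stable : IsStable swap R

attribute [instance] Quad.grp Quad.mod Quad.fin

/-- Morphisms of operads, in terms of the images of the generators: an equivariant map of
generators that sends relators to relators. -/
def IsHom {K : Type u} [Field K] (P Q : Quad K) (φ : P.E →ₗ[K] Q.E) : Prop :=
  (∀ e, φ (P.swap e) = Q.swap (φ e)) ∧ ∀ r ∈ P.R, ternMap φ r ∈ Q.R

/-- Isomorphism of operads: an equivariant linear isomorphism of the generators that identifies
the spaces of relators. -/
def Isomorphic {K : Type u} [Field K] (P Q : Quad K) : Prop :=
  ∃ φ : P.E ≃ₗ[K] Q.E, (∀ e, φ (P.swap e) = Q.swap (φ e)) ∧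
    P.R.map (ternMap (φ : P.E →ₗ[K] Q.E)) = Q.R

/-! ### The Manin black product -/

section Black

variable {K : Type u} [Field K]

/-- The map `Ψ`, with values in ternary composites of `E ⊗ F`: it sends
`(μ ∘ᵢ ν, μ' ∘ⱼ ν')` to `(μ ⊗ μ') ∘ᵢ (ν ⊗ ν')` if the shapes `i`, `j` agree and to `0`
otherwise. -/
def blackMap {E : Type v} [AddCommGroup E] [Module K E] {F : Type w} [AddCommGroup F]
    [Module K F] (r : Tern K E) (s : Tern K F) : Tern K (E ⊗[K] F) :=
  fun i => TensorProduct.tensorTensorTensorComm K E E F F (r i ⊗ₜ s i)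

theorem blackMap_flip {E : Type v} [AddCommGroup E] [Module K E] {F : Type w} [AddCommGroup F]
    [Module K F] (σ : E →ₗ[K] E) (τ : F →ₗ[K] F) (r : Tern K E) (s : Tern K F) :
    flip (-TensorProduct.map σ τ) (blackMap r s) = -blackMap (flip σ r) (flip τ s) := by
  funext i
  have h : (TensorProduct.map LinearMap.id (-TensorProduct.map σ τ)) ∘ₗ
      (TensorProduct.tensorTensorTensorComm K E E F F).toLinearMap =
      -((TensorProduct.tensorTensorTensorComm K E E F F).toLinearMap ∘ₗ
        TensorProduct.map (TensorProduct.map LinearMap.id σ)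
          (TensorProduct.map LinearMap.id τ)) := by
    ext a b c d
    simp [TensorProduct.tmul_neg]
  have := LinearMap.congr_fun h (r (-i) ⊗ₜ s (-i))
  simpa [flip, blackMap] using this

/-- The Manin black product `P ∙ Q`: generators `E_P ⊗ E_Q ⊗ sgn`, relators `Ψ(R_P ⊗ R_Q)`. -/
abbrev black (P Q : Quad K) : Quad K where
  E := P.E ⊗[K] Q.E
  swap := -TensorProduct.map P.swap Q.swap
  swap_swap e := by
    have h : TensorProduct.map P.swap Q.swap ∘ₗ TensorProduct.map P.swap Q.swap =
        LinearMap.id := by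
      ext a b
      simp [P.swap_swap, Q.swap_swap]
    simpa using LinearMap.congr_fun h e
  R := Submodule.span K {t | ∃ r ∈ P.R, ∃ s ∈ Q.R, t = blackMap r s}
  stable := by
    constructor
    · intro t ht
      induction ht using Submodule.span_induction with
      | mem t ht =>
        obtain ⟨r, hr, s, hs, rfl⟩ := ht
        exact Submodule.subset_span ⟨rot r, P.stable.1 r hr, rot s, Q.stable.1 s hs, rfl⟩
      | zero => exact Submodule.zero_mem _
      | add x y _ _ hx hy => exact Submodule.add_mem _ hx hy
      | smul c x _ hx => exact Submodule.smul_mem _ c hx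
    · intro t ht
      induction ht using Submodule.span_induction with
      | mem t ht =>
        obtain ⟨r, hr, s, hs, rfl⟩ := ht
        rw [blackMap_flip]
        exact Submodule.neg_mem _ (Submodule.subset_span
          ⟨_, P.stable.2 r hr, _, Q.stable.2 s hs, rfl⟩)
      | zero =>
        convert Submodule.zero_mem _
        funext i
        simp [flip]
      | add x y _ _ hx hy =>
        convert Submodule.add_mem _ hx hy
        funext i
        simp [flip]
      | smul c x _ hx =>
        convert Submodule.smul_mem _ c hx
        funext i
        simp [flip]

/-- The operad `P × Q`: the operations and relations of `P` and of `Q`, and every composite of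
an operation of `P` with one of `Q` (in either order) vanishes. -/
abbrev prod (P Q : Quad K) : Quad K where
  E := P.E × Q.E
  swap := P.swap.prodMap Q.swap
  swap_swap e := by simp [P.swap_swap, Q.swap_swap]
  R := stableSpan (P.swap.prodMap Q.swap)
    (ternMap (LinearMap.inl K P.E Q.E) '' P.R ∪ ternMap (LinearMap.inr K P.E Q.E) '' Q.R ∪
      {t | ∃ (a : P.E) (b : Q.E) (i : Fin 3),
        t = Pi.single i ((a, (0 : Q.E)) ⊗ₜ[K] ((0 : P.E), b)) ∨
        t = Pi.single i (((0 : P.E), b) ⊗ₜ[K] (a, (0 : Q.E)))})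
  stable := isStable_stableSpan _ _

end Black

/-! ### Presentations by non-symmetric, commutative and anti-commutative operations -/

section Presentation

/-- The generators of an operad with `p` non-symmetric operations (each spanning, together with
its opposite, a copy of the regular representation `K × K` of `S₂`), `q` commutative and `r`
anti-commutative ones. -/
abbrev Gen (K : Type u) (p q r : ℕ) : Type u :=
  (Fin p → K × K) × (Fin q → K) × (Fin r → K)

variable {K : Type u} [Field K] {p q r : ℕ}

/-- The `i`-th non-symmetric operation. -/
def dot (i : Fin p) : Gen K p q r := (Pi.single i (1, 0), 0, 0)

/-- The opposite of the `i`-th non-symmetric operation. -/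
def dotop (i : Fin p) : Gen K p q r := (Pi.single i (0, 1), 0, 0)

/-- The `j`-th commutative operation. -/
def bul (j : Fin q) : Gen K p q r := (0, Pi.single j 1, 0)

/-- The `k`-th anti-commutative operation. -/
def brk (k : Fin r) : Gen K p q r := (0, 0, Pi.single k 1)

/-- The map `e ↦ e^op` on generators. -/
def gswap : Gen K p q r →ₗ[K] Gen K p q r where
  toFun e := (fun i => ((e.1 i).2, (e.1 i).1), e.2.1, -e.2.2)
  map_add' e f := by
    refine Prod.ext rfl (Prod.ext rfl ?_)
    simp
    abel
  map_smul' c e := by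
    refine Prod.ext rfl (Prod.ext rfl ?_)
    simp

theorem gswap_gswap (e : Gen K p q r) : gswap (gswap e) = e := by
  simp [gswap]

/-- The operad with `p` non-symmetric, `q` commutative and `r` anti-commutative generating
operations and the given relators. -/
abbrev pres (S : Set (Tern K (Gen K p q r))) : Quad K where
  E := Gen K p q r
  swap := gswap
  swap_swap := gswap_gswap
  R := stableSpan gswap S
  stable := isStable_stableSpan _ _

/-- The composite `μ(ν(x_i,x_j),x_k)` in generators. -/
abbrev L (μ ν : Gen K p q r) (i j k : Fin 3) : Tern K (Gen K p q r) := treeL gswap μ ν i j k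

/-- The composite `μ(x_i,ν(x_j,x_k))` in generators. -/
abbrev M (μ ν : Gen K p q r) (i j k : Fin 3) : Tern K (Gen K p q r) := treeR gswap μ ν i j k

/-- The associator `(x_i x_j) x_k - x_i (x_j x_k)`. -/
def assoc (μ : Gen K p q r) (i j k : Fin 3) : Tern K (Gen K p q r) := L μ μ i j k - M μ μ i j k

/-- The right pre-Lie relator `(x y) z - x (y z) - (x z) y + x (z y)`. -/
def preLieRel (μ : Gen K p q r) : Tern K (Gen K p q r) := assoc μ 0 1 2 - assoc μ 0 2 1

/-- The Jacobi relator `[[x,y],z] + [[y,z],x] + [[z,x],y]`. -/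
def jacobi (β : Gen K p q r) : Tern K (Gen K p q r) := L β β 0 1 2 + L β β 1 2 0 + L β β 2 0 1

variable (K)

/-- Associative algebras. -/
abbrev Ass : Quad K := pres (p := 1) (q := 0) (r := 0) {assoc (dot 0) 0 1 2}

/-- Commutative and associative algebras. -/
abbrev Com : Quad K := pres (p := 0) (q := 1) (r := 0) {assoc (bul 0) 0 1 2}

/-- Lie algebras. -/
abbrev Lie : Quad K := pres (p := 0) (q := 0) (r := 1) {jacobi (brk 0)}

/-- Right pre-Lie algebras. -/
abbrev PreLie : Quad K := pres (p := 1) (q := 0) (r := 0) {preLieRel (dot 0)}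

/-- Two-step nilpotent Lie algebras: `[[x,y],z] = 0`. -/
abbrev NilLie : Quad K := pres (p := 0) (q := 0) (r := 1) {L (brk 0) (brk 0) 0 1 2}

/-- Commutative Poisson algebras: `•` is commutative and associative, `[-,-]` is a Lie bracket
and `[x, y • z] = [x, y] • z + y • [x, z]`. -/
abbrev Pois : Quad K :=
  let b : Gen K 0 1 1 := bul 0
  let l : Gen K 0 1 1 := brk 0
  pres {assoc b 0 1 2, jacobi l, M l b 0 1 2 - L b l 0 1 2 - M b l 1 0 2}

/-- Right post-Lie algebras: `[-,-]` is a Lie bracket, `[x,y]·z = [x,y·z] + [x·z,y]` and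
`x·(y·z - z·y + [y,z]) = (x·y)·z - (x·z)·y`. -/
abbrev PostLie : Quad K :=
  let m : Gen K 1 0 1 := dot 0
  let l : Gen K 1 0 1 := brk 0
  pres {jacobi l,
    L m l 0 1 2 - M l m 0 1 2 - L l m 0 2 1,
    M m m 0 1 2 - M m m 0 2 1 + M m l 0 1 2 - L m m 0 1 2 + L m m 0 2 1}

/-- Lie admissible algebras: the commutator `x·y - y·x` satisfies the Jacobi identity. -/
abbrev LieAdm : Quad K := pres (p := 1) (q := 0) (r := 0) {jacobi (dot 0 - dotop 0)}

/-- Two operations `∘` (number `0`) and `∗` (number `1`) with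
`(x∘y)∘z = x∘(y∘z) = 0`, `∗` associative, and
`(x∗y)∘z = x∗(y∘z) = x∘(y∗z) = (x∘y)∗z`. -/
abbrev AssPois : Quad K :=
  let c : Gen K 2 0 0 := dot 0
  let a : Gen K 2 0 0 := dot 1
  pres {L c c 0 1 2, M c c 0 1 2, assoc a 0 1 2,
    L c a 0 1 2 - M a c 0 1 2, M a c 0 1 2 - M c a 0 1 2, M c a 0 1 2 - L a c 0 1 2}

/-- Right pre-Poisson algebras: `∘` (number `0`) is right Zinbiel, i.e.
`(x∘y)∘z = x∘(y∘z + z∘y)`, the product `∗` (number `1`) is right pre-Lie, and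
`x∗(y∘z + z∘y) = (x∗y)∘z + (x∗z)∘y`, `y∘(x∗z - z∗x) = (y∗x)∘z - (y∘z)∗x`. -/
abbrev PrePois : Quad K :=
  let c : Gen K 2 0 0 := dot 0
  let a : Gen K 2 0 0 := dot 1
  let cop : Gen K 2 0 0 := dotop 0
  let aop : Gen K 2 0 0 := dotop 1
  pres {L c c 0 1 2 - M c (c + cop) 0 1 2, preLieRel a,
    M a (c + cop) 0 1 2 - L c a 0 1 2 - L c a 0 2 1,
    M c (a - aop) 1 0 2 - L c a 1 0 2 + L a c 1 2 0}

/-- Dendriform trialgebras: operations `≺` (number `0`), `≻` (number `1`), `∗` (number `2`). -/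
abbrev Tridend : Quad K :=
  let p : Gen K 3 0 0 := dot 0
  let s : Gen K 3 0 0 := dot 1
  let a : Gen K 3 0 0 := dot 2
  pres {L p p 0 1 2 - M p (p + s + a) 0 1 2,
    L p s 0 1 2 - M s p 0 1 2,
    L s (p + s + a) 0 1 2 - M s s 0 1 2,
    L a s 0 1 2 - M s a 0 1 2,
    L a p 0 1 2 - M a s 0 1 2,
    L p a 0 1 2 - M a p 0 1 2,
    assoc a 0 1 2}

/-- A non-symmetric operation `⋆` and a commutative operation `⊛` with
`(x⊛y)⊛z = x⊛(y⊛z)`, `(x⊛y)⋆z = x⊛(y⋆z)` and `(x⋆y)⋆z = x⋆(y⋆z + z⋆y + y⊛z)`. -/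
abbrev PostCom : Quad K :=
  let s : Gen K 1 1 0 := dot 0
  let sop : Gen K 1 1 0 := dotop 0
  let c : Gen K 1 1 0 := bul 0
  pres {assoc c 0 1 2, L s c 0 1 2 - M c s 0 1 2, L s s 0 1 2 - M s (s + sop + c) 0 1 2}

/-- Two operations `≺` (number `0`), `≻` (number `1`) such that `x≺y + x≻y` is associative. -/
abbrev AssAdm : Quad K := pres (p := 2) (q := 0) (r := 0) {assoc (dot 0 + dot 1) 0 1 2}

/-- One operation `⋆` such that `x⋆y + y⋆x` is associative. -/
abbrev ComAdm : Quad K := pres (p := 1) (q := 0) (r := 0) {assoc (dot 0 + dotop 0) 0 1 2}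

/-- Two operations `≺` (number `0`), `≻` (number `1`) such that `x≺y + x≻y` is right pre-Lie. -/
abbrev PreLieAdm : Quad K := pres (p := 2) (q := 0) (r := 0) {preLieRel (dot 0 + dot 1)}

end Presentation

/-! ### Algebras and dg algebras over a binary quadratic operad -/

section Algebra

variable {K : Type u} [Field K]

/-- Bilinear operations on `V`. -/
abbrev Bil (K : Type u) [Field K] (V : Type v) [AddCommGroup V] [Module K V] : Type v :=
  V →ₗ[K] V →ₗ[K] V

section Eval

variable {E : Type w} [AddCommGroup E] [Module K E] {V : Type v} [AddCommGroup V] [Module K V]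

/-- `μ ⊗ ν ↦ μ(ν(x,y),z)`, for operations `a : E → Bil V`. -/
def comp (a : E →ₗ[K] Bil K V) (x y z : V) : E ⊗[K] E →ₗ[K] V :=
  TensorProduct.lift (LinearMap.mk₂ K (fun μ ν => a μ (a ν x y) z)
    (by simp) (by simp) (by simp) (by simp))

/-- The value of a ternary composite at `x₀, x₁, x₂`. -/
def evalTern (a : E →ₗ[K] Bil K V) (t : Tern K E) (x : Fin 3 → V) : V :=
  ∑ i, comp a (x i) (x (i + 1)) (x (i + 2)) (t i)

/-- The Koszul sign of the reordering of `x₀,x₁,x₂` into `x_i,x_{i+1},x_{i+2}`, for variables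
of degrees `n 0, n 1, n 2`. -/
def koszul (n : Fin 3 → ℕ) : Fin 3 → ℤ :=
  ![1, (-1) ^ (n 0 * (n 1 + n 2)), (-1) ^ (n 2 * (n 0 + n 1))]

/-- The value of a ternary composite at homogeneous elements of degrees `n 0, n 1, n 2`. -/
def evalGraded (a : E →ₗ[K] Bil K V) (t : Tern K E) (n : Fin 3 → ℕ) (x : Fin 3 → V) : V :=
  ∑ i, koszul n i • comp a (x i) (x (i + 1)) (x (i + 2)) (t i)

/-- The composites `treeL` are evaluated as their description says. -/
theorem evalTern_treeL (σ : E →ₗ[K] E) (a : E →ₗ[K] Bil K V)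
    (ha : ∀ e x y, a (σ e) x y = a e y x) (μ ν : E) (x : Fin 3 → V) (i j k : Fin 3)
    (hij : i ≠ j) (hjk : j ≠ k) (hik : i ≠ k) :
    evalTern a (treeL σ μ ν i j k) x = a μ (a ν (x i) (x j)) (x k) := by
  fin_cases i <;> fin_cases j <;> fin_cases k <;>
    simp_all [evalTern, treeL, comp, Fin.sum_univ_three, Pi.single_apply]

/-- The composites `treeR` are evaluated as their description says. -/
theorem evalTern_treeR (σ : E →ₗ[K] E) (a : E →ₗ[K] Bil K V)
    (ha : ∀ e x y, a (σ e) x y = a e y x) (μ ν : E) (x : Fin 3 → V) (i j k : Fin 3)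
    (hij : i ≠ j) (hjk : j ≠ k) (hik : i ≠ k) :
    evalTern a (treeR σ μ ν i j k) x = a μ (x i) (a ν (x j) (x k)) := by
  rw [treeR, evalTern_treeL σ a ha _ _ _ _ _ _ hjk hik.symm hij.symm, ha]

end Eval

/-- `O`-algebra structures on a vector space `V`. -/
structure IsAlg (O : Quad K) {V : Type v} [AddCommGroup V] [Module K V]
    (a : O.E →ₗ[K] Bil K V) : Prop where
  symm : ∀ e x y, a (O.swap e) x y = a e y x
  rel : ∀ r ∈ O.R, ∀ x : Fin 3 → V, evalTern a r x = 0

/-- dg `O`-algebra structures on a complex `A` with grading `gr` and differential `d` of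
degree one. -/
structure IsDGAlg (O : Quad K) {A : Type v} [AddCommGroup A] [Module K A]
    (gr : ℕ → Submodule K A) (d : A →ₗ[K] A) (a : O.E →ₗ[K] Bil K A) : Prop where
  deg : ∀ e m n, ∀ x ∈ gr m, ∀ y ∈ gr n, a e x y ∈ gr (m + n)
  symm : ∀ e m n, ∀ x ∈ gr m, ∀ y ∈ gr n,
    a (O.swap e) x y = (-1 : ℤ) ^ (m * n) • a e y x
  leibniz : ∀ e m, ∀ x ∈ gr m, ∀ y, d (a e x y) = a e (d x) y + (-1 : ℤ) ^ m • a e x (d y)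
  rel : ∀ r ∈ O.R, ∀ (n : Fin 3 → ℕ) (x : Fin 3 → A), (∀ i, x i ∈ gr (n i)) →
    evalGraded a r n x = 0

/-- dg ideals of a dg `O`-algebra. -/
def IsDGIdeal (O : Quad K) {A : Type v} [AddCommGroup A] [Module K A]
    (d : A →ₗ[K] A) (a : O.E →ₗ[K] Bil K A) (I : Submodule K A) : Prop :=
  (∀ x ∈ I, d x ∈ I) ∧ ∀ e, ∀ x ∈ I, ∀ y, a e x y ∈ I ∧ a e y x ∈ I

/-- The operations on `V` given by arbitrary values on the generators: `f i` for the `i`-th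
non-symmetric generator, `g j` for the `j`-th commutative and `h k` for the `k`-th
anti-commutative one. -/
def ofOps {V : Type v} [AddCommGroup V] [Module K V] {p q r : ℕ}
    (f : Fin p → Bil K V) (g : Fin q → Bil K V) (h : Fin r → Bil K V) :
    Gen K p q r →ₗ[K] Bil K V where
  toFun e := ∑ i, ((e.1 i).1 • f i + (e.1 i).2 • (f i).flip) + ∑ j, e.2.1 j • g j +
    ∑ k, e.2.2 k • h k
  map_add' e e' := by
    simp only [Prod.fst_add, Prod.snd_add, Pi.add_apply, add_smul, Finset.sum_add_distrib]
    abel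
  map_smul' c e := by
    simp only [Prod.smul_fst, Prod.smul_snd, Pi.smul_apply, smul_eq_mul, mul_smul,
      Finset.smul_sum, smul_add, RingHom.id_apply]

end Algebra

/-! ### Cochains on the interval -/

section Cochains

variable (K : Type u) [Field K] (V : Type v) [AddCommGroup V] [Module K V]

/-- Non-degenerate cochains on the interval with coefficients in `V`: the triple `(x, y, z)` has
value `x` at the left vertex, `y` at the right vertex and `z` on the edge. -/
abbrev Cochain (V : Type v) : Type v := V × V × V

namespace Cochain

/-- `x` at the left vertex. -/
def left : V →ₗ[K] Cochain V := LinearMap.inl K V (V × V)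

/-- `x` at the right vertex. -/
def right : V →ₗ[K] Cochain V := LinearMap.inr K V (V × V) ∘ₗ LinearMap.inl K V V

/-- `x` on the edge. -/
def edge : V →ₗ[K] Cochain V := LinearMap.inr K V (V × V) ∘ₗ LinearMap.inr K V V

/-- Value at the left vertex. -/
def atLeft : Cochain V →ₗ[K] V := LinearMap.fst K V (V × V)

/-- Value at the right vertex. -/
def atRight : Cochain V →ₗ[K] V := LinearMap.fst K V V ∘ₗ LinearMap.snd K V (V × V)

/-- Value on the edge. -/
def onEdge : Cochain V →ₗ[K] V := LinearMap.snd K V V ∘ₗ LinearMap.snd K V (V × V)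

/-- The differential `(x, y, z) ↦ (0, 0, y - x)`. -/
def d : Cochain V →ₗ[K] Cochain V := edge K V ∘ₗ (atRight K V - atLeft K V)

/-- The grading: vertices in degree `0`, the edge in degree `1`. -/
def gr : ℕ → Submodule K (Cochain V)
  | 0 => LinearMap.range (left K V) ⊔ LinearMap.range (right K V)
  | 1 => LinearMap.range (edge K V)
  | _ => ⊥

/-- Cochains relative to the left vertex. -/
def relLeft : Submodule K (Cochain V) := LinearMap.ker (atLeft K V)

/-- Cochains relative to the right vertex. -/
def relRight : Submodule K (Cochain V) := LinearMap.ker (atRight K V)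

/-- Cochains relative to the boundary. -/
def relBoundary : Submodule K (Cochain V) := relLeft K V ⊓ relRight K V

end Cochain

/-- Cochains on the interval relative to the left vertex: the pair `(y, z)` has value `y` at the
right vertex and `z` on the edge. -/
abbrev RelCochain (V : Type v) : Type v := V × V

namespace RelCochain

/-- `x` at the right vertex. -/
def right : V →ₗ[K] RelCochain V := LinearMap.inl K V V

/-- `x` on the edge. -/
def edge : V →ₗ[K] RelCochain V := LinearMap.inr K V V

/-- Value on the edge. -/
def onEdge : RelCochain V →ₗ[K] V := LinearMap.snd K V V

/-- The differential `(y, z) ↦ (0, y)`. -/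
def d : RelCochain V →ₗ[K] RelCochain V := edge K V ∘ₗ LinearMap.fst K V V

/-- The grading. -/
def gr : ℕ → Submodule K (RelCochain V)
  | 0 => LinearMap.range (right K V)
  | 1 => LinearMap.range (edge K V)
  | _ => ⊥

/-- The inclusion into all cochains. -/
def incl : RelCochain V →ₗ[K] Cochain V := LinearMap.inr K V (V × V)

theorem range_incl : LinearMap.range (incl K V) = Cochain.relLeft K V := by
  ext ⟨x, y, z⟩
  simp [incl, Cochain.relLeft, Cochain.atLeft, eq_comm]

theorem incl_d (c : RelCochain V) : incl K V (d K V c) = Cochain.d K V (incl K V c) := by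
  simp [incl, d, Cochain.d, edge, Cochain.edge, Cochain.atLeft, Cochain.atRight]

end RelCochain

variable {K V}

/-- `Ass_•(O)`-algebra structures on `V`: local dg `O`-algebra structures on the cochains of the
interval with coefficients in `V`. -/
structure IsAssBullet (O : Quad K) (a : O.E →ₗ[K] Bil K (Cochain V)) : Prop where
  dg : IsDGAlg O (Cochain.gr K V) (Cochain.d K V) a
  ideal_left : IsDGIdeal O (Cochain.d K V) a (Cochain.relLeft K V)
  ideal_right : IsDGIdeal O (Cochain.d K V) a (Cochain.relRight K V)
  ideal_boundary : IsDGIdeal O (Cochain.d K V) a (Cochain.relBoundary K V)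

/-- `Com_•(O)`-algebra structures on `V`: `Ass_•(O)`-algebra structures such that the associated
`O`-algebra structure on `V`, read off at the right vertex, is trivial. -/
def IsComBullet (O : Quad K) (a : O.E →ₗ[K] Bil K (Cochain V)) : Prop :=
  IsAssBullet O a ∧
    ∀ e x y, Cochain.atRight K V (a e (Cochain.right K V x) (Cochain.right K V y)) = 0

/-- `preLie_•(O)`-algebra structures on `V`: dg `O`-algebra structures on the cochains relative
to the left vertex. -/
def IsPreLieBullet (O : Quad K) (a : O.E →ₗ[K] Bil K (RelCochain V)) : Prop :=
  IsDGAlg O (RelCochain.gr K V) (RelCochain.d K V) a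

/-- The operation `x, y ↦ (edge x)·(right y)` on `V` (the value is supported on the edge). It is
written `≺`, `∘` or `∗` according to the symmetry of the operation `m`. -/
def prec (m : Bil K (Cochain V)) : Bil K V :=
  (m.compl₁₂ (Cochain.edge K V) (Cochain.right K V)).compr₂ (Cochain.onEdge K V)

/-- The operation `≻` on `V` with `(right x)·(edge y) = -edge (y ≻ x)`. -/
def succ (m : Bil K (Cochain V)) : Bil K V :=
  -((m.compl₁₂ (Cochain.right K V) (Cochain.edge K V)).compr₂ (Cochain.onEdge K V)).flip

/-- The analogue of `prec` for cochains relative to the left vertex. -/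
def precRel (m : Bil K (RelCochain V)) : Bil K V :=
  (m.compl₁₂ (RelCochain.edge K V) (RelCochain.right K V)).compr₂ (RelCochain.onEdge K V)

/-- The analogue of `succ` for cochains relative to the left vertex. -/
def succRel (m : Bil K (RelCochain V)) : Bil K V :=
  -((m.compl₁₂ (RelCochain.right K V) (RelCochain.edge K V)).compr₂
    (RelCochain.onEdge K V)).flip

end Cochains

end BinaryOperad

end

/-! Both kinds of structure to be compared, algebras over a black product and dg structures on
cochains, are governed by one linear map `c : O.E → Bil K V`, the products of the edge with the
right vertex.

Rigidity. In a local dg structure the product of a left and a right vertex cochain lies in both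
relative ideals and has degree zero, so it vanishes. The Leibniz rule then expresses all other
products through `c`, so the structure equals `cochainOps O c` (`IsAssBullet.eq_cochainOps`). As
only degrees 0 and 1 occur, Koszul signs play no role, and the structure is dg exactly when it is a
plain `O`-algebra (`isAssBullet_cochainOps_iff`). The induced structure on `V` is the sum of `c e`
and the opposite of `c (e^op)`; it is trivial when `c` is equivariant up to the sign representation.

Black products. Differentiating relations shows that they need only be tested with one argument at
the left vertex, one on the edge and one at the right vertex (`isAlg_cochainOps_iff`). There the
shape multiplying right by left dies, and the two others evaluate as the two shapes in an
associator. The value of a relator `s` is thus the value of `Ψ(associator ⊗ s)`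
(`evalTern_black_ass`, `evalTern_black_com`), and algebras over the black product are the maps `c`
for which `cochainOps O c` is an algebra. Without the left vertex the test placement is edge, right,
right; the product of two right vertices has two terms, so the four terms of the pre-Lie relator
appear (`evalTern_black_preLie`).

From algebras to operads. The free algebra on three generators shows that relators are the ternary
composites vanishing in every algebra (`mem_of_forall_isAlg`). An equivariant bijection of
generators is therefore an isomorphism of operads as soon as both sides have the same algebras.

Each black product item thus reduces to one equivalence, called `core`: `b` is an algebra over the
right-hand operad if and only if the cochain operations built from `b ∘ ψ` form an `O`-algebra,
where `ψ` matches generators. It is proved by writing the generating relators of `O` at all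
placements. The morphisms of operads come from explicit combinations of relators. -/

noncomputable section

namespace BinaryOperad

/-! ### Evaluation of ternary composites and stable spans of relators -/

section Eval

variable {K : Type u} [Field K] {E : Type w} [AddCommGroup E] [Module K E]
  {V : Type v} [AddCommGroup V] [Module K V]

@[simp]
theorem comp_tmul (a : E →ₗ[K] Bil K V) (x y z : V) (μ ν : E) :
    comp a x y z (μ ⊗ₜ ν) = a μ (a ν x y) z := by
  simp [comp]

theorem comp_add₁ (a : E →ₗ[K] Bil K V) (x x' y z : V) (t : E ⊗[K] E) :
    comp a (x + x') y z t = comp a x y z t + comp a x' y z t := by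
  induction t with
  | zero => simp
  | tmul μ ν => simp
  | add s t hs ht => rw [map_add, map_add, map_add, hs, ht]; abel

theorem comp_add₂ (a : E →ₗ[K] Bil K V) (x y y' z : V) (t : E ⊗[K] E) :
    comp a x (y + y') z t = comp a x y z t + comp a x y' z t := by
  induction t with
  | zero => simp
  | tmul μ ν => simp
  | add s t hs ht => rw [map_add, map_add, map_add, hs, ht]; abel

theorem comp_add₃ (a : E →ₗ[K] Bil K V) (x y z z' : V) (t : E ⊗[K] E) :
    comp a x y (z + z') t = comp a x y z t + comp a x y z' t := by
  induction t with
  | zero => simp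
  | tmul μ ν => simp
  | add s t hs ht => rw [map_add, map_add, map_add, hs, ht]; abel

theorem comp_map_swap {σ : E →ₗ[K] E} {a : E →ₗ[K] Bil K V}
    (ha : ∀ e x y, a (σ e) x y = a e y x) (x y z : V) (t : E ⊗[K] E) :
    comp a x y z (TensorProduct.map LinearMap.id σ t) = comp a y x z t := by
  induction t with
  | zero => simp
  | tmul μ ν => simp [ha]
  | add s t hs ht => simp [hs, ht]

theorem comp_map {F : Type*} [AddCommGroup F] [Module K F] (a : F →ₗ[K] Bil K V)
    (φ : E →ₗ[K] F) (x y z : V) (t : E ⊗[K] E) :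
    comp a x y z (TensorProduct.map φ φ t) = comp (a ∘ₗ φ) x y z t := by
  induction t with
  | zero => simp
  | tmul μ ν => simp
  | add s t hs ht => simp [hs, ht]

theorem evalTern_eq (a : E →ₗ[K] Bil K V) (t : Tern K E) (x : Fin 3 → V) :
    evalTern a t x = comp a (x 0) (x 1) (x 2) (t 0) + comp a (x 1) (x 2) (x 0) (t 1) +
      comp a (x 2) (x 0) (x 1) (t 2) := by
  simp [evalTern, Fin.sum_univ_three]

/-- `evalTern` as a linear map of the ternary composite. -/
def evalLin (a : E →ₗ[K] Bil K V) (x : Fin 3 → V) : Tern K E →ₗ[K] V where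
  toFun t := evalTern a t x
  map_add' s t := by simp [evalTern, Finset.sum_add_distrib]
  map_smul' c t := by simp [evalTern, Finset.smul_sum]

@[simp]
theorem evalTern_zero (a : E →ₗ[K] Bil K V) (x : Fin 3 → V) :
    evalTern a (0 : Tern K E) x = 0 :=
  (evalLin a x).map_zero

@[simp]
theorem evalTern_add (a : E →ₗ[K] Bil K V) (s t : Tern K E) (x : Fin 3 → V) :
    evalTern a (s + t) x = evalTern a s x + evalTern a t x :=
  (evalLin a x).map_add s t

@[simp]
theorem evalTern_sub (a : E →ₗ[K] Bil K V) (s t : Tern K E) (x : Fin 3 → V) :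
    evalTern a (s - t) x = evalTern a s x - evalTern a t x :=
  (evalLin a x).map_sub s t

@[simp]
theorem evalTern_neg (a : E →ₗ[K] Bil K V) (t : Tern K E) (x : Fin 3 → V) :
    evalTern a (-t) x = -evalTern a t x :=
  (evalLin a x).map_neg t

@[simp]
theorem evalTern_smul (a : E →ₗ[K] Bil K V) (k : K) (t : Tern K E) (x : Fin 3 → V) :
    evalTern a (k • t) x = k • evalTern a t x :=
  (evalLin a x).map_smul k t

theorem evalTern_rot (a : E →ₗ[K] Bil K V) (t : Tern K E) (x : Fin 3 → V) :
    evalTern a (rot t) x = evalTern a t ![x 1, x 2, x 0] := by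
  simp [evalTern_eq, rot]
  rw [show (-1 : Fin 3) = 2 from rfl]
  abel

theorem evalTern_flip {σ : E →ₗ[K] E} {a : E →ₗ[K] Bil K V}
    (ha : ∀ e x y, a (σ e) x y = a e y x) (t : Tern K E) (x : Fin 3 → V) :
    evalTern a (flip σ t) x = evalTern a t ![x 1, x 0, x 2] := by
  simp [evalTern_eq, flip, comp_map_swap ha]
  rw [show (-1 : Fin 3) = 2 from rfl, show (-2 : Fin 3) = 1 from rfl]
  abel

theorem evalTern_ternMap {F : Type*} [AddCommGroup F] [Module K F] (a : F →ₗ[K] Bil K V)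
    (φ : E →ₗ[K] F) (t : Tern K E) (x : Fin 3 → V) :
    evalTern a (ternMap φ t) x = evalTern (a ∘ₗ φ) t x := by
  simp [evalTern, ternMap, comp_map]

theorem stableSpan_le {σ : E →ₗ[K] E} {S : Set (Tern K E)} {R : Submodule K (Tern K E)}
    (hS : S ⊆ R) (hR : IsStable σ R) : stableSpan σ S ≤ R :=
  sInf_le ⟨hS, hR⟩

theorem subset_stableSpan {σ : E →ₗ[K] E} {S : Set (Tern K E)} :
    S ⊆ stableSpan σ S := fun _ hs => Submodule.mem_sInf.2 fun _ hR => hR.1 hs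

theorem forall_fin_three {V : Type*} {p : (Fin 3 → V) → Prop} :
    (∀ x, p x) ↔ ∀ x y z, p ![x, y, z] := by
  refine ⟨fun h x y z => h _, fun h x => ?_⟩
  have : x = ![x 0, x 1, x 2] := by ext i; fin_cases i <;> rfl
  rw [this]
  exact h _ _ _

/-- If `G` is closed under permutations, the relators that vanish on `G` form a stable space. -/
theorem evalTern_eq_zero_of_stableSpan {σ : E →ₗ[K] E} {a : E →ₗ[K] Bil K V}
    (ha : ∀ e x y, a (σ e) x y = a e y x) {S : Set (Tern K E)} {G : Set (Fin 3 → V)}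
    (hrot : ∀ x ∈ G, ![x 1, x 2, x 0] ∈ G) (hflip : ∀ x ∈ G, ![x 1, x 0, x 2] ∈ G)
    (h : ∀ s ∈ S, ∀ x ∈ G, evalTern a s x = 0) :
    ∀ s ∈ stableSpan σ S, ∀ x ∈ G, evalTern a s x = 0 := by
  -- Permuting the arguments of a composite stays within `G`, so this subspace is stable and
  -- minimality of the stable span applies. A general `G` is needed later for sets of placements of
  -- edge and vertex cochains.
  let R : Submodule K (Tern K E) :=
    { carrier := {s | ∀ x ∈ G, evalTern a s x = 0}
      zero_mem' := by simp
      add_mem' := by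
        intro s t hs ht x hx
        simp [hs x hx, ht x hx]
      smul_mem' := by
        intro c s hs x hx
        simp [hs x hx] }
  have : stableSpan σ S ≤ R := by
    refine stableSpan_le h ⟨fun r hr x hx => ?_, fun r hr x hx => ?_⟩
    · rw [evalTern_rot]; exact hr _ (hrot x hx)
    · rw [evalTern_flip ha]; exact hr _ (hflip x hx)
  exact this

/-- Permuting a relator amounts to permuting its arguments, which are arbitrary; hence generating
relators suffice. -/
theorem isAlg_iff_of_eq_stableSpan {O : Quad K} {S : Set (Tern K O.E)}
    (hS : O.R = stableSpan O.swap S) {a : O.E →ₗ[K] Bil K V}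
    (ha : ∀ e x y, a (O.swap e) x y = a e y x) :
    IsAlg O a ↔ ∀ s ∈ S, ∀ x y z, evalTern a s ![x, y, z] = 0 := by
  constructor
  · intro h s hs x y z
    exact h.rel s (hS ▸ subset_stableSpan hs) _
  · intro h
    refine ⟨ha, fun r hr x => ?_⟩
    rw [hS] at hr
    exact evalTern_eq_zero_of_stableSpan ha (G := Set.univ) (by simp) (by simp)
      (fun s hs x _ => forall_fin_three (p := fun x => evalTern a s x = 0).2 (h s hs) x) r hr x trivial

/-- A ternary composite vanishes if it vanishes on a generating set. -/
theorem evalTern_eq_zero_of_closure {a : E →ₗ[K] Bil K V} {t : Tern K E} {s : Set V}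
    (hs : AddSubmonoid.closure s = ⊤)
    (h : ∀ x ∈ s, ∀ y ∈ s, ∀ z ∈ s, evalTern a t ![x, y, z] = 0) (x y z : V) :
    evalTern a t ![x, y, z] = 0 := by
  -- Evaluation is additive in each argument separately, so vanishing spreads from `s` to `V` one
  -- slot at a time.
  let f₃ (x y : V) : V →+ V := AddMonoidHom.mk' (fun z => evalTern a t ![x, y, z]) fun z z' => by
    simp [evalTern_eq, comp_add₁, comp_add₂, comp_add₃]; abel
  let f₂ (x z : V) : V →+ V := AddMonoidHom.mk' (fun y => evalTern a t ![x, y, z]) fun z z' => by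
    simp [evalTern_eq, comp_add₁, comp_add₂, comp_add₃]; abel
  let f₁ (y z : V) : V →+ V := AddMonoidHom.mk' (fun x => evalTern a t ![x, y, z]) fun z z' => by
    simp [evalTern_eq, comp_add₁, comp_add₂, comp_add₃]; abel
  have key (f : V →+ V) (hf : ∀ x ∈ s, f x = 0) (x : V) : f x = 0 :=
    DFunLike.congr_fun (AddMonoidHom.eq_of_eqOn_denseM hs (g := 0) hf) x
  exact key (f₁ y z) (fun x hx => key (f₂ x z) (fun y hy => key (f₃ x y) (h x hx y hy) z) y) x

end Eval

/-! ### The free algebra on three generators detects relators -/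

section Universal

variable {K : Type u} [Field K]

/-- The underlying space of the free `P`-algebra on three generators, truncated to its
components that are multilinear in the generators. -/
abbrev FreeThree (P : Quad K) : Type u := (Fin 3 → K) × (Fin 3 → P.E) × (Tern K P.E ⧸ P.R)

/-- The operations of `FreeThree P`. -/
def freeThreeOps (P : Quad K) : P.E →ₗ[K] Bil K (FreeThree P) where
  -- `u.1 k` is the coefficient of the `k`-th variable and `u.2.1 k` is the operation applied to
  -- variables `k`, `k + 1`. Products in which a variable repeats, or of total degree above three,
  -- are dropped.
  toFun e := LinearMap.mk₂ K (fun u v =>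
      (0, fun k => (u.1 k * v.1 (k + 1)) • e + (u.1 (k + 1) * v.1 k) • P.swap e,
        P.R.mkQ fun k => v.1 (k + 2) • (e ⊗ₜ u.2.1 k) + u.1 (k + 2) • (P.swap e ⊗ₜ v.2.1 k)))
    (by
      intro u u' v
      refine Prod.ext (by simp) (Prod.ext ?_ ?_)
      · ext k; simp; module
      · simp only [Prod.snd_add, ← map_add]
        congr 1; ext k; simp [tmul_add]; module)
    (by
      intro c u v
      refine Prod.ext (by simp) (Prod.ext ?_ ?_)
      · ext k; simp; module
      · simp only [Prod.smul_snd, ← map_smul]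
        congr 1; ext k; simp; module)
    (by
      intro u u' v
      refine Prod.ext (by simp) (Prod.ext ?_ ?_)
      · ext k; simp; module
      · simp only [Prod.snd_add, ← map_add]
        congr 1; ext k; simp [tmul_add]; module)
    (by
      intro c u v
      refine Prod.ext (by simp) (Prod.ext ?_ ?_)
      · ext k; simp; module
      · simp only [Prod.smul_snd, ← map_smul]
        congr 1; ext k; simp; module)
  map_add' e e' := by
    refine LinearMap.ext₂ fun u v => Prod.ext (by simp) (Prod.ext ?_ ?_)
    · ext k; simp; module
    · simp only [LinearMap.mk₂_apply, LinearMap.add_apply, Prod.snd_add, ← map_add]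
      congr 1; ext k; simp [add_tmul]; module
  map_smul' c e := by
    refine LinearMap.ext₂ fun u v => Prod.ext (by simp) (Prod.ext ?_ ?_)
    · ext k; simp; module
    · simp only [LinearMap.mk₂_apply, LinearMap.smul_apply, Prod.smul_snd, ← map_smul]
      congr 1; ext k; simp [← smul_tmul', smul_smul]; module

theorem freeThreeOps_apply (P : Quad K) (e : P.E) (u v : FreeThree P) :
    freeThreeOps P e u v =
      (0, fun k => (u.1 k * v.1 (k + 1)) • e + (u.1 (k + 1) * v.1 k) • P.swap e,
        P.R.mkQ fun k => v.1 (k + 2) • (e ⊗ₜ u.2.1 k) + u.1 (k + 2) • (P.swap e ⊗ₜ v.2.1 k)) :=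
  rfl

theorem freeThreeOps_swap (P : Quad K) (e : P.E) (u v : FreeThree P) :
    freeThreeOps P (P.swap e) u v = freeThreeOps P e v u := by
  simp only [freeThreeOps_apply, P.swap_swap]
  refine Prod.ext rfl (Prod.ext ?_ ?_)
  · ext k; simp only; module
  · simp only
    congr 1; ext k; module

theorem comp_freeThreeOps (P : Quad K) (u v w : FreeThree P) (t : P.E ⊗[K] P.E) :
    comp (freeThreeOps P) u v w t = (0, 0, P.R.mkQ fun k =>
      w.1 (k + 2) • ((u.1 k * v.1 (k + 1)) • t + (u.1 (k + 1) * v.1 k) •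
        TensorProduct.map LinearMap.id P.swap t)) := by
  induction t with
  | zero =>
    have : (fun _ => 0 : Tern K P.E) = 0 := rfl
    simp [this]; rfl
  | tmul μ ν =>
    rw [comp_tmul, freeThreeOps_apply, freeThreeOps_apply]
    refine Prod.ext rfl (Prod.ext ?_ ?_)
    · ext k; simp
    · simp [tmul_add]
  | add s t hs ht =>
    rw [map_add, hs, ht]
    refine Prod.ext (by simp) (Prod.ext (by simp) ?_)
    simp only [Prod.snd_add, ← map_add]
    congr 1; ext k; simp; module

/-- Expanding the arguments in the three variables turns the value of a relator into the class of a
combination of its six permutations, all of which lie in the stable space `P.R`. -/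
theorem isAlg_freeThreeOps (P : Quad K) : IsAlg P (freeThreeOps P) := by
  refine ⟨freeThreeOps_swap P, fun r hr x => ?_⟩
  have h1 := P.stable.1
  have h2 := P.stable.2
  -- Coefficients of the even (`A`) and odd (`B`) assignments of variables to the three arguments.
  let A (m : Fin 3) : K := (x 0).1 m * (x 1).1 (m + 1) * (x 2).1 (m + 2)
  let B (m : Fin 3) : K := (x 0).1 (m + 1) * (x 1).1 m * (x 2).1 (m + 2)
  have key : (A 0 • r + A 1 • rot r + A 2 • rot (rot r)) +
      (B 0 • flip P.swap r + B 1 • rot (flip P.swap r) + B 2 • rot (rot (flip P.swap r))) ∈ P.R :=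
    add_mem (add_mem (add_mem (P.R.smul_mem _ hr) (P.R.smul_mem _ (h1 _ hr)))
        (P.R.smul_mem _ (h1 _ (h1 _ hr))))
      (add_mem (add_mem (P.R.smul_mem _ (h2 _ hr)) (P.R.smul_mem _ (h1 _ (h2 _ hr))))
        (P.R.smul_mem _ (h1 _ (h1 _ (h2 _ hr)))))
  rw [← Submodule.Quotient.mk_eq_zero, ← Submodule.mkQ_apply] at key
  simp only [evalTern_eq, comp_freeThreeOps]
  refine Prod.ext (by simp) (Prod.ext (by simp) ?_)
  simp only [Prod.snd_add, ← map_add, Prod.snd_zero]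
  rw [← key]
  congr 1
  ext k
  fin_cases k <;> simp [rot, flip, A, B, show (-1 : Fin 3) = 2 from rfl, show (-2 : Fin 3) = 1 from rfl] <;>
    module

/-- The variables of `FreeThree P`. -/
def freeThreeVar (P : Quad K) (i : Fin 3) : FreeThree P := (Pi.single i 1, 0, 0)

/-- At the variables themselves only the identity assignment survives, so the class of `t` modulo
the relators is recovered. -/
theorem evalTern_freeThreeVar (P : Quad K) (t : Tern K P.E) :
    evalTern (freeThreeOps P) t (freeThreeVar P) = (0, 0, P.R.mkQ t) := by
  simp only [evalTern_eq, comp_freeThreeOps]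
  refine Prod.ext (by simp) (Prod.ext (by simp) ?_)
  simp only [Prod.snd_add, ← map_add]
  congr 1
  ext k
  fin_cases k <;> simp [freeThreeVar, Pi.single_apply] 

/-- The relators of an operad are the ternary composites that vanish in all algebras. -/
theorem mem_of_forall_isAlg {P : Quad K} {t : Tern K P.E}
    (h : ∀ (V : Type u) [AddCommGroup V] [Module K V] (b : P.E →ₗ[K] Bil K V), IsAlg P b →
      ∀ x, evalTern b t x = 0) : t ∈ P.R := by
  have := h _ _ (isAlg_freeThreeOps P) (freeThreeVar P)
  rw [evalTern_freeThreeVar] at this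
  simpa using this

theorem isHom_of_forall_isAlg {P Q : Quad K} {φ : P.E →ₗ[K] Q.E}
    (hφ : ∀ e, φ (P.swap e) = Q.swap (φ e))
    (h : ∀ (V : Type u) [AddCommGroup V] [Module K V] (b : Q.E →ₗ[K] Bil K V), IsAlg Q b →
      IsAlg P (b ∘ₗ φ)) : IsHom P Q φ := by
  refine ⟨hφ, fun r hr => mem_of_forall_isAlg fun V _ _ b hb x => ?_⟩
  rw [evalTern_ternMap]
  exact (h V b hb).rel r hr x

theorem ternMap_comp {E F G : Type*} [AddCommGroup E] [Module K E] [AddCommGroup F] [Module K F]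
    [AddCommGroup G] [Module K G] (φ : E →ₗ[K] F) (ψ : F →ₗ[K] G) (t : Tern K E) :
    ternMap ψ (ternMap φ t) = ternMap (ψ ∘ₗ φ) t := by
  ext i
  simp [ternMap, TensorProduct.map_comp]

theorem ternMap_id {E : Type*} [AddCommGroup E] [Module K E] (t : Tern K E) :
    ternMap (LinearMap.id : E →ₗ[K] E) t = t := by
  ext i
  simp [ternMap]

/-- A bijection of generators is an isomorphism of operads if both operads have the same
algebras. -/
theorem isomorphic_of_forall_isAlg {P Q : Quad K} (φ : P.E ≃ₗ[K] Q.E)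
    (hφ : ∀ e, φ (P.swap e) = Q.swap (φ e))
    (h : ∀ (V : Type u) [AddCommGroup V] [Module K V] (b : Q.E →ₗ[K] Bil K V),
      (∀ e x y, b (Q.swap e) x y = b e y x) → (IsAlg Q b ↔ IsAlg P (b ∘ₗ φ.toLinearMap))) :
    Isomorphic P Q := by
  refine ⟨φ, hφ, le_antisymm ?_ ?_⟩
  · rintro _ ⟨r, hr, rfl⟩
    exact (isHom_of_forall_isAlg hφ fun V _ _ b hb => (h V b hb.symm).1 hb).2 r hr
  · intro r hr
    -- The reverse inclusion of relators is the same criterion applied to the inverse bijection.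
    have hψ : IsHom Q P φ.symm.toLinearMap := by
      have hs : ∀ e, φ.symm (Q.swap e) = P.swap (φ.symm e) := fun e =>
        φ.injective (by simp [hφ])
      refine isHom_of_forall_isAlg hs fun V _ _ b hb => ?_
      refine (h V _ fun e x y => ?_).2 ?_
      · simp [hs, hb.symm]
      · convert hb
        ext e
        simp
    refine ⟨_, hψ.2 r hr, ?_⟩
    rw [ternMap_comp]
    convert ternMap_id r
    ext e
    simp

end Universal

/-! ### Rigidity of local dg structures on cochains of the interval -/

section CochainOps

variable {K : Type u} [Field K] {V : Type v} [AddCommGroup V] [Module K V]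

open Cochain

/-- `precLin a e = prec (a e)`, as a linear map. -/
def precLin {E : Type w} [AddCommGroup E] [Module K E] (a : E →ₗ[K] Bil K (Cochain V)) :
    E →ₗ[K] Bil K V where
  toFun e := prec (a e)
  map_add' e f := by ext; simp [prec]
  map_smul' c e := by ext; simp [prec]

@[simp]
theorem precLin_apply {E : Type w} [AddCommGroup E] [Module K E]
    (a : E →ₗ[K] Bil K (Cochain V)) (e : E) : precLin a e = prec (a e) := rfl

/-- The operations on cochains whose products of an edge with the right vertex are given by `c`. -/
def cochainOps (O : Quad K) (c : O.E →ₗ[K] Bil K V) : O.E →ₗ[K] Bil K (Cochain V) where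
  toFun e := LinearMap.mk₂ K (fun X Y =>
      (c e X.1 Y.1 + c (O.swap e) Y.1 X.1, c e X.2.1 Y.2.1 + c (O.swap e) Y.2.1 X.2.1,
        c e X.1 Y.2.2 + c e X.2.2 Y.2.1 + c (O.swap e) Y.1 X.2.2 + c (O.swap e) Y.2.2 X.2.1))
    (by intro X X' Y; ext <;> simp <;> abel)
    (by intro k X Y; ext <;> simp)
    (by intro X X' Y; ext <;> simp <;> abel)
    (by intro k X Y; ext <;> simp)
  map_add' e f := by
    refine LinearMap.ext₂ fun X Y => ?_
    ext <;> simp <;> abel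
  map_smul' k e := by
    refine LinearMap.ext₂ fun X Y => ?_
    ext <;> simp

variable (O : Quad K) (c : O.E →ₗ[K] Bil K V)

theorem cochainOps_apply (e : O.E) (X Y : Cochain V) :
    cochainOps O c e X Y = (c e X.1 Y.1 + c (O.swap e) Y.1 X.1,
      c e X.2.1 Y.2.1 + c (O.swap e) Y.2.1 X.2.1,
      c e X.1 Y.2.2 + c e X.2.2 Y.2.1 + c (O.swap e) Y.1 X.2.2 + c (O.swap e) Y.2.2 X.2.1) := rfl

theorem cochainOps_swap (e : O.E) (X Y : Cochain V) :
    cochainOps O c (O.swap e) X Y = cochainOps O c e Y X := by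
  simp only [cochainOps_apply, O.swap_swap]
  ext <;> simp only <;> abel

theorem Cochain.left_apply (x : V) : left K V x = (x, 0, 0) := rfl

theorem Cochain.right_apply (x : V) : right K V x = (0, x, 0) := rfl

theorem Cochain.edge_apply (x : V) : edge K V x = (0, 0, x) := rfl

@[simp]
theorem cochainOps_left_left (e : O.E) (x y : V) : cochainOps O c e (left K V x) (left K V y) =
    left K V (c e x y + c (O.swap e) y x) := by
  simp [cochainOps_apply, left_apply]

@[simp]
theorem cochainOps_right_right (e : O.E) (x y : V) :
    cochainOps O c e (right K V x) (right K V y) = right K V (c e x y + c (O.swap e) y x) := by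
  simp [cochainOps_apply, right_apply]

@[simp]
theorem cochainOps_left_right (e : O.E) (x y : V) :
    cochainOps O c e (left K V x) (right K V y) = 0 := by
  simp [cochainOps_apply, left_apply, right_apply]

@[simp]
theorem cochainOps_right_left (e : O.E) (x y : V) :
    cochainOps O c e (right K V x) (left K V y) = 0 := by
  simp [cochainOps_apply, left_apply, right_apply]

@[simp]
theorem cochainOps_edge_edge (e : O.E) (x y : V) :
    cochainOps O c e (edge K V x) (edge K V y) = 0 := by
  simp [cochainOps_apply, edge_apply]

@[simp]
theorem cochainOps_left_edge (e : O.E) (x y : V) :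
    cochainOps O c e (left K V x) (edge K V y) = edge K V (c e x y) := by
  simp [cochainOps_apply, left_apply, edge_apply]

@[simp]
theorem cochainOps_edge_right (e : O.E) (x y : V) :
    cochainOps O c e (edge K V x) (right K V y) = edge K V (c e x y) := by
  simp [cochainOps_apply, right_apply, edge_apply]

@[simp]
theorem cochainOps_edge_left (e : O.E) (x y : V) :
    cochainOps O c e (edge K V x) (left K V y) = edge K V (c (O.swap e) y x) := by
  simp [cochainOps_apply, left_apply, edge_apply]

@[simp]
theorem cochainOps_right_edge (e : O.E) (x y : V) :
    cochainOps O c e (right K V x) (edge K V y) = edge K V (c (O.swap e) y x) := by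
  simp [cochainOps_apply, right_apply, edge_apply]

@[simp]
theorem prec_cochainOps (e : O.E) : prec (cochainOps O c e) = c e := by
  ext x y
  change (cochainOps O c e (edge K V x) (right K V y)).2.2 = _
  rw [cochainOps_edge_right]
  rfl

theorem succ_cochainOps (e : O.E) : succ (cochainOps O c e) = -c (O.swap e) := by
  ext x y
  change -(cochainOps O c e (right K V y) (edge K V x)).2.2 = _
  rw [cochainOps_right_edge]
  rfl

theorem closure_cochain : AddSubmonoid.closure
    (Set.range (left K V) ∪ Set.range (right K V) ∪ Set.range (edge K V)) = ⊤ := by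
  refine (AddSubmonoid.eq_top_iff' _).2 fun X => ?_
  have : X = left K V X.1 + right K V X.2.1 + edge K V X.2.2 := by
    simp [left_apply, right_apply, edge_apply]
  rw [this]
  exact add_mem (add_mem (AddSubmonoid.subset_closure (by simp))
    (AddSubmonoid.subset_closure (by simp))) (AddSubmonoid.subset_closure (by simp))

theorem Cochain.mem_gr_zero {X : Cochain V} : X ∈ gr K V 0 ↔ X.2.2 = 0 := by
  simp only [gr, Submodule.mem_sup, LinearMap.mem_range]
  constructor
  · rintro ⟨_, ⟨x, rfl⟩, _, ⟨y, rfl⟩, rfl⟩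
    simp [left_apply, right_apply]
  · intro h
    refine ⟨_, ⟨X.1, rfl⟩, _, ⟨X.2.1, rfl⟩, ?_⟩
    exact Prod.ext (by simp [left_apply, right_apply]) (Prod.ext (by simp [left_apply, right_apply])
      (by simp [left_apply, right_apply, h]))

theorem Cochain.mem_gr_one {X : Cochain V} : X ∈ gr K V 1 ↔ X.1 = 0 ∧ X.2.1 = 0 := by
  simp only [gr, LinearMap.mem_range]
  constructor
  · rintro ⟨x, rfl⟩
    simp [edge_apply]
  · rintro ⟨h1, h2⟩
    exact ⟨X.2.2, Prod.ext h1.symm (Prod.ext h2.symm rfl)⟩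

theorem Cochain.mem_gr_add_two {X : Cochain V} (n : ℕ) : X ∈ gr K V (n + 2) ↔ X = 0 := by
  simp [gr]

/-- Graded and ungraded evaluation agree in a complex concentrated in degrees `0` and `1`. -/
theorem evalGraded_eq_evalTern {E : Type*} [AddCommGroup E] [Module K E]
    {A : Type*} [AddCommGroup A] [Module K A] {G : ℕ → Submodule K A}
    (hG : ∀ n, G (n + 2) = ⊥) {a : E →ₗ[K] Bil K A}
    (ha : ∀ e m n, ∀ x ∈ G m, ∀ y ∈ G n, a e x y ∈ G (m + n)) (t : Tern K E) {n : Fin 3 → ℕ}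
    {x : Fin 3 → A} (hx : ∀ i, x i ∈ G (n i)) : evalGraded a t n x = evalTern a t x := by
  have hc {k l m : ℕ} {x y z : A} (hx : x ∈ G k) (hy : y ∈ G l) (hz : z ∈ G m)
      (t : E ⊗[K] E) : comp a x y z t ∈ G (k + l + m) := by
    induction t with
    | zero => simp
    | tmul μ ν =>
      rw [comp_tmul]
      exact ha _ _ _ _ (ha _ _ _ _ hx _ hy) _ hz
    | add s t hs ht => rw [map_add]; exact add_mem hs ht
  -- In total degree at least two every composite lands in a zero space. Otherwise at most one
  -- argument has odd degree and all Koszul signs are `1`.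
  by_cases h : 2 ≤ n 0 + n 1 + n 2
  · obtain ⟨k, hk⟩ := Nat.exists_eq_add_of_le' h
    have h0 (i : Fin 3) : comp a (x i) (x (i + 1)) (x (i + 2)) (t i) = 0 := by
      have := hc (hx i) (hx (i + 1)) (hx (i + 2)) (t i)
      rwa [show n i + n (i + 1) + n (i + 2) = k + 2 by
        rw [← hk]; fin_cases i <;> simp <;> ring, hG, Submodule.mem_bot] at this
    simp [evalGraded, evalTern, h0]
  · have h0 : n 0 * (n 1 + n 2) = 0 := by
      rw [Nat.mul_eq_zero]; omega
    have h2 : n 2 * (n 0 + n 1) = 0 := by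
      rw [Nat.mul_eq_zero]; omega
    simp [evalGraded, evalTern, koszul, Fin.sum_univ_three, h0, h2]

theorem Cochain.forall_gr_induction {p : ℕ → Cochain V → Prop} (h0 : ∀ x y, p 0 (x, y, 0))
    (h1 : ∀ z, p 1 (0, 0, z)) (h2 : ∀ n, p (n + 2) 0) : ∀ n, ∀ X ∈ gr K V n, p n X
  | 0, (x, y, z), h => by
    obtain rfl : z = 0 := mem_gr_zero.1 h
    exact h0 x y
  | 1, (x, y, z), h => by
    obtain ⟨rfl, rfl⟩ : x = 0 ∧ y = 0 := mem_gr_one.1 h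
    exact h1 z
  | n + 2, X, h => by
    rw [(mem_gr_add_two n).1 h]
    exact h2 n

theorem cochainOps_mem_gr (e : O.E) (m n : ℕ) (X : Cochain V) (hX : X ∈ gr K V m)
    (Y : Cochain V) (hY : Y ∈ gr K V n) : cochainOps O c e X Y ∈ gr K V (m + n) := by
  revert m X n Y
  have (m : ℕ) (X : Cochain V) (hX : X ∈ gr K V m) :
      ∀ n, ∀ Y ∈ gr K V n, cochainOps O c e X Y ∈ gr K V (m + n) := by
    refine forall_gr_induction ?_ ?_ (fun n => by rw [map_zero]; exact zero_mem _) <;> revert m X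
    · intro m X hX y y'
      revert m X
      refine forall_gr_induction ?_ ?_ (fun n => by simp) <;> intros <;>
        simp [mem_gr_zero, mem_gr_one, cochainOps_apply]
    · intro m X hX y
      revert m X
      refine forall_gr_induction ?_ ?_ (fun n => by simp) <;> intros <;>
        simp [cochainOps_apply, gr, edge_apply]
  intro m n X hX Y hY
  exact this m X hX n Y hY

/-- dg algebra structures given by `cochainOps` are the same as plain algebra structures. -/
theorem isAssBullet_cochainOps_iff :
    IsAssBullet O (cochainOps O c) ↔ IsAlg O (cochainOps O c) := by
  constructor
  · intro h
    refine ⟨cochainOps_swap O c, fun r hr x => ?_⟩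
    revert x
    rw [forall_fin_three]
    -- Homogeneous elements span, and on them the graded evaluation is the plain one.
    refine evalTern_eq_zero_of_closure (closure_cochain (K := K)) ?_
    have hs : ∀ X ∈ (Set.range (left K V) ∪ Set.range (right K V) ∪ Set.range (edge K V)),
        ∃ n, X ∈ gr K V n := by
      rintro _ ((⟨x, rfl⟩ | ⟨x, rfl⟩) | ⟨x, rfl⟩)
      · exact ⟨0, by simp [mem_gr_zero, left_apply]⟩
      · exact ⟨0, by simp [mem_gr_zero, right_apply]⟩
      · exact ⟨1, by simp [mem_gr_one, edge_apply]⟩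
    intro X hX Y hY Z hZ
    obtain ⟨l, hl⟩ := hs X hX
    obtain ⟨m, hm⟩ := hs Y hY
    obtain ⟨n, hn⟩ := hs Z hZ
    have hh : ∀ i, ![X, Y, Z] i ∈ gr K V (![l, m, n] i) := by
      intro i; fin_cases i <;> assumption
    rw [← evalGraded_eq_evalTern (fun _ => rfl) (cochainOps_mem_gr O c) r hh]
    exact h.dg.rel r hr _ _ hh
  · intro h
    refine ⟨⟨cochainOps_mem_gr O c, ?_, ?_, fun r hr n x hx => ?_⟩, ?_, ?_, ?_⟩
    · intro e m n X hX Y hY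
      rw [cochainOps_swap]
      -- A sign can only occur for two factors of positive degree, and their product vanishes for
      -- degree reasons.
      by_cases hmn : m * n = 0
      · simp [hmn]
      · have h0 : cochainOps O c e Y X = 0 := by
          have := cochainOps_mem_gr O c e n m Y hY X hX
          obtain ⟨k, hk⟩ : ∃ k, n + m = k + 2 := by
            rw [Nat.mul_eq_zero] at hmn
            exact ⟨n + m - 2, by omega⟩
          rwa [hk, mem_gr_add_two] at this
        simp [h0]
    · intro e m X hX Y
      revert m X
      refine forall_gr_induction ?_ ?_ ?_
      · intro x x'
        simp [cochainOps_apply, d, edge_apply, atLeft, atRight]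
        abel
      · intro z
        simp [cochainOps_apply, d, edge_apply, atLeft, atRight]
      · simp
    · rw [evalGraded_eq_evalTern (fun _ => rfl) (cochainOps_mem_gr O c) r hx]
      exact h.rel r hr x
    · refine ⟨?_, ?_⟩ <;> simp +contextual [relLeft, atLeft, d, edge_apply, cochainOps_apply]
    · refine ⟨?_, ?_⟩ <;>
        simp +contextual [relRight, atRight, d, edge_apply, cochainOps_apply]
    · refine ⟨?_, ?_⟩ <;>
        simp +contextual [relBoundary, relLeft, atLeft, relRight, atRight, d, edge_apply,
          cochainOps_apply]

/-- A local dg structure is determined by the products of the edge with the right vertex. -/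
theorem IsAssBullet.eq_cochainOps {O : Quad K} {a : O.E →ₗ[K] Bil K (Cochain V)}
    (h : IsAssBullet O a) : a = cochainOps O (precLin a) := by
  have hl (x : V) : left K V x ∈ gr K V 0 := by simp [mem_gr_zero, left_apply]
  have hr (x : V) : right K V x ∈ gr K V 0 := by simp [mem_gr_zero, right_apply]
  have he (x : V) : edge K V x ∈ gr K V 1 := by simp [mem_gr_one, edge_apply]
  have hlL (x : V) : left K V x ∈ relRight K V := by simp [left_apply, relRight, atRight]
  have hrL (x : V) : right K V x ∈ relLeft K V := by simp [right_apply, relLeft, atLeft]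
  have dl (x : V) : d K V (left K V x) = -edge K V x := by
    simp [d, left_apply, edge_apply, atLeft, atRight]
  have dr (x : V) : d K V (right K V x) = edge K V x := by
    simp [d, right_apply, edge_apply, atLeft, atRight]
  have er (e : O.E) (x y : V) :
      a e (edge K V x) (right K V y) = edge K V (prec (a e) x y) := by
    have := mem_gr_one.1 (h.dg.deg e 1 0 _ (he x) _ (hr y))
    refine Prod.ext this.1 (Prod.ext this.2 rfl)
  have re (e : O.E) (x y : V) :
      a e (right K V x) (edge K V y) = edge K V (prec (a (O.swap e)) y x) := by
    rw [← er, h.dg.symm e 1 0 _ (he y) _ (hr x)]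
    simp
  -- The product belongs to the ideals relative to both vertices, and degree zero leaves no edge
  -- component.
  have lr (e : O.E) (x y : V) : a e (left K V x) (right K V y) = 0 := by
    refine Prod.ext ((h.ideal_left.2 e _ (hrL y) _).2) (Prod.ext
      ((h.ideal_right.2 e _ (hlL x) _).1) (mem_gr_zero.1 (h.dg.deg e 0 0 _ (hl x) _ (hr y))))
  have rl (e : O.E) (x y : V) : a e (right K V x) (left K V y) = 0 := by
    refine Prod.ext ((h.ideal_left.2 e _ (hrL x) _).1) (Prod.ext
      ((h.ideal_right.2 e _ (hlL y) _).2) (mem_gr_zero.1 (h.dg.deg e 0 0 _ (hr x) _ (hl y))))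
  -- Differentiating the vanishing product left times right: the two Leibniz terms, edge times right
  -- and left times edge, must cancel, with `d` of a left cochain being minus the edge.
  have le (e : O.E) (x y : V) :
      a e (left K V x) (edge K V y) = edge K V (prec (a e) x y) := by
    have := h.dg.leibniz e 0 _ (hl x) (right K V y)
    rw [lr, dl, dr, map_neg, LinearMap.neg_apply, er] at this
    simp at this
    rwa [eq_comm, neg_add_eq_zero, eq_comm] at this
  have el (e : O.E) (x y : V) :
      a e (edge K V x) (left K V y) = edge K V (prec (a (O.swap e)) y x) := by
    rw [← le, h.dg.symm e 0 1 _ (hl y) _ (he x)]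
    simp
  have ee (e : O.E) (x y : V) : a e (edge K V x) (edge K V y) = 0 :=
    (mem_gr_add_two 0).1 (h.dg.deg e 1 1 _ (he x) _ (he y))
  -- The ideal relative to the left vertex leaves only the right vertex value, on which the
  -- differential is injective; the Leibniz rule then computes it.
  have rr (e : O.E) (x y : V) : a e (right K V x) (right K V y) =
      right K V (prec (a e) x y + prec (a (O.swap e)) y x) := by
    have hd := h.dg.leibniz e 0 _ (hr x) (right K V y)
    rw [dr, dr, er, re] at hd
    have h0 := (h.ideal_left.2 e _ (hrL x) (right K V y)).1
    have h2 := mem_gr_zero.1 (h.dg.deg e 0 0 _ (hr x) _ (hr y))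
    refine Prod.ext h0 (Prod.ext ?_ h2)
    have h1 := congrArg (fun X : Cochain V => X.2.2) hd
    have h0' : (a e (right K V x) (right K V y)).1 = 0 := h0
    simp [d, edge_apply, atLeft, atRight, h0'] at h1
    exact h1
  have ll (e : O.E) (x y : V) : a e (left K V x) (left K V y) =
      left K V (prec (a e) x y + prec (a (O.swap e)) y x) := by
    have hd := h.dg.leibniz e 0 _ (hl x) (left K V y)
    rw [dl, dl, map_neg, map_neg, LinearMap.neg_apply, le, el] at hd
    have h0 := (h.ideal_right.2 e _ (hlL x) (left K V y)).1
    have h2 := mem_gr_zero.1 (h.dg.deg e 0 0 _ (hl x) _ (hl y))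
    refine Prod.ext ?_ (Prod.ext h0 h2)
    have h1 := congrArg (fun X : Cochain V => X.2.2) hd
    have h0' : (a e (left K V x) (left K V y)).2.1 = 0 := h0
    simp [d, edge_apply, atLeft, atRight, h0'] at h1
    change _ = prec (a e) x y + _
    rw [← neg_inj, h1]
    abel
  ext e : 1
  refine LinearMap.ext₂ fun X Y => ?_
  have hX (X : Cochain V) : X = left K V X.1 + right K V X.2.1 + edge K V X.2.2 := by
    simp [left_apply, right_apply, edge_apply]
  rw [hX X, hX Y]
  simp only [map_add, LinearMap.add_apply, ll, lr, rl, rr, le, el, re, er, ee,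
    cochainOps_left_left, cochainOps_left_right, cochainOps_right_left, cochainOps_right_right,
    cochainOps_left_edge, cochainOps_edge_left, cochainOps_right_edge, cochainOps_edge_right,
    cochainOps_edge_edge, precLin_apply]

end CochainOps

/-! ### Reduction of the relations on cochains to mixed placements -/

section Mixed

variable {K : Type u} [Field K] {V : Type v} [AddCommGroup V] [Module K V]

open Cochain

theorem vanish_rot {O : Quad K} {a : O.E →ₗ[K] Bil K V} {x y z : V}
    (h : ∀ s ∈ O.R, evalTern a s ![x, y, z] = 0) : ∀ s ∈ O.R, evalTern a s ![y, z, x] = 0 := by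
  intro s hs
  simpa [evalTern_rot] using h _ (O.stable.1 s hs)

theorem vanish_flip {O : Quad K} {a : O.E →ₗ[K] Bil K V}
    (ha : ∀ e x y, a (O.swap e) x y = a e y x) {x y z : V}
    (h : ∀ s ∈ O.R, evalTern a s ![x, y, z] = 0) : ∀ s ∈ O.R, evalTern a s ![y, x, z] = 0 := by
  intro s hs
  simpa [evalTern_flip ha] using h _ (O.stable.2 s hs)

variable (O : Quad K) (c : O.E →ₗ[K] Bil K V)

theorem Cochain.edge_eq_zero {x : V} : edge K V x = 0 ↔ x = 0 := by
  simp [edge_apply]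

theorem comp_edge_edge (x y : V) (Z : Cochain V) (t : O.E ⊗[K] O.E) :
    comp (cochainOps O c) (edge K V x) (edge K V y) Z t = 0 := by
  induction t with
  | zero => simp
  | tmul μ ν => simp
  | add s t hs ht => rw [map_add, hs, ht, add_zero]

theorem comp_edge_mid_edge (x y : V) (Z : Cochain V) (t : O.E ⊗[K] O.E) :
    comp (cochainOps O c) (edge K V x) Z (edge K V y) t = 0 := by
  induction t with
  | zero => simp
  | tmul μ ν => rw [comp_tmul]; simp [cochainOps_apply, edge_apply]
  | add s t hs ht => rw [map_add, hs, ht, add_zero]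

theorem comp_mid_edge_edge (x y : V) (Z : Cochain V) (t : O.E ⊗[K] O.E) :
    comp (cochainOps O c) Z (edge K V x) (edge K V y) t = 0 := by
  induction t with
  | zero => simp
  | tmul μ ν => rw [comp_tmul]; simp [cochainOps_apply, edge_apply]
  | add s t hs ht => rw [map_add, hs, ht, add_zero]

/-- Two edges already have total degree two, where the complex is zero. -/
theorem evalTern_edge_edge (t : Tern K O.E) (x y : V) (Z : Cochain V) :
    evalTern (cochainOps O c) t ![edge K V x, edge K V y, Z] = 0 := by
  simp [evalTern_eq, comp_edge_edge, comp_edge_mid_edge, comp_mid_edge_edge]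

/-- This is the Leibniz rule for a composite of three right vertex cochains, combined with
injectivity of the differential on the right vertex. -/
theorem comp_right (x y z : V) (t : O.E ⊗[K] O.E) :
    comp (cochainOps O c) (right K V x) (right K V y) (right K V z) t = right K V (onEdge K V
      (comp (cochainOps O c) (edge K V x) (right K V y) (right K V z) t +
      comp (cochainOps O c) (right K V x) (edge K V y) (right K V z) t +
      comp (cochainOps O c) (right K V x) (right K V y) (edge K V z) t)) := by
  induction t with
  | zero => simp
  | tmul μ ν => simp [-map_add, -LinearMap.add_apply]; simp [onEdge, edge_apply]
  | add s t hs ht => simp only [map_add, hs, ht]; abel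

theorem comp_left (x y z : V) (t : O.E ⊗[K] O.E) :
    comp (cochainOps O c) (left K V x) (left K V y) (left K V z) t = left K V (onEdge K V
      (comp (cochainOps O c) (edge K V x) (left K V y) (left K V z) t +
      comp (cochainOps O c) (left K V x) (edge K V y) (left K V z) t +
      comp (cochainOps O c) (left K V x) (left K V y) (edge K V z) t)) := by
  induction t with
  | zero => simp
  | tmul μ ν => simp [-map_add, -LinearMap.add_apply]; simp [onEdge, edge_apply]; abel
  | add s t hs ht => simp only [map_add, hs, ht]; abel

/-- The Leibniz rule for the placement left, right, right, where every composite is zero; the edge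
replacing the left vertex carries a minus sign. -/
theorem evalTern_edge_right_right (t : Tern K O.E) (x y z : V) :
    evalTern (cochainOps O c) t ![edge K V x, right K V y, right K V z] =
      evalTern (cochainOps O c) t ![left K V x, edge K V y, right K V z] +
      evalTern (cochainOps O c) t ![left K V x, right K V y, edge K V z] := by
  have h0 (t : O.E ⊗[K] O.E) :
      comp (cochainOps O c) (edge K V x) (right K V y) (right K V z) t =
      comp (cochainOps O c) (left K V x) (edge K V y) (right K V z) t +
      comp (cochainOps O c) (left K V x) (right K V y) (edge K V z) t := by
    induction t with
    | zero => simp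
    | tmul μ ν => simp
    | add s t hs ht => simp only [map_add, hs, ht]; abel
  have h1 (t : O.E ⊗[K] O.E) :
      comp (cochainOps O c) (right K V y) (right K V z) (edge K V x) t =
      comp (cochainOps O c) (edge K V y) (right K V z) (left K V x) t +
      comp (cochainOps O c) (right K V y) (edge K V z) (left K V x) t := by
    induction t with
    | zero => simp
    | tmul μ ν => simp
    | add s t hs ht => simp only [map_add, hs, ht]; abel
  have h2 (t : O.E ⊗[K] O.E) :
      comp (cochainOps O c) (right K V z) (edge K V x) (right K V y) t =
      comp (cochainOps O c) (right K V z) (left K V x) (edge K V y) t +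
      comp (cochainOps O c) (edge K V z) (left K V x) (right K V y) t := by
    induction t with
    | zero => simp
    | tmul μ ν => simp
    | add s t hs ht => simp only [map_add, hs, ht]; abel
  simp only [evalTern_eq, Matrix.cons_val, h0, h1, h2]
  abel

/-- The Leibniz rule for the vanishing placement left, left, right. -/
theorem evalTern_left_left_edge (t : Tern K O.E) (x y z : V) :
    evalTern (cochainOps O c) t ![left K V x, left K V y, edge K V z] =
      evalTern (cochainOps O c) t ![left K V x, edge K V y, right K V z] +
      evalTern (cochainOps O c) t ![edge K V x, left K V y, right K V z] := by
  have h0 (t : O.E ⊗[K] O.E) :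
      comp (cochainOps O c) (left K V x) (left K V y) (edge K V z) t =
      comp (cochainOps O c) (left K V x) (edge K V y) (right K V z) t +
      comp (cochainOps O c) (edge K V x) (left K V y) (right K V z) t := by
    induction t with
    | zero => simp
    | tmul μ ν => simp
    | add s t hs ht => simp only [map_add, hs, ht]; abel
  have h1 (t : O.E ⊗[K] O.E) :
      comp (cochainOps O c) (left K V y) (edge K V z) (left K V x) t =
      comp (cochainOps O c) (edge K V y) (right K V z) (left K V x) t +
      comp (cochainOps O c) (left K V y) (right K V z) (edge K V x) t := by
    induction t with
    | zero => simp
    | tmul μ ν => simp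
    | add s t hs ht => simp only [map_add, hs, ht]; abel
  have h2 (t : O.E ⊗[K] O.E) :
      comp (cochainOps O c) (edge K V z) (left K V x) (left K V y) t =
      comp (cochainOps O c) (right K V z) (left K V x) (edge K V y) t +
      comp (cochainOps O c) (right K V z) (edge K V x) (left K V y) t := by
    induction t with
    | zero => simp
    | tmul μ ν => simp
    | add s t hs ht => simp only [map_add, hs, ht]; abel
  simp only [evalTern_eq, Matrix.cons_val, h0, h1, h2]
  abel

/-- Two left cochains multiply to a left cochain, so each shape contains a product of opposite
vertices. -/
theorem evalTern_left_left_right (t : Tern K O.E) (x y z : V) :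
    evalTern (cochainOps O c) t ![left K V x, left K V y, right K V z] = 0 := by
  have h0 (t : O.E ⊗[K] O.E) :
      comp (cochainOps O c) (left K V x) (left K V y) (right K V z) t = 0 := by
    induction t with
    | zero => simp
    | tmul μ ν => rw [comp_tmul]; simp [cochainOps_apply, left_apply, right_apply]
    | add s t hs ht => rw [map_add, hs, ht, add_zero]
  have h1 (t : O.E ⊗[K] O.E) :
      comp (cochainOps O c) (left K V y) (right K V z) (left K V x) t = 0 := by
    induction t with
    | zero => simp
    | tmul μ ν => simp
    | add s t hs ht => rw [map_add, hs, ht, add_zero]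
  have h2 (t : O.E ⊗[K] O.E) :
      comp (cochainOps O c) (right K V z) (left K V x) (left K V y) t = 0 := by
    induction t with
    | zero => simp
    | tmul μ ν => simp
    | add s t hs ht => rw [map_add, hs, ht, add_zero]
  simp [evalTern_eq, h0, h1, h2]

theorem evalTern_left_right_right (t : Tern K O.E) (x y z : V) :
    evalTern (cochainOps O c) t ![left K V x, right K V y, right K V z] = 0 := by
  have h0 (t : O.E ⊗[K] O.E) :
      comp (cochainOps O c) (left K V x) (right K V y) (right K V z) t = 0 := by
    induction t with
    | zero => simp
    | tmul μ ν => simp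
    | add s t hs ht => rw [map_add, hs, ht, add_zero]
  have h1 (t : O.E ⊗[K] O.E) :
      comp (cochainOps O c) (right K V y) (right K V z) (left K V x) t = 0 := by
    induction t with
    | zero => simp
    | tmul μ ν => rw [comp_tmul]; simp [cochainOps_apply, left_apply, right_apply]
    | add s t hs ht => rw [map_add, hs, ht, add_zero]
  have h2 (t : O.E ⊗[K] O.E) :
      comp (cochainOps O c) (right K V z) (left K V x) (right K V y) t = 0 := by
    induction t with
    | zero => simp
    | tmul μ ν => simp
    | add s t hs ht => rw [map_add, hs, ht, add_zero]
  simp [evalTern_eq, h0, h1, h2]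

/-- All relations on cochains follow from those with one argument on the edge, one at the left
and one at the right vertex. -/
theorem isAlg_cochainOps_iff : IsAlg O (cochainOps O c) ↔ ∀ s ∈ O.R, ∀ x y z,
    evalTern (cochainOps O c) s ![left K V x, edge K V y, right K V z] = 0 := by
  refine ⟨fun h s hs x y z => h.rel s hs _, fun h => ⟨cochainOps_swap O c, ?_⟩⟩
  have ler (x y z : V) := fun s hs => h s hs x y z
  -- The relators form a stable space, so the hypothesis for one placement gives all its
  -- permutations.
  have lre (x y z : V) : ∀ s ∈ O.R,
      evalTern (cochainOps O c) s ![left K V x, right K V y, edge K V z] = 0 :=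
    vanish_rot (vanish_rot (vanish_flip (cochainOps_swap O c) (vanish_rot (ler x z y))))
  have elr (x y z : V) : ∀ s ∈ O.R,
      evalTern (cochainOps O c) s ![edge K V x, left K V y, right K V z] = 0 :=
    vanish_flip (cochainOps_swap O c) (ler y x z)
  have err (x y z : V) : ∀ s ∈ O.R,
      evalTern (cochainOps O c) s ![edge K V x, right K V y, right K V z] = 0 := by
    intro s hs
    rw [evalTern_edge_right_right, ler _ _ _ s hs, lre _ _ _ s hs, add_zero]
  have lle (x y z : V) : ∀ s ∈ O.R,
      evalTern (cochainOps O c) s ![left K V x, left K V y, edge K V z] = 0 := by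
    intro s hs
    rw [evalTern_left_left_edge, ler _ _ _ s hs, elr _ _ _ s hs, add_zero]
  -- Rotations bring the edge into each of the three slots; the three resulting relations add up to
  -- the Leibniz expansion in `comp_right`.
  have rrr (x y z : V) : ∀ s ∈ O.R,
      evalTern (cochainOps O c) s ![right K V x, right K V y, right K V z] = 0 := by
    intro s hs
    have h1 := congrArg (onEdge K V) (err x y z s hs)
    have h2 := congrArg (onEdge K V) (vanish_rot (vanish_rot (err y z x)) s hs)
    have h3 := congrArg (onEdge K V) (vanish_rot (err z x y) s hs)
    simp only [evalTern_eq, Matrix.cons_val, map_add, map_zero] at h1 h2 h3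
    simp only [evalTern_eq, Matrix.cons_val, comp_right, ← map_add]
    rw [← map_zero (right K V)]
    congr 1
    simp only [map_add]
    linear_combination (norm := module) h1 + h2 + h3
  have lll (x y z : V) : ∀ s ∈ O.R,
      evalTern (cochainOps O c) s ![left K V x, left K V y, left K V z] = 0 := by
    intro s hs
    have h1 := congrArg (onEdge K V) (lle x y z s hs)
    have h2 := congrArg (onEdge K V) (vanish_rot (vanish_rot (lle y z x)) s hs)
    have h3 := congrArg (onEdge K V) (vanish_rot (lle z x y) s hs)
    simp only [evalTern_eq, Matrix.cons_val, map_add, map_zero] at h1 h2 h3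
    simp only [evalTern_eq, Matrix.cons_val, comp_left, ← map_add]
    rw [← map_zero (left K V)]
    congr 1
    simp only [map_add]
    linear_combination (norm := module) h1 + h2 + h3
  have ee (x y : V) (Z : Cochain V) : ∀ s ∈ O.R,
      evalTern (cochainOps O c) s ![edge K V x, edge K V y, Z] = 0 :=
    fun s _ => evalTern_edge_edge O c s x y Z
  have llr (x y z : V) : ∀ s ∈ O.R,
      evalTern (cochainOps O c) s ![left K V x, left K V y, right K V z] = 0 :=
    fun s _ => evalTern_left_left_right O c s x y z
  have lrr (x y z : V) : ∀ s ∈ O.R,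
      evalTern (cochainOps O c) s ![left K V x, right K V y, right K V z] = 0 :=
    fun s _ => evalTern_left_right_right O c s x y z
  intro s hs
  rw [forall_fin_three]
  refine evalTern_eq_zero_of_closure (closure_cochain (K := K)) ?_
  have rot1 := @vanish_rot K _ _ _ _ O (cochainOps O c)
  have flip1 := @vanish_flip K _ _ _ _ O (cochainOps O c) (cochainOps_swap O c)
  rintro _ ((⟨x, rfl⟩ | ⟨x, rfl⟩) | ⟨x, rfl⟩) _ ((⟨y, rfl⟩ | ⟨y, rfl⟩) | ⟨y, rfl⟩)
    _ ((⟨z, rfl⟩ | ⟨z, rfl⟩) | ⟨z, rfl⟩) <;> revert s hs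
  · exact lll x y z
  · exact llr x y z
  · exact lle x y z
  · exact rot1 (llr z x y)
  · exact lrr x y z
  · exact lre x y z
  · exact rot1 (lle z x y)
  · exact ler x y z
  · exact rot1 (rot1 (ee y z _))
  · exact rot1 (rot1 (llr y z x))
  · exact rot1 (rot1 (lrr y z x))
  · exact rot1 (rot1 (ler y z x))
  · exact rot1 (lrr z x y)
  · exact rrr x y z
  · exact rot1 (err z x y)
  · exact rot1 (lre z x y)
  · exact rot1 (rot1 (err y z x))
  · exact rot1 (rot1 (ee y z _))
  · exact rot1 (rot1 (lle y z x))
  · exact elr x y z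
  · exact rot1 (ee z x _)
  · exact rot1 (ler z x y)
  · exact err x y z
  · exact rot1 (ee z x _)
  · exact ee x y _
  · exact ee x y _
  · exact ee x y _

/-- The relations on cochains in terms of generating relators. -/
theorem isAlg_cochainOps_iff_of_eq_stableSpan {S : Set (Tern K O.E)}
    (hS : O.R = stableSpan O.swap S) :
    IsAlg O (cochainOps O c) ↔ ∀ s ∈ S, ∀ x y z,
      evalTern (cochainOps O c) s ![left K V x, edge K V y, right K V z] = 0 ∧
      evalTern (cochainOps O c) s ![edge K V x, right K V y, left K V z] = 0 ∧
      evalTern (cochainOps O c) s ![right K V x, left K V y, edge K V z] = 0 ∧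
      evalTern (cochainOps O c) s ![edge K V x, left K V y, right K V z] = 0 ∧
      evalTern (cochainOps O c) s ![left K V x, right K V y, edge K V z] = 0 ∧
      evalTern (cochainOps O c) s ![right K V x, edge K V y, left K V z] = 0 := by
  constructor
  · intro h s hs x y z
    have hs' : s ∈ O.R := hS ▸ subset_stableSpan hs
    exact ⟨h.rel s hs' _, h.rel s hs' _, h.rel s hs' _, h.rel s hs' _, h.rel s hs' _,
      h.rel s hs' _⟩
  · intro h
    rw [isAlg_cochainOps_iff, hS]
    -- The six placements of left, edge and right are closed under permutation. Testing the
    -- generating relators on all of them replaces testing the whole stable span on a single one.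
    let G : Set (Fin 3 → Cochain V) := {X | ∃ x y z,
      X = ![left K V x, edge K V y, right K V z] ∨ X = ![edge K V x, right K V y, left K V z] ∨
      X = ![right K V x, left K V y, edge K V z] ∨ X = ![edge K V x, left K V y, right K V z] ∨
      X = ![left K V x, right K V y, edge K V z] ∨ X = ![right K V x, edge K V y, left K V z]}
    have key := evalTern_eq_zero_of_stableSpan (cochainOps_swap O c) (S := S) (G := G) ?_ ?_ ?_
    · intro s hs x y z
      exact key s hs _ ⟨x, y, z, Or.inl rfl⟩
    · rintro X ⟨x, y, z, rfl | rfl | rfl | rfl | rfl | rfl⟩ <;> refine ⟨y, z, x, ?_⟩ <;> simp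
    · rintro X ⟨x, y, z, rfl | rfl | rfl | rfl | rfl | rfl⟩ <;> refine ⟨y, x, z, ?_⟩ <;> simp
    · rintro s hs X ⟨x, y, z, rfl | rfl | rfl | rfl | rfl | rfl⟩
      exacts [(h s hs x y z).1, (h s hs x y z).2.1, (h s hs x y z).2.2.1,
        (h s hs x y z).2.2.2.1, (h s hs x y z).2.2.2.2.1, (h s hs x y z).2.2.2.2.2]

end Mixed

/-! ### The same analysis for cochains relative to the left vertex -/

section RelCochainOps

variable {K : Type u} [Field K] {V : Type v} [AddCommGroup V] [Module K V]

namespace RelCochain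

theorem right_apply (x : V) : right K V x = (x, 0) := rfl

theorem edge_apply (x : V) : edge K V x = (0, x) := rfl

theorem mem_gr_zero {X : RelCochain V} : X ∈ gr K V 0 ↔ X.2 = 0 := by
  simp only [gr, LinearMap.mem_range]
  constructor
  · rintro ⟨x, rfl⟩
    rfl
  · intro h
    exact ⟨X.1, Prod.ext rfl h.symm⟩

theorem mem_gr_one {X : RelCochain V} : X ∈ gr K V 1 ↔ X.1 = 0 := by
  simp only [gr, LinearMap.mem_range]
  constructor
  · rintro ⟨x, rfl⟩
    rfl
  · intro h
    exact ⟨X.2, Prod.ext h.symm rfl⟩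

theorem mem_gr_add_two {X : RelCochain V} (n : ℕ) : X ∈ gr K V (n + 2) ↔ X = 0 := by
  simp [gr]

theorem forall_gr_induction {p : ℕ → RelCochain V → Prop} (h0 : ∀ x, p 0 (x, 0))
    (h1 : ∀ z, p 1 (0, z)) (h2 : ∀ n, p (n + 2) 0) : ∀ n, ∀ X ∈ gr K V n, p n X
  | 0, (x, z), h => by
    obtain rfl : z = 0 := mem_gr_zero.1 h
    exact h0 x
  | 1, (x, z), h => by
    obtain rfl : x = 0 := mem_gr_one.1 h
    exact h1 z
  | n + 2, X, h => by
    rw [(mem_gr_add_two n).1 h]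
    exact h2 n

theorem edge_eq_zero {x : V} : edge K V x = 0 ↔ x = 0 := by
  simp [edge_apply]

end RelCochain

open RelCochain

/-- `precRelLin a e = precRel (a e)`, as a linear map. -/
def precRelLin {E : Type w} [AddCommGroup E] [Module K E] (a : E →ₗ[K] Bil K (RelCochain V)) :
    E →ₗ[K] Bil K V where
  toFun e := precRel (a e)
  map_add' e f := by ext; simp [precRel]
  map_smul' c e := by ext; simp [precRel]

@[simp]
theorem precRelLin_apply {E : Type w} [AddCommGroup E] [Module K E]
    (a : E →ₗ[K] Bil K (RelCochain V)) (e : E) : precRelLin a e = precRel (a e) := rfl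

/-- The operations on cochains relative to the left vertex whose products of an edge with the
right vertex are given by `c`. -/
def relOps (O : Quad K) (c : O.E →ₗ[K] Bil K V) : O.E →ₗ[K] Bil K (RelCochain V) where
  toFun e := LinearMap.mk₂ K (fun X Y =>
      (c e X.1 Y.1 + c (O.swap e) Y.1 X.1, c e X.2 Y.1 + c (O.swap e) Y.2 X.1))
    (by intro X X' Y; ext <;> simp <;> abel)
    (by intro k X Y; ext <;> simp)
    (by intro X X' Y; ext <;> simp <;> abel)
    (by intro k X Y; ext <;> simp)
  map_add' e f := by
    refine LinearMap.ext₂ fun X Y => ?_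
    ext <;> simp <;> abel
  map_smul' k e := by
    refine LinearMap.ext₂ fun X Y => ?_
    ext <;> simp

variable (O : Quad K) (c : O.E →ₗ[K] Bil K V)

theorem relOps_apply (e : O.E) (X Y : RelCochain V) :
    relOps O c e X Y = (c e X.1 Y.1 + c (O.swap e) Y.1 X.1,
      c e X.2 Y.1 + c (O.swap e) Y.2 X.1) := rfl

theorem relOps_swap (e : O.E) (X Y : RelCochain V) :
    relOps O c (O.swap e) X Y = relOps O c e Y X := by
  simp only [relOps_apply, O.swap_swap]
  ext <;> simp only <;> abel

@[simp]
theorem relOps_right_right (e : O.E) (x y : V) :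
    relOps O c e (right K V x) (right K V y) = right K V (c e x y + c (O.swap e) y x) := by
  simp [relOps_apply, right_apply]

@[simp]
theorem relOps_edge_edge (e : O.E) (x y : V) :
    relOps O c e (edge K V x) (edge K V y) = 0 := by
  simp [relOps_apply, edge_apply]

@[simp]
theorem relOps_edge_right (e : O.E) (x y : V) :
    relOps O c e (edge K V x) (right K V y) = edge K V (c e x y) := by
  simp [relOps_apply, right_apply, edge_apply]

@[simp]
theorem relOps_right_edge (e : O.E) (x y : V) :
    relOps O c e (right K V x) (edge K V y) = edge K V (c (O.swap e) y x) := by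
  simp [relOps_apply, right_apply, edge_apply]

@[simp]
theorem precRel_relOps (e : O.E) : precRel (relOps O c e) = c e := by
  ext x y
  change (relOps O c e (edge K V x) (right K V y)).2 = _
  rw [relOps_edge_right]
  rfl

theorem succRel_relOps (e : O.E) : succRel (relOps O c e) = -c (O.swap e) := by
  ext x y
  change -(relOps O c e (right K V y) (edge K V x)).2 = _
  rw [relOps_right_edge]
  rfl

theorem closure_relCochain : AddSubmonoid.closure
    (Set.range (right K V) ∪ Set.range (edge K V)) = ⊤ := by
  refine (AddSubmonoid.eq_top_iff' _).2 fun X => ?_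
  have : X = right K V X.1 + edge K V X.2 := by
    simp [right_apply, edge_apply]
  rw [this]
  exact add_mem (AddSubmonoid.subset_closure (by simp)) (AddSubmonoid.subset_closure (by simp))

theorem relOps_mem_gr (e : O.E) (m n : ℕ) (X : RelCochain V) (hX : X ∈ gr K V m)
    (Y : RelCochain V) (hY : Y ∈ gr K V n) : relOps O c e X Y ∈ gr K V (m + n) := by
  revert m X n Y
  have (m : ℕ) (X : RelCochain V) (hX : X ∈ gr K V m) :
      ∀ n, ∀ Y ∈ gr K V n, relOps O c e X Y ∈ gr K V (m + n) := by
    refine forall_gr_induction ?_ ?_ (fun n => by rw [map_zero]; exact zero_mem _) <;> revert m X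
    · intro m X hX y
      revert m X
      refine forall_gr_induction ?_ ?_ (fun n => by simp) <;> intros <;>
        simp [mem_gr_zero, mem_gr_one, relOps_apply]
    · intro m X hX y
      revert m X
      refine forall_gr_induction ?_ ?_ (fun n => by simp) <;> intros <;>
        simp [relOps_apply, gr, edge_apply]
  intro m n X hX Y hY
  exact this m X hX n Y hY

/-- dg algebra structures given by `relOps` are the same as plain algebra structures. -/
theorem isPreLieBullet_relOps_iff :
    IsPreLieBullet O (relOps O c) ↔ IsAlg O (relOps O c) := by
  constructor
  · intro h
    refine ⟨relOps_swap O c, fun r hr x => ?_⟩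
    revert x
    rw [forall_fin_three]
    refine evalTern_eq_zero_of_closure (closure_relCochain (K := K)) ?_
    have hs : ∀ X ∈ (Set.range (right K V) ∪ Set.range (edge K V)), ∃ n, X ∈ gr K V n := by
      rintro _ (⟨x, rfl⟩ | ⟨x, rfl⟩)
      · exact ⟨0, by simp [mem_gr_zero, right_apply]⟩
      · exact ⟨1, by simp [mem_gr_one, edge_apply]⟩
    intro X hX Y hY Z hZ
    obtain ⟨l, hl⟩ := hs X hX
    obtain ⟨m, hm⟩ := hs Y hY
    obtain ⟨n, hn⟩ := hs Z hZ
    have hh : ∀ i, ![X, Y, Z] i ∈ gr K V (![l, m, n] i) := by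
      intro i; fin_cases i <;> assumption
    rw [← evalGraded_eq_evalTern (fun _ => rfl) (relOps_mem_gr O c) r hh]
    exact IsDGAlg.rel h r hr _ _ hh
  · intro h
    refine ⟨relOps_mem_gr O c, ?_, ?_, fun r hr n x hx => ?_⟩
    · intro e m n X hX Y hY
      rw [relOps_swap]
      by_cases hmn : m * n = 0
      · simp [hmn]
      · have h0 : relOps O c e Y X = 0 := by
          have := relOps_mem_gr O c e n m Y hY X hX
          obtain ⟨k, hk⟩ : ∃ k, n + m = k + 2 := by
            rw [Nat.mul_eq_zero] at hmn
            exact ⟨n + m - 2, by omega⟩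
          rwa [hk, mem_gr_add_two] at this
        simp [h0]
    · intro e m X hX Y
      revert m X
      refine forall_gr_induction ?_ ?_ ?_
      · intro x
        simp [relOps_apply, d, edge_apply]
      · intro z
        simp [relOps_apply, d, edge_apply]
      · simp
    · rw [evalGraded_eq_evalTern (fun _ => rfl) (relOps_mem_gr O c) r hx]
      exact h.rel r hr x

/-- A dg structure is determined by the products of the edge with the right vertex. -/
theorem IsPreLieBullet.eq_relOps {O : Quad K} {a : O.E →ₗ[K] Bil K (RelCochain V)}
    (h : IsPreLieBullet O a) : a = relOps O (precRelLin a) := by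
  have hd : IsDGAlg O (gr K V) (d K V) a := h
  have hr (x : V) : right K V x ∈ gr K V 0 := by simp [mem_gr_zero, right_apply]
  have he (x : V) : edge K V x ∈ gr K V 1 := by simp [mem_gr_one, edge_apply]
  have dr (x : V) : d K V (right K V x) = edge K V x := by
    simp [d, right_apply, edge_apply]
  have er (e : O.E) (x y : V) :
      a e (edge K V x) (right K V y) = edge K V (precRel (a e) x y) :=
    Prod.ext (mem_gr_one.1 (hd.deg e 1 0 _ (he x) _ (hr y))) rfl
  have re (e : O.E) (x y : V) :
      a e (right K V x) (edge K V y) = edge K V (precRel (a (O.swap e)) y x) := by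
    rw [← er, hd.symm e 1 0 _ (he y) _ (hr x)]
    simp
  have ee (e : O.E) (x y : V) : a e (edge K V x) (edge K V y) = 0 :=
    (mem_gr_add_two 0).1 (hd.deg e 1 1 _ (he x) _ (he y))
  -- No ideal condition is needed here: degree zero consists of the right vertex alone, and the
  -- differential is injective on it.
  have rr (e : O.E) (x y : V) : a e (right K V x) (right K V y) =
      right K V (precRel (a e) x y + precRel (a (O.swap e)) y x) := by
    have hl := hd.leibniz e 0 _ (hr x) (right K V y)
    rw [dr, dr, er, re] at hl
    refine Prod.ext ?_ (mem_gr_zero.1 (hd.deg e 0 0 _ (hr x) _ (hr y)))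
    have h1 := congrArg (fun X : RelCochain V => X.2) hl
    simp [d, edge_apply] at h1
    exact h1
  ext e : 1
  refine LinearMap.ext₂ fun X Y => ?_
  have hX (X : RelCochain V) : X = right K V X.1 + edge K V X.2 := by
    simp [right_apply, edge_apply]
  rw [hX X, hX Y]
  simp only [map_add, LinearMap.add_apply, rr, re, er, ee, relOps_right_right,
    relOps_right_edge, relOps_edge_right, relOps_edge_edge, precRelLin_apply]

/-- Again the Leibniz rule. It makes the relations with three arguments at the right vertex follow
from those with exactly one argument on the edge. -/
theorem comp_relOps_right (x y z : V) (t : O.E ⊗[K] O.E) :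
    comp (relOps O c) (right K V x) (right K V y) (right K V z) t = right K V (onEdge K V
      (comp (relOps O c) (edge K V x) (right K V y) (right K V z) t +
      comp (relOps O c) (right K V x) (edge K V y) (right K V z) t +
      comp (relOps O c) (right K V x) (right K V y) (edge K V z) t)) := by
  induction t with
  | zero => simp
  | tmul μ ν => simp [-map_add, -LinearMap.add_apply]; simp [onEdge, edge_apply]
  | add s t hs ht => simp only [map_add, hs, ht]; abel

theorem evalTern_relOps_edge_edge (t : Tern K O.E) (x y : V) (Z : RelCochain V) :
    evalTern (relOps O c) t ![edge K V x, edge K V y, Z] = 0 := by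
  have h0 (t : O.E ⊗[K] O.E) : comp (relOps O c) (edge K V x) (edge K V y) Z t = 0 := by
    induction t with
    | zero => simp
    | tmul μ ν => simp
    | add s t hs ht => rw [map_add, hs, ht, add_zero]
  have h1 (t : O.E ⊗[K] O.E) : comp (relOps O c) (edge K V y) Z (edge K V x) t = 0 := by
    induction t with
    | zero => simp
    | tmul μ ν => rw [comp_tmul]; simp [relOps_apply, edge_apply]
    | add s t hs ht => rw [map_add, hs, ht, add_zero]
  have h2 (t : O.E ⊗[K] O.E) : comp (relOps O c) Z (edge K V x) (edge K V y) t = 0 := by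
    induction t with
    | zero => simp
    | tmul μ ν => rw [comp_tmul]; simp [relOps_apply, edge_apply]
    | add s t hs ht => rw [map_add, hs, ht, add_zero]
  simp [evalTern_eq, h0, h1, h2]

/-- All relations on relative cochains follow from those with one argument on the edge and two
at the right vertex. -/
theorem isAlg_relOps_iff : IsAlg O (relOps O c) ↔ ∀ s ∈ O.R, ∀ x y z,
    evalTern (relOps O c) s ![edge K V x, right K V y, right K V z] = 0 := by
  refine ⟨fun h s hs x y z => h.rel s hs _, fun h => ⟨relOps_swap O c, ?_⟩⟩
  have err (x y z : V) := fun s hs => h s hs x y z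
  have rrr (x y z : V) : ∀ s ∈ O.R,
      evalTern (relOps O c) s ![right K V x, right K V y, right K V z] = 0 := by
    intro s hs
    have h1 := congrArg (onEdge K V) (err x y z s hs)
    have h2 := congrArg (onEdge K V) (vanish_rot (vanish_rot (err y z x)) s hs)
    have h3 := congrArg (onEdge K V) (vanish_rot (err z x y) s hs)
    simp only [evalTern_eq, Matrix.cons_val, map_add, map_zero] at h1 h2 h3
    simp only [evalTern_eq, Matrix.cons_val, comp_relOps_right, ← map_add]
    rw [← map_zero (right K V)]
    congr 1
    simp only [map_add]
    linear_combination (norm := module) h1 + h2 + h3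
  have ee (x y : V) (Z : RelCochain V) : ∀ s ∈ O.R,
      evalTern (relOps O c) s ![edge K V x, edge K V y, Z] = 0 :=
    fun s _ => evalTern_relOps_edge_edge O c s x y Z
  intro s hs
  rw [forall_fin_three]
  refine evalTern_eq_zero_of_closure (closure_relCochain (K := K)) ?_
  have rot1 := @vanish_rot K _ _ _ _ O (relOps O c)
  rintro _ (⟨x, rfl⟩ | ⟨x, rfl⟩) _ (⟨y, rfl⟩ | ⟨y, rfl⟩) _ (⟨z, rfl⟩ | ⟨z, rfl⟩) <;> revert s hs
  · exact rrr x y z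
  · exact rot1 (err z x y)
  · exact rot1 (rot1 (err y z x))
  · exact rot1 (rot1 (ee y z _))
  · exact err x y z
  · exact rot1 (ee z x _)
  · exact ee x y _
  · exact ee x y _

/-- The relations on relative cochains in terms of generating relators. -/
theorem isAlg_relOps_iff_of_eq_stableSpan {S : Set (Tern K O.E)}
    (hS : O.R = stableSpan O.swap S) :
    IsAlg O (relOps O c) ↔ ∀ s ∈ S, ∀ x y z,
      evalTern (relOps O c) s ![edge K V x, right K V y, right K V z] = 0 ∧
      evalTern (relOps O c) s ![right K V x, edge K V y, right K V z] = 0 ∧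
      evalTern (relOps O c) s ![right K V x, right K V y, edge K V z] = 0 := by
  constructor
  · intro h s hs x y z
    have hs' : s ∈ O.R := hS ▸ subset_stableSpan hs
    exact ⟨h.rel s hs' _, h.rel s hs' _, h.rel s hs' _⟩
  · intro h
    rw [isAlg_relOps_iff, hS]
    let G : Set (Fin 3 → RelCochain V) := {X | ∃ x y z,
      X = ![edge K V x, right K V y, right K V z] ∨ X = ![right K V x, edge K V y, right K V z] ∨
      X = ![right K V x, right K V y, edge K V z]}
    have key := evalTern_eq_zero_of_stableSpan (relOps_swap O c) (S := S) (G := G) ?_ ?_ ?_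
    · intro s hs x y z
      exact key s hs _ ⟨x, y, z, Or.inl rfl⟩
    · rintro X ⟨x, y, z, rfl | rfl | rfl⟩ <;> refine ⟨y, z, x, ?_⟩ <;> simp
    · rintro X ⟨x, y, z, rfl | rfl | rfl⟩ <;> refine ⟨y, x, z, ?_⟩ <;> simp
    · rintro s hs X ⟨x, y, z, rfl | rfl | rfl⟩
      exacts [(h s hs x y z).1, (h s hs x y z).2.1, (h s hs x y z).2.2]

end RelCochainOps

/-! ### Algebras over black products as algebra structures on cochains -/

section BlackAlg

variable {K : Type u} [Field K] {V : Type v} [AddCommGroup V] [Module K V]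

theorem rot_rot_rot {E : Type w} [AddCommGroup E] [Module K E] (t : Tern K E) :
    rot (rot (rot t)) = t := by
  ext i
  simp only [rot]
  congr 1
  fin_cases i <;> rfl

theorem flip_flip {E : Type w} [AddCommGroup E] [Module K E] {σ : E →ₗ[K] E}
    (hσ : ∀ e, σ (σ e) = e) (t : Tern K E) : flip σ (flip σ t) = t := by
  have : σ ∘ₗ σ = LinearMap.id := LinearMap.ext hσ
  ext i
  simp only [flip, neg_neg]
  rw [← LinearMap.comp_apply, ← TensorProduct.map_comp, this]
  simp

theorem blackMap_add_left {E F : Type*} [AddCommGroup E] [Module K E] [AddCommGroup F]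
    [Module K F] (r r' : Tern K E) (s : Tern K F) :
    blackMap (r + r') s = blackMap r s + blackMap r' s := by
  ext i; simp [blackMap, add_tmul]

theorem blackMap_smul_left {E F : Type*} [AddCommGroup E] [Module K E] [AddCommGroup F]
    [Module K F] (k : K) (r : Tern K E) (s : Tern K F) :
    blackMap (k • r) s = k • blackMap r s := by
  ext i; simp [blackMap, ← smul_tmul']

/-- Algebras over a black product in terms of generating relators of the first factor. -/
theorem isAlg_black_iff {P Q : Quad K} {S : Set (Tern K P.E)} (hS : P.R = stableSpan P.swap S)
    {b : (black P Q).E →ₗ[K] Bil K V} (hb : ∀ e x y, b ((black P Q).swap e) x y = b e y x) :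
    IsAlg (black P Q) b ↔ ∀ r ∈ S, ∀ s ∈ Q.R, ∀ x, evalTern b (blackMap r s) x = 0 := by
  constructor
  · intro h r hr s hs x
    exact h.rel _ (Submodule.subset_span ⟨r, hS ▸ subset_stableSpan hr, s, hs, rfl⟩) x
  · intro h
    let R : Submodule K (Tern K P.E) :=
      { carrier := {r | ∀ s ∈ Q.R, ∀ x, evalTern b (blackMap r s) x = 0}
        zero_mem' := by
          intro s _ x
          have : blackMap (0 : Tern K P.E) s = 0 := by ext i; simp [blackMap]
          rw [this, evalTern_zero]
        add_mem' := by
          intro r r' hr hr' s hs x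
          rw [blackMap_add_left, evalTern_add, hr s hs x, hr' s hs x, add_zero]
        smul_mem' := by
          intro k r hr s hs x
          rw [blackMap_smul_left, evalTern_smul, hr s hs x, smul_zero] }
    have hR : P.R ≤ R := by
      rw [hS]
      refine stableSpan_le h ⟨fun r hr s hs x => ?_, fun r hr s hs x => ?_⟩
      -- A permutation of the first factor is moved to the second by equivariance of `Ψ`, and the
      -- relators of `Q` are stable.
      · rw [← rot_rot_rot s]
        change evalTern b (rot (blackMap r (rot (rot s)))) x = 0
        rw [evalTern_rot]
        exact hr _ (Q.stable.1 _ (Q.stable.1 _ hs)) _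
      · rw [← flip_flip Q.swap_swap s, ← neg_neg (blackMap _ _), ← blackMap_flip, evalTern_neg,
          evalTern_flip (σ := (black P Q).swap) hb, hr _ (Q.stable.2 s hs), neg_zero]
    refine ⟨hb, fun t ht x => ?_⟩
    induction ht using Submodule.span_induction with
    | mem t ht =>
      obtain ⟨r, hr, s, hs, rfl⟩ := ht
      exact hR hr s hs x
    | zero => simp
    | add t t' _ _ h h' => rw [evalTern_add, h, h', add_zero]
    | smul k t _ h => rw [evalTern_smul, h, smul_zero]

/-- The operations `e ↦ b (g ⊗ e)`. -/
abbrev slice {E F : Type*} [AddCommGroup E] [Module K E] [AddCommGroup F] [Module K F]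
    (b : E ⊗[K] F →ₗ[K] Bil K V) (g : E) : F →ₗ[K] Bil K V :=
  b ∘ₗ TensorProduct.mk K E F g

@[simp]
theorem gswap_dot {p q r : ℕ} (i : Fin p) : gswap (dot i : Gen K p q r) = dotop i := by
  refine Prod.ext (funext fun j => ?_) (by simp [gswap, dot, dotop])
  by_cases h : j = i
  · subst h; simp [gswap, dot, dotop]
  · simp [gswap, dot, dotop, h]

@[simp]
theorem gswap_dotop {p q r : ℕ} (i : Fin p) : gswap (dotop i : Gen K p q r) = dot i := by
  rw [← gswap_dot, gswap_gswap]

@[simp]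
theorem gswap_bul {p q r : ℕ} (i : Fin q) : gswap (bul i : Gen K p q r) = bul i := by
  refine Prod.ext (funext fun j => ?_) ?_ <;> simp [gswap, bul]

@[simp]
theorem gswap_brk {p q r : ℕ} (i : Fin r) : gswap (brk i : Gen K p q r) = -brk i := by
  refine Prod.ext (funext fun j => ?_) ?_ <;> simp [gswap, brk]

theorem comp_black {P Q : Quad K} (b : (black P Q).E →ₗ[K] Bil K V) (x y z : V) (α β : P.E)
    (μ ν : Q.E) : comp b x y z (TensorProduct.tensorTensorTensorComm K P.E P.E Q.E Q.E
      ((α ⊗ₜ β) ⊗ₜ (μ ⊗ₜ ν))) = b (α ⊗ₜ μ) (b (β ⊗ₜ ν) x y) z := by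
  simp

theorem map_comp_black {P Q : Quad K} {b : (black P Q).E →ₗ[K] Bil K V} {x y z : V} {α β : P.E}
    {W : Type*} [AddCommGroup W] [Module K W] {g : V →ₗ[K] W} {f : Q.E ⊗[K] Q.E →ₗ[K] W}
    (h : ∀ μ ν, g (b (α ⊗ₜ μ) (b (β ⊗ₜ ν) x y) z) = f (μ ⊗ₜ ν)) (t : Q.E ⊗[K] Q.E) :
    g (comp b x y z (TensorProduct.tensorTensorTensorComm K P.E P.E Q.E Q.E
      ((α ⊗ₜ β) ⊗ₜ t))) = f t := by
  induction t with
  | zero => simp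
  | tmul μ ν => rw [comp_black, h]
  | add s t hs ht => rw [tmul_add, map_add, map_add, map_add, hs, ht, map_add]

/-- The minus sign is the sign representation in the generators of the black product. -/
theorem black_ass_dotop {O : Quad K} {b : (black (Ass K) O).E →ₗ[K] Bil K V}
    (hb : ∀ e x y, b ((black (Ass K) O).swap e) x y = b e y x) (e : O.E) (x y : V) :
    b ((dotop 0 : Gen K 1 0 0) ⊗ₜ e) x y = -b ((dot 0 : Gen K 1 0 0) ⊗ₜ O.swap e) y x := by
  rw [← hb]
  simp

theorem black_com_bul {O : Quad K} {b : (black (Com K) O).E →ₗ[K] Bil K V}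
    (hb : ∀ e x y, b ((black (Com K) O).swap e) x y = b e y x) (e : O.E) (x y : V) :
    b ((bul 0 : Gen K 0 1 0) ⊗ₜ O.swap e) x y = -b ((bul 0 : Gen K 0 1 0) ⊗ₜ e) y x := by
  rw [← hb]
  simp [O.swap_swap]

-- The associator consists of `dot ⊗ dot` in shape 0 minus `dotop ⊗ dot` in shape 1. These match
-- `(left x · edge y) · right z` and `(edge y · right z) · left x`; in the second, the minus sign of
-- the associator cancels the sign twist.
open Cochain in
theorem evalTern_black_ass {O : Quad K} {b : (black (Ass K) O).E →ₗ[K] Bil K V}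
    (hb : ∀ e x y, b ((black (Ass K) O).swap e) x y = b e y x) (s : Tern K O.E) (x y z : V) :
    edge K V (evalTern b (blackMap (assoc (dot 0 : Gen K 1 0 0) 0 1 2) s) ![x, y, z]) =
      evalTern (cochainOps O (slice b (dot 0))) s ![left K V x, edge K V y, right K V z] := by
  have h0 (t : O.E ⊗[K] O.E) : edge K V (comp b x y z
      (TensorProduct.tensorTensorTensorComm K _ _ O.E O.E
        (((dot 0 : Gen K 1 0 0) ⊗ₜ (dot 0 : Gen K 1 0 0)) ⊗ₜ t))) =
      comp (cochainOps O (slice b (dot 0))) (left K V x) (edge K V y) (right K V z) t :=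
    map_comp_black (P := Ass K) (g := edge K V) (fun μ ν => by simp) t
  have h1 (t : O.E ⊗[K] O.E) : -edge K V (comp b y z x
      (TensorProduct.tensorTensorTensorComm K _ _ O.E O.E
        (((dotop 0 : Gen K 1 0 0) ⊗ₜ (dot 0 : Gen K 1 0 0)) ⊗ₜ t))) =
      comp (cochainOps O (slice b (dot 0))) (edge K V y) (right K V z) (left K V x) t := by
    exact map_comp_black (P := Ass K) (g := -edge K V) (fun μ ν => by rw [black_ass_dotop hb]; simp) t
  -- Shape 2 is absent from the associator; on cochains it starts with right times left, which is
  -- zero.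
  have h2 (t : O.E ⊗[K] O.E) : comp (cochainOps O (slice b (dot 0)))
      (right K V z) (left K V x) (edge K V y) t = 0 := by
    induction t with
    | zero => simp
    | tmul μ ν => simp
    | add s t hs ht => simp only [map_add, hs, ht, add_zero]
  simp only [evalTern_eq, Matrix.cons_val, ← h0, ← h1, h2, blackMap, assoc, L, M, treeR, treeL]
  simp [neg_tmul]

theorem isAlg_black_ass_iff {O : Quad K} {b : (black (Ass K) O).E →ₗ[K] Bil K V}
    (hb : ∀ e x y, b ((black (Ass K) O).swap e) x y = b e y x) :
    IsAlg (black (Ass K) O) b ↔ IsAlg O (cochainOps O (slice b (dot 0))) := by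
  rw [isAlg_black_iff rfl hb, isAlg_cochainOps_iff]
  simp only [Set.mem_singleton_iff, forall_eq]
  refine forall₂_congr fun s _ => ?_
  rw [forall_fin_three]
  simp only [← evalTern_black_ass hb, Cochain.edge_eq_zero]

-- The same match as for `Ass`: the associator of a commutative product also occupies shapes 0 and
-- 1, with the sign now coming from `black_com_bul`.
open Cochain in
theorem evalTern_black_com {O : Quad K} {b : (black (Com K) O).E →ₗ[K] Bil K V}
    (hb : ∀ e x y, b ((black (Com K) O).swap e) x y = b e y x) (s : Tern K O.E) (x y z : V) :
    edge K V (evalTern b (blackMap (assoc (bul 0 : Gen K 0 1 0) 0 1 2) s) ![x, y, z]) =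
      evalTern (cochainOps O (slice b (bul 0))) s ![left K V x, edge K V y, right K V z] := by
  have h0 (t : O.E ⊗[K] O.E) : edge K V (comp b x y z
      (TensorProduct.tensorTensorTensorComm K _ _ O.E O.E
        (((bul 0 : Gen K 0 1 0) ⊗ₜ (bul 0 : Gen K 0 1 0)) ⊗ₜ t))) =
      comp (cochainOps O (slice b (bul 0))) (left K V x) (edge K V y) (right K V z) t :=
    map_comp_black (P := Com K) (g := edge K V) (fun μ ν => by simp) t
  have h1 (t : O.E ⊗[K] O.E) : -edge K V (comp b y z x
      (TensorProduct.tensorTensorTensorComm K _ _ O.E O.E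
        (((bul 0 : Gen K 0 1 0) ⊗ₜ (bul 0 : Gen K 0 1 0)) ⊗ₜ t))) =
      comp (cochainOps O (slice b (bul 0))) (edge K V y) (right K V z) (left K V x) t := by
    exact map_comp_black (P := Com K) (g := -edge K V) (fun μ ν => by simp [black_com_bul hb]) t
  have h2 (t : O.E ⊗[K] O.E) : comp (cochainOps O (slice b (bul 0)))
      (right K V z) (left K V x) (edge K V y) t = 0 := by
    induction t with
    | zero => simp
    | tmul μ ν => simp
    | add s t hs ht => simp only [map_add, hs, ht, add_zero]
  simp only [evalTern_eq, Matrix.cons_val, ← h0, ← h1, h2, blackMap, assoc, L, M, treeR, treeL]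
  simp [neg_tmul]

theorem isAlg_black_com_iff {O : Quad K} {b : (black (Com K) O).E →ₗ[K] Bil K V}
    (hb : ∀ e x y, b ((black (Com K) O).swap e) x y = b e y x) :
    IsAlg (black (Com K) O) b ↔ IsAlg O (cochainOps O (slice b (bul 0))) := by
  rw [isAlg_black_iff rfl hb, isAlg_cochainOps_iff]
  simp only [Set.mem_singleton_iff, forall_eq]
  refine forall₂_congr fun s _ => ?_
  rw [forall_fin_three]
  simp only [← evalTern_black_com hb, Cochain.edge_eq_zero]

-- The pre-Lie relator has one term in each of shapes 0 and 2 and two in shape 1. The two account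
-- for the product of right vertex cochains, which is a sum of two terms.
open RelCochain in
theorem evalTern_black_preLie {O : Quad K} {b : (black (PreLie K) O).E →ₗ[K] Bil K V}
    (hb : ∀ e x y, b ((black (PreLie K) O).swap e) x y = b e y x) (s : Tern K O.E) (x y z : V) :
    edge K V (evalTern b (blackMap (preLieRel (dot 0 : Gen K 1 0 0)) s) ![x, y, z]) =
      evalTern (relOps O (slice b (dot 0))) s ![edge K V x, right K V y, right K V z] := by
  have hop : ∀ (e : O.E) (x y : V), b ((dotop 0 : Gen K 1 0 0) ⊗ₜ e) x y =
    -b ((dot 0 : Gen K 1 0 0) ⊗ₜ O.swap e) y x := black_ass_dotop hb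
  have h0 (t : O.E ⊗[K] O.E) : edge K V (comp b x y z
      (TensorProduct.tensorTensorTensorComm K _ _ O.E O.E
        (((dot 0 : Gen K 1 0 0) ⊗ₜ (dot 0 : Gen K 1 0 0)) ⊗ₜ t))) =
      comp (relOps O (slice b (dot 0))) (edge K V x) (right K V y) (right K V z) t := by
    induction t with
    | zero => simp
    | tmul μ ν => rw [comp_black (P := PreLie K)]; simp
    | add s t hs ht => simp only [tmul_add, map_add, hs, ht]
  have h1 (t : O.E ⊗[K] O.E) : edge K V (comp b y z x
      (TensorProduct.tensorTensorTensorComm K _ _ O.E O.E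
        (((dotop 0 : Gen K 1 0 0) ⊗ₜ (dotop 0 : Gen K 1 0 0)) ⊗ₜ t))) -
      edge K V (comp b y z x
      (TensorProduct.tensorTensorTensorComm K _ _ O.E O.E
        (((dotop 0 : Gen K 1 0 0) ⊗ₜ (dot 0 : Gen K 1 0 0)) ⊗ₜ t))) =
      comp (relOps O (slice b (dot 0))) (right K V y) (right K V z) (edge K V x) t := by
    induction t with
    | zero => simp
    | tmul μ ν =>
      rw [comp_black (P := PreLie K), comp_black (P := PreLie K), hop, hop, hop]
      simp
      abel
    | add s t hs ht => rw [map_add, ← hs, ← ht]; simp only [tmul_add, map_add]; abel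
  have h2 (t : O.E ⊗[K] O.E) : -edge K V (comp b z x y
      (TensorProduct.tensorTensorTensorComm K _ _ O.E O.E
        (((dot 0 : Gen K 1 0 0) ⊗ₜ (dotop 0 : Gen K 1 0 0)) ⊗ₜ t))) =
      comp (relOps O (slice b (dot 0))) (right K V z) (edge K V x) (right K V y) t := by
    induction t with
    | zero => simp
    | tmul μ ν => rw [comp_black (P := PreLie K), hop]; simp
    | add s t hs ht => simp only [tmul_add, map_add, neg_add, hs, ht]
  simp only [evalTern_eq, Matrix.cons_val, ← h0, ← h1, ← h2, blackMap, preLieRel, assoc, L, M,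
    treeR, treeL]
  simp [neg_tmul, add_tmul]
  abel

theorem isAlg_black_preLie_iff {O : Quad K} {b : (black (PreLie K) O).E →ₗ[K] Bil K V}
    (hb : ∀ e x y, b ((black (PreLie K) O).swap e) x y = b e y x) :
    IsAlg (black (PreLie K) O) b ↔ IsAlg O (relOps O (slice b (dot 0))) := by
  rw [isAlg_black_iff rfl hb, isAlg_relOps_iff]
  simp only [Set.mem_singleton_iff, forall_eq]
  refine forall₂_congr fun s _ => ?_
  rw [forall_fin_three]
  simp only [← evalTern_black_preLie hb, RelCochain.edge_eq_zero]

end BlackAlg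

/-! ### General criteria for the isomorphisms and the bijections -/

section Comparison

variable {K : Type u} [Field K] {V : Type v} [AddCommGroup V] [Module K V] {O Q : Quad K}

/-- The equivariant map on `Gen K 1 0 0 ⊗ O.E` extending a map `ψ` on the copy of `O.E` spanned
by the non-symmetric generator. -/
def dotExtend (ψ : O.E →ₗ[K] Q.E) : Gen K 1 0 0 ⊗[K] O.E →ₗ[K] Q.E :=
  TensorProduct.lift (LinearMap.mk₂ K
    -- The value on `dotop ⊗ e` is forced by equivariance, the swap of the black product being minus
    -- the tensor product of the swaps.
    (fun g e => (g.1 0).1 • ψ e - (g.1 0).2 • Q.swap (ψ (O.swap e)))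
    (by intros; simp; module) (by intros; simp; module) (by intros; simp; module)
    (by intros; simp; module))

theorem dotExtend_tmul (ψ : O.E →ₗ[K] Q.E) (g : Gen K 1 0 0) (e : O.E) :
    dotExtend ψ (g ⊗ₜ e) = (g.1 0).1 • ψ e - (g.1 0).2 • Q.swap (ψ (O.swap e)) := by
  simp [dotExtend]

theorem dotExtend_dot (ψ : O.E →ₗ[K] Q.E) (e : O.E) : dotExtend ψ (dot 0 ⊗ₜ e) = ψ e := by
  simp [dotExtend_tmul, dot]

theorem dotExtend_dotop (ψ : O.E →ₗ[K] Q.E) (e : O.E) :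
    dotExtend ψ (dotop 0 ⊗ₜ e) = -Q.swap (ψ (O.swap e)) := by
  simp [dotExtend_tmul, dotop]

theorem dotExtend_swap (ψ : O.E →ₗ[K] Q.E) (t : Gen K 1 0 0 ⊗[K] O.E) :
    dotExtend ψ ((-TensorProduct.map gswap O.swap) t) = Q.swap (dotExtend ψ t) := by
  induction t with
  | zero => simp
  | tmul g e => simp [dotExtend_tmul, gswap, O.swap_swap, Q.swap_swap]
  | add s t hs ht => simp only [map_add, hs, ht]

theorem dotExtend_surjective {ψ : O.E →ₗ[K] Q.E}
    (hgen : LinearMap.range ψ ⊔ (LinearMap.range ψ).map Q.swap = ⊤) :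
    Function.Surjective (dotExtend ψ) := by
  rw [← LinearMap.range_eq_top, eq_top_iff, ← hgen, sup_le_iff]
  constructor
  · rintro _ ⟨e, rfl⟩
    exact ⟨_, dotExtend_dot ψ e⟩
  · rintro _ ⟨_, ⟨e, rfl⟩, rfl⟩
    exact ⟨-(dotop 0 ⊗ₜ O.swap e), by simp [dotExtend_dotop, O.swap_swap]⟩

/-- `dotExtend` as an isomorphism. -/
def dotEquiv (ψ : O.E →ₗ[K] Q.E) (hrank : Module.finrank K Q.E = 2 * Module.finrank K O.E)
    (hgen : LinearMap.range ψ ⊔ (LinearMap.range ψ).map Q.swap = ⊤) :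
    Gen K 1 0 0 ⊗[K] O.E ≃ₗ[K] Q.E :=
  -- A surjection between spaces of equal finite dimension is bijective.
  have hr : Module.finrank K (Gen K 1 0 0 ⊗[K] O.E) = Module.finrank K Q.E := by
    simp [hrank, Module.finrank_tensorProduct, Module.finrank_prod,
      Module.finrank_pi_fintype]
  LinearEquiv.ofBijective (dotExtend ψ)
    ⟨(LinearMap.injective_iff_surjective_of_finrank_eq_finrank hr).2 (dotExtend_surjective hgen),
      dotExtend_surjective hgen⟩

/-- The hypothesis `core` compares algebras over `Q` with cochain structures, and
`isAlg_black_ass_iff` does the same for the black product, so both operads have the same algebras.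
The same `core` feeds `bijOn_isAssBullet`. -/
theorem isomorphic_black_ass (ψ : O.E →ₗ[K] Q.E)
    (hrank : Module.finrank K Q.E = 2 * Module.finrank K O.E)
    (hgen : LinearMap.range ψ ⊔ (LinearMap.range ψ).map Q.swap = ⊤)
    (core : ∀ (V : Type u) [AddCommGroup V] [Module K V] (b : Q.E →ₗ[K] Bil K V),
      (∀ e x y, b (Q.swap e) x y = b e y x) →
        (IsAlg Q b ↔ IsAlg O (cochainOps O (b ∘ₗ ψ)))) :
    Isomorphic (black (Ass K) O) Q := by
  refine isomorphic_of_forall_isAlg (P := black (Ass K) O) (dotEquiv ψ hrank hgen)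
    (dotExtend_swap ψ) fun V _ _ b hb => ?_
  rw [core V b hb, isAlg_black_ass_iff]
  · have : slice (b ∘ₗ (dotEquiv ψ hrank hgen).toLinearMap) (dot 0) = b ∘ₗ ψ := by
      ext e : 1
      exact congrArg b (dotExtend_dot ψ e)
    rw [this]
  · intro e x y
    refine Eq.trans ?_ (hb _ _ _)
    exact congrArg (fun t => b t x y) (dotExtend_swap ψ e)

theorem isomorphic_black_preLie (ψ : O.E →ₗ[K] Q.E)
    (hrank : Module.finrank K Q.E = 2 * Module.finrank K O.E)
    (hgen : LinearMap.range ψ ⊔ (LinearMap.range ψ).map Q.swap = ⊤)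
    (core : ∀ (V : Type u) [AddCommGroup V] [Module K V] (b : Q.E →ₗ[K] Bil K V),
      (∀ e x y, b (Q.swap e) x y = b e y x) →
        (IsAlg Q b ↔ IsAlg O (relOps O (b ∘ₗ ψ)))) :
    Isomorphic (black (PreLie K) O) Q := by
  refine isomorphic_of_forall_isAlg (P := black (PreLie K) O) (dotEquiv ψ hrank hgen)
    (dotExtend_swap ψ) fun V _ _ b hb => ?_
  rw [core V b hb, isAlg_black_preLie_iff]
  · have : slice (b ∘ₗ (dotEquiv ψ hrank hgen).toLinearMap) (dot 0) = b ∘ₗ ψ := by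
      ext e : 1
      exact congrArg b (dotExtend_dot ψ e)
    rw [this]
  · intro e x y
    refine Eq.trans ?_ (hb _ _ _)
    exact congrArg (fun t => b t x y) (dotExtend_swap ψ e)

/-- The map on `Gen K 0 1 0 ⊗ O.E` extending a map `ψ` on `O.E`. -/
def bulExtend (ψ : O.E →ₗ[K] Q.E) : Gen K 0 1 0 ⊗[K] O.E →ₗ[K] Q.E :=
  TensorProduct.lift (LinearMap.mk₂ K (fun g e => g.2.1 0 • ψ e)
    (by intros; simp; module) (by intros; simp; module) (by intros; simp)
    (by intros; simp; module))

theorem bulExtend_tmul (ψ : O.E →ₗ[K] Q.E) (g : Gen K 0 1 0) (e : O.E) :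
    bulExtend ψ (g ⊗ₜ e) = g.2.1 0 • ψ e := by
  simp [bulExtend]

theorem bulExtend_bul (ψ : O.E →ₗ[K] Q.E) (e : O.E) : bulExtend ψ (bul 0 ⊗ₜ e) = ψ e := by
  simp [bulExtend_tmul, bul]

theorem bulExtend_swap {ψ : O.E →ₗ[K] Q.E} (hψ : ∀ e, ψ (O.swap e) = -Q.swap (ψ e))
    (t : Gen K 0 1 0 ⊗[K] O.E) :
    bulExtend ψ ((-TensorProduct.map gswap O.swap) t) = Q.swap (bulExtend ψ t) := by
  induction t with
  | zero => simp
  | tmul g e => simp [bulExtend_tmul, gswap, hψ]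
  | add s t hs ht => simp only [map_add, hs, ht]

theorem bulExtend_surjective {ψ : O.E →ₗ[K] Q.E} (hgen : Function.Surjective ψ) :
    Function.Surjective (bulExtend ψ) := fun y => by
  obtain ⟨e, rfl⟩ := hgen y
  exact ⟨_, bulExtend_bul ψ e⟩

/-- `bulExtend` as an isomorphism. -/
def bulEquiv (ψ : O.E →ₗ[K] Q.E) (hrank : Module.finrank K Q.E = Module.finrank K O.E)
    (hgen : Function.Surjective ψ) : Gen K 0 1 0 ⊗[K] O.E ≃ₗ[K] Q.E :=
  have hr : Module.finrank K (Gen K 0 1 0 ⊗[K] O.E) = Module.finrank K Q.E := by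
    simp [hrank, Module.finrank_tensorProduct, Module.finrank_prod,
      Module.finrank_pi_fintype]
  LinearEquiv.ofBijective (bulExtend ψ)
    ⟨(LinearMap.injective_iff_surjective_of_finrank_eq_finrank hr).2 (bulExtend_surjective hgen),
      bulExtend_surjective hgen⟩

theorem isomorphic_black_com (ψ : O.E →ₗ[K] Q.E)
    (hrank : Module.finrank K Q.E = Module.finrank K O.E)
    (hgen : Function.Surjective ψ) (hψ : ∀ e, ψ (O.swap e) = -Q.swap (ψ e))
    (core : ∀ (V : Type u) [AddCommGroup V] [Module K V] (b : Q.E →ₗ[K] Bil K V),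
      (∀ e x y, b (Q.swap e) x y = b e y x) →
        (IsAlg Q b ↔ IsAlg O (cochainOps O (b ∘ₗ ψ)))) :
    Isomorphic (black (Com K) O) Q := by
  refine isomorphic_of_forall_isAlg (P := black (Com K) O) (bulEquiv ψ hrank hgen)
    (bulExtend_swap hψ) fun V _ _ b hb => ?_
  rw [core V b hb, isAlg_black_com_iff]
  · have : slice (b ∘ₗ (bulEquiv ψ hrank hgen).toLinearMap) (bul 0) = b ∘ₗ ψ := by
      ext e : 1
      exact congrArg b (bulExtend_bul ψ e)
    rw [this]
  · intro e x y
    refine Eq.trans ?_ (hb _ _ _)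
    exact congrArg (fun t => b t x y) (bulExtend_swap hψ e)

theorem eq_of_symm_of_generate {ψ : O.E →ₗ[K] Q.E}
    (hgen : LinearMap.range ψ ⊔ (LinearMap.range ψ).map Q.swap = ⊤) {b b' : Q.E →ₗ[K] Bil K V}
    (hb : ∀ e x y, b (Q.swap e) x y = b e y x) (hb' : ∀ e x y, b' (Q.swap e) x y = b' e y x)
    (h : ∀ e, b (ψ e) = b' (ψ e)) : b = b' := by
  have : LinearMap.range ψ ⊔ (LinearMap.range ψ).map Q.swap ≤ LinearMap.eqLocus b b' := by
    refine sup_le ?_ ?_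
    · rintro _ ⟨e, rfl⟩
      exact h e
    · rintro _ ⟨_, ⟨e, rfl⟩, rfl⟩
      refine LinearMap.ext₂ fun x y => ?_
      rw [hb, hb', h]
  rw [hgen] at this
  exact LinearMap.ext fun e => this trivial

/-- The inverse sends `b` to `cochainOps O (b ∘ₗ ψ)`. By rigidity a structure is recovered from its
edge products, and by generation `b` is recovered from `b ∘ₗ ψ`. -/
theorem bijOn_isAssBullet {ψ : O.E →ₗ[K] Q.E}
    (hgen : LinearMap.range ψ ⊔ (LinearMap.range ψ).map Q.swap = ⊤)
    {Φ : (O.E →ₗ[K] Bil K (Cochain V)) → (Q.E →ₗ[K] Bil K V)}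
    (hsymm : ∀ a e x y, Φ a (Q.swap e) x y = Φ a e y x)
    (hΦ : ∀ c, Φ (cochainOps O c) ∘ₗ ψ = c)
    (core : ∀ b : Q.E →ₗ[K] Bil K V, (∀ e x y, b (Q.swap e) x y = b e y x) →
      (IsAlg Q b ↔ IsAlg O (cochainOps O (b ∘ₗ ψ)))) :
    Set.BijOn Φ {a | IsAssBullet O a} {b | IsAlg Q b} := by
  refine ⟨fun a ha => ?_, fun a ha a' ha' h => ?_, fun b hb => ?_⟩
  · have ha : IsAssBullet O a := ha
    rw [Set.mem_ofPred_eq, core _ (hsymm a), ha.eq_cochainOps, hΦ, ← isAssBullet_cochainOps_iff,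
      ← ha.eq_cochainOps]
    exact ha
  · have ha : IsAssBullet O a := ha
    have ha' : IsAssBullet O a' := ha'
    rw [ha.eq_cochainOps, ha'.eq_cochainOps] at h ⊢
    rw [← hΦ (precLin a), h, hΦ]
  · have hb : IsAlg Q b := hb
    refine ⟨cochainOps O (b ∘ₗ ψ), ?_, ?_⟩
    · rw [Set.mem_ofPred_eq, isAssBullet_cochainOps_iff, ← core b hb.symm]
      exact hb
    · exact eq_of_symm_of_generate hgen (hsymm _) hb.symm fun e =>
        LinearMap.congr_fun (hΦ (b ∘ₗ ψ)) e

/-- The induced product at the right vertex is `c e x y + c (O.swap e) y x`. Its vanishing is the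
sign-twisted symmetry that the generators of a black product with `Com` satisfy. -/
theorem isComBullet_cochainOps_iff (c : O.E →ₗ[K] Bil K V) : IsComBullet O (cochainOps O c) ↔
    IsAlg O (cochainOps O c) ∧ ∀ e x y, c (O.swap e) x y = -c e y x := by
  rw [IsComBullet, isAssBullet_cochainOps_iff]
  refine and_congr_right fun _ => ?_
  simp only [cochainOps_right_right]
  refine ⟨fun h e x y => ?_, fun h e x y => ?_⟩
  · have : c e y x + c (O.swap e) x y = 0 := h e y x
    exact eq_neg_of_add_eq_zero_right this
  · change c e x y + c (O.swap e) y x = 0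
    rw [h, add_neg_cancel]

theorem bijOn_isComBullet {ψ : O.E →ₗ[K] Q.E}
    (hgen : Function.Surjective ψ) (hψ : ∀ e, ψ (O.swap e) = -Q.swap (ψ e))
    {Φ : (O.E →ₗ[K] Bil K (Cochain V)) → (Q.E →ₗ[K] Bil K V)}
    (hΦ : ∀ c, (∀ e x y, c (O.swap e) x y = -c e y x) → Φ (cochainOps O c) ∘ₗ ψ = c)
    (core : ∀ b : Q.E →ₗ[K] Bil K V, (∀ e x y, b (Q.swap e) x y = b e y x) →
      (IsAlg Q b ↔ IsAlg O (cochainOps O (b ∘ₗ ψ)))) :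
    Set.BijOn Φ {a | IsComBullet O a} {b | IsAlg Q b} := by
  have key (a) (ha : IsComBullet O a) : ∃ c : O.E →ₗ[K] Bil K V, a = cochainOps O c ∧
      IsAlg O (cochainOps O c) ∧ ∀ e x y, c (O.swap e) x y = -c e y x := by
    refine ⟨precLin a, ha.1.eq_cochainOps, (isComBullet_cochainOps_iff _).1 ?_⟩
    rwa [← ha.1.eq_cochainOps]
  refine ⟨fun a ha => ?_, fun a ha a' ha' h => ?_, fun b hb => ?_⟩
  · obtain ⟨c, rfl, hc, hs⟩ := key a ha
    rw [Set.mem_ofPred_eq, core, hΦ c hs]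
    · exact hc
    · intro e x y
      -- Symmetry of the operations read off on `V` is not automatic here: it follows from
      -- triviality of the induced structure.
      obtain ⟨e, rfl⟩ := hgen e
      have h (e) : Φ (cochainOps O c) (ψ e) = c e := LinearMap.congr_fun (hΦ c hs) e
      rw [← neg_neg (Q.swap _), ← hψ, map_neg, h, h, LinearMap.neg_apply, LinearMap.neg_apply, hs,
        neg_neg]
  · obtain ⟨c, rfl, hc, hs⟩ := key a ha
    obtain ⟨c', rfl, hc', hs'⟩ := key a' ha'
    rw [← hΦ c hs, h, hΦ c' hs']
  · have hb : IsAlg Q b := hb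
    have hs : ∀ e x y, (b ∘ₗ ψ) (O.swap e) x y = -(b ∘ₗ ψ) e y x := by
      intro e x y
      simp [hψ, hb.symm]
    refine ⟨cochainOps O (b ∘ₗ ψ), (isComBullet_cochainOps_iff _).2 ⟨?_, hs⟩, ?_⟩
    · rwa [← core b hb.symm]
    · ext e : 1
      obtain ⟨e, rfl⟩ := hgen e
      exact LinearMap.congr_fun (hΦ (b ∘ₗ ψ) hs) e

theorem bijOn_isPreLieBullet {ψ : O.E →ₗ[K] Q.E}
    (hgen : LinearMap.range ψ ⊔ (LinearMap.range ψ).map Q.swap = ⊤)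
    {Φ : (O.E →ₗ[K] Bil K (RelCochain V)) → (Q.E →ₗ[K] Bil K V)}
    (hsymm : ∀ a e x y, Φ a (Q.swap e) x y = Φ a e y x)
    (hΦ : ∀ c, Φ (relOps O c) ∘ₗ ψ = c)
    (core : ∀ b : Q.E →ₗ[K] Bil K V, (∀ e x y, b (Q.swap e) x y = b e y x) →
      (IsAlg Q b ↔ IsAlg O (relOps O (b ∘ₗ ψ)))) :
    Set.BijOn Φ {a | IsPreLieBullet O a} {b | IsAlg Q b} := by
  refine ⟨fun a ha => ?_, fun a ha a' ha' h => ?_, fun b hb => ?_⟩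
  · have ha : IsPreLieBullet O a := ha
    rw [Set.mem_ofPred_eq, core _ (hsymm a), ha.eq_relOps, hΦ, ← isPreLieBullet_relOps_iff,
      ← ha.eq_relOps]
    exact ha
  · have ha : IsPreLieBullet O a := ha
    have ha' : IsPreLieBullet O a' := ha'
    rw [ha.eq_relOps, ha'.eq_relOps] at h ⊢
    rw [← hΦ (precRelLin a), h, hΦ]
  · have hb : IsAlg Q b := hb
    refine ⟨relOps O (b ∘ₗ ψ), ?_, ?_⟩
    · rw [Set.mem_ofPred_eq, isPreLieBullet_relOps_iff, ← core b hb.symm]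
      exact hb
    · exact eq_of_symm_of_generate hgen (hsymm _) hb.symm fun e =>
        LinearMap.congr_fun (hΦ (b ∘ₗ ψ)) e

end Comparison

/-! ### Maps out of the generators of a presentation -/

section Gen

variable {K : Type u} [Field K] {p q r : ℕ} {E : Type w} [AddCommGroup E] [Module K E]
  {V : Type v} [AddCommGroup V] [Module K V]

/-- The linear map with given values on the generators. -/
def genMap (f f' : Fin p → E) (g : Fin q → E) (h : Fin r → E) : Gen K p q r →ₗ[K] E where
  toFun e := ∑ i, ((e.1 i).1 • f i + (e.1 i).2 • f' i) + ∑ j, e.2.1 j • g j + ∑ k, e.2.2 k • h k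
  map_add' e e' := by
    simp only [Prod.fst_add, Prod.snd_add, Pi.add_apply, add_smul, Finset.sum_add_distrib]
    abel
  map_smul' c e := by
    simp only [Prod.smul_fst, Prod.smul_snd, Pi.smul_apply, smul_eq_mul, mul_smul,
      Finset.smul_sum, smul_add, RingHom.id_apply]

theorem genMap_apply (f f' : Fin p → E) (g : Fin q → E) (h : Fin r → E) (e : Gen K p q r) :
    genMap f f' g h e = ∑ i, ((e.1 i).1 • f i + (e.1 i).2 • f' i) + ∑ j, e.2.1 j • g j +
      ∑ k, e.2.2 k • h k := rfl

theorem sum_single_fst_smul (i : Fin p) (x : K × K) (f : Fin p → E) :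
    ∑ j, ((Pi.single i x : Fin p → K × K) j).1 • f j = x.1 • f i := by
  rw [Finset.sum_eq_single i] <;> simp +contextual

theorem sum_single_snd_smul (i : Fin p) (x : K × K) (f : Fin p → E) :
    ∑ j, ((Pi.single i x : Fin p → K × K) j).2 • f j = x.2 • f i := by
  rw [Finset.sum_eq_single i] <;> simp +contextual

@[simp]
theorem genMap_dot (f f' : Fin p → E) (g : Fin q → E) (h : Fin r → E) (i : Fin p) :
    genMap f f' g h (dot i : Gen K p q r) = f i := by
  simp [genMap_apply, dot, Finset.sum_add_distrib, sum_single_fst_smul, sum_single_snd_smul]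

@[simp]
theorem genMap_dotop (f f' : Fin p → E) (g : Fin q → E) (h : Fin r → E) (i : Fin p) :
    genMap f f' g h (dotop i : Gen K p q r) = f' i := by
  simp [genMap_apply, dotop, Finset.sum_add_distrib, sum_single_fst_smul, sum_single_snd_smul]

@[simp]
theorem genMap_bul (f f' : Fin p → E) (g : Fin q → E) (h : Fin r → E) (i : Fin q) :
    genMap f f' g h (bul i : Gen K p q r) = g i := by
  simp [genMap_apply, bul, Pi.single_apply]

@[simp]
theorem genMap_brk (f f' : Fin p → E) (g : Fin q → E) (h : Fin r → E) (i : Fin r) :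
    genMap f f' g h (brk i : Gen K p q r) = h i := by
  simp [genMap_apply, brk, Pi.single_apply]

theorem ofOps_eq_genMap (f : Fin p → Bil K V) (g : Fin q → Bil K V) (h : Fin r → Bil K V) :
    ofOps f g h = genMap f (fun i => (f i).flip) g h := rfl

/-- A subspace of the generators that contains the basic operations is everything. -/
theorem gen_eq_top {N : Submodule K (Gen K p q r)} (h₁ : ∀ i, dot i ∈ N)
    (h₂ : ∀ i, dotop i ∈ N) (h₃ : ∀ i, bul i ∈ N) (h₄ : ∀ i, brk i ∈ N) : N = ⊤ := by
  refine (Submodule.eq_top_iff').2 fun e => ?_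
  have he : e = genMap dot dotop bul brk e := by
    refine Prod.ext (funext fun i => ?_) (Prod.ext (funext fun i => ?_) (funext fun i => ?_))
    · simp only [genMap_apply, dot, dotop, bul, brk, Prod.fst_add, Prod.fst_sum, Prod.smul_fst,
        Pi.add_apply, Finset.sum_apply, Pi.smul_apply, Finset.sum_add_distrib]
      refine Prod.ext ?_ ?_ <;> simp [Pi.single_apply, apply_ite, Prod.fst_sum, Prod.snd_sum]
    · simp [genMap_apply, dot, dotop, bul, brk, Prod.fst_sum, Prod.snd_sum, Finset.sum_apply,
        Pi.single_apply]
    · simp [genMap_apply, dot, dotop, bul, brk, Prod.fst_sum, Prod.snd_sum, Finset.sum_apply,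
        Pi.single_apply]
  rw [he, genMap_apply]
  refine add_mem (add_mem ?_ ?_) ?_
  · exact sum_mem fun i _ => add_mem (N.smul_mem _ (h₁ i)) (N.smul_mem _ (h₂ i))
  · exact sum_mem fun i _ => N.smul_mem _ (h₃ i)
  · exact sum_mem fun i _ => N.smul_mem _ (h₄ i)

theorem gen_hom_ext {φ ψ : Gen K p q r →ₗ[K] E} (h₁ : ∀ i, φ (dot i) = ψ (dot i))
    (h₂ : ∀ i, φ (dotop i) = ψ (dotop i)) (h₃ : ∀ i, φ (bul i) = ψ (bul i))
    (h₄ : ∀ i, φ (brk i) = ψ (brk i)) : φ = ψ := by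
  have : LinearMap.eqLocus φ ψ = ⊤ := gen_eq_top h₁ h₂ h₃ h₄
  exact LinearMap.ext fun e => (this ▸ Submodule.mem_top : e ∈ LinearMap.eqLocus φ ψ)

theorem ofOps_gswap {f : Fin p → Bil K V} {g : Fin q → Bil K V} {h : Fin r → Bil K V}
    (hg : ∀ j x y, g j x y = g j y x) (hh : ∀ k x y, h k x y = -h k y x) (e : Gen K p q r)
    (x y : V) : ofOps f g h (gswap e) x y = ofOps f g h e y x := by
  simp only [ofOps_eq_genMap, genMap_apply, gswap, LinearMap.coe_mk, AddHom.coe_mk,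
    LinearMap.add_apply, LinearMap.sum_apply, LinearMap.smul_apply, LinearMap.flip_apply,
    Pi.neg_apply, neg_smul, LinearMap.neg_apply]
  congr 1
  · congr 1
    · exact Finset.sum_congr rfl fun i _ => add_comm _ _
    · exact Finset.sum_congr rfl fun i _ => by rw [hg]
  · exact Finset.sum_congr rfl fun i _ => by rw [hh, smul_neg, neg_neg]

theorem finrank_gen : Module.finrank K (Gen K p q r) = 2 * p + (q + r) := by
  simp [Module.finrank_prod, Module.finrank_pi_fintype]
  ring

section Pres

variable {S : Set (Tern K (Gen K p q r))}

theorem pres_eval_L {a : (pres S).E →ₗ[K] Bil K V}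
    (ha : ∀ e x y, a ((pres S).swap e) x y = a e y x) (μ ν : Gen K p q r) (x : Fin 3 → V)
    (i j k : Fin 3) (hij : i ≠ j) (hjk : j ≠ k) (hik : i ≠ k) :
    evalTern a (L μ ν i j k) x = a μ (a ν (x i) (x j)) (x k) := by
  rw [evalTern_treeL (pres S).swap a ha _ _ _ _ _ _ hij hjk hik]

theorem pres_eval_M {a : (pres S).E →ₗ[K] Bil K V}
    (ha : ∀ e x y, a ((pres S).swap e) x y = a e y x) (μ ν : Gen K p q r) (x : Fin 3 → V)
    (i j k : Fin 3) (hij : i ≠ j) (hjk : j ≠ k) (hik : i ≠ k) :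
    evalTern a (M μ ν i j k) x = a μ (x i) (a ν (x j) (x k)) := by
  rw [M, evalTern_treeR (pres S).swap a ha _ _ _ _ _ _ hij hjk hik]

variable (S) (c : Gen K p q r →ₗ[K] Bil K V) (e : Gen K p q r) (x y : V)

/-- `cochainOps` for an operad given by a presentation. -/
abbrev presOps : Gen K p q r →ₗ[K] Bil K (Cochain V) := cochainOps (pres S) c

open Cochain

@[simp]
theorem presOps_left_left : presOps S c e (left K V x) (left K V y) =
    left K V (c e x y + c (gswap e) y x) :=
  cochainOps_left_left (pres S) c e x y

@[simp]
theorem presOps_right_right : presOps S c e (right K V x) (right K V y) =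
    right K V (c e x y + c (gswap e) y x) :=
  cochainOps_right_right (pres S) c e x y

@[simp]
theorem presOps_left_right : presOps S c e (left K V x) (right K V y) = 0 :=
  cochainOps_left_right (pres S) c e x y

@[simp]
theorem presOps_right_left : presOps S c e (right K V x) (left K V y) = 0 :=
  cochainOps_right_left (pres S) c e x y

@[simp]
theorem presOps_left_edge : presOps S c e (left K V x) (edge K V y) = edge K V (c e x y) :=
  cochainOps_left_edge (pres S) c e x y

@[simp]
theorem presOps_edge_right : presOps S c e (edge K V x) (right K V y) = edge K V (c e x y) :=
  cochainOps_edge_right (pres S) c e x y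

@[simp]
theorem presOps_edge_left : presOps S c e (edge K V x) (left K V y) = edge K V (c (gswap e) y x) :=
  cochainOps_edge_left (pres S) c e x y

@[simp]
theorem presOps_right_edge : presOps S c e (right K V x) (edge K V y) = edge K V (c (gswap e) y x) :=
  cochainOps_right_edge (pres S) c e x y

/-- Relations on cochains for an operad given by a presentation. -/
theorem isAlg_presOps_iff (c : Gen K p q r →ₗ[K] Bil K V) :
    IsAlg (pres S) (cochainOps (pres S) c) ↔ ∀ s ∈ S, ∀ x y z,
      evalTern (presOps S c) s ![left K V x, edge K V y, right K V z] = 0 ∧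
      evalTern (presOps S c) s ![edge K V x, right K V y, left K V z] = 0 ∧
      evalTern (presOps S c) s ![right K V x, left K V y, edge K V z] = 0 ∧
      evalTern (presOps S c) s ![edge K V x, left K V y, right K V z] = 0 ∧
      evalTern (presOps S c) s ![left K V x, right K V y, edge K V z] = 0 ∧
      evalTern (presOps S c) s ![right K V x, edge K V y, left K V z] = 0 :=
  isAlg_cochainOps_iff_of_eq_stableSpan _ _ rfl

theorem presOps_swap (c : Gen K p q r →ₗ[K] Bil K V) (e : (pres S).E) (X Y : Cochain V) :
    presOps S c ((pres S).swap e) X Y = presOps S c e Y X :=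
  cochainOps_swap (pres S) c e X Y

/-- `relOps` for an operad given by a presentation. -/
abbrev presRelOps : Gen K p q r →ₗ[K] Bil K (RelCochain V) := relOps (pres S) c

@[simp]
theorem presRelOps_right_right : presRelOps S c e (RelCochain.right K V x) (RelCochain.right K V y) =
    RelCochain.right K V (c e x y + c (gswap e) y x) :=
  relOps_right_right (pres S) c e x y

@[simp]
theorem presRelOps_edge_right : presRelOps S c e (RelCochain.edge K V x) (RelCochain.right K V y) =
    RelCochain.edge K V (c e x y) :=
  relOps_edge_right (pres S) c e x y

@[simp]
theorem presRelOps_right_edge : presRelOps S c e (RelCochain.right K V x) (RelCochain.edge K V y) =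
    RelCochain.edge K V (c (gswap e) y x) :=
  relOps_right_edge (pres S) c e x y

/-- Relations on relative cochains for an operad given by a presentation. -/
theorem isAlg_presRelOps_iff (c : Gen K p q r →ₗ[K] Bil K V) :
    IsAlg (pres S) (relOps (pres S) c) ↔ ∀ s ∈ S, ∀ x y z,
      evalTern (presRelOps S c) s
        ![RelCochain.edge K V x, RelCochain.right K V y, RelCochain.right K V z] = 0 ∧
      evalTern (presRelOps S c) s
        ![RelCochain.right K V x, RelCochain.edge K V y, RelCochain.right K V z] = 0 ∧
      evalTern (presRelOps S c) s
        ![RelCochain.right K V x, RelCochain.right K V y, RelCochain.edge K V z] = 0 :=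
  isAlg_relOps_iff_of_eq_stableSpan _ _ rfl

theorem presRelOps_swap (c : Gen K p q r →ₗ[K] Bil K V) (e : (pres S).E) (X Y : RelCochain V) :
    presRelOps S c ((pres S).swap e) X Y = presRelOps S c e Y X :=
  relOps_swap (pres S) c e X Y

end Pres

end Gen

/-! ### Generating relators written out at all placements -/

section Cores

variable {K : Type u} [Field K] {V : Type v} [AddCommGroup V] [Module K V]

theorem pres_eval_dotop {p q r : ℕ} {S : Set (Tern K (Gen K p q r))} {b : (pres S).E →ₗ[K] Bil K V}
    (hb : ∀ e x y, b ((pres S).swap e) x y = b e y x) (i : Fin p) (x y : V) :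
    b (dotop i : Gen K p q r) x y = b (dot i : Gen K p q r) y x := by
  rw [← hb (show (pres S).E from dot i)]
  exact congrArg (fun e => b e x y) (gswap_dot i).symm

theorem pres_eval_bul {p q r : ℕ} {S : Set (Tern K (Gen K p q r))} {b : (pres S).E →ₗ[K] Bil K V}
    (hb : ∀ e x y, b ((pres S).swap e) x y = b e y x) (i : Fin q) (x y : V) :
    b (bul i : Gen K p q r) x y = b (bul i : Gen K p q r) y x := by
  exact (congrArg (fun e => b e x y) (gswap_bul i)).symm.trans (hb _ x y)

theorem pres_eval_brk {p q r : ℕ} {S : Set (Tern K (Gen K p q r))} {b : (pres S).E →ₗ[K] Bil K V}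
    (hb : ∀ e x y, b ((pres S).swap e) x y = b e y x) (i : Fin r) (x y : V) :
    b (brk i : Gen K p q r) x y = -b (brk i : Gen K p q r) y x := by
  rw [← hb]
  have : (pres S).swap (brk i : Gen K p q r) = -(brk i : Gen K p q r) := gswap_brk i
  rw [this, map_neg, LinearMap.neg_apply, LinearMap.neg_apply]

/-- The operations `∘` and `∗` induced by a Poisson structure. -/
def poisGen : Gen K 0 1 1 →ₗ[K] Gen K 2 0 0 := genMap ![] ![] ![dot 0] ![dot 1]

/-- At each placement the product of the two vertices is zero, so relators lose terms. The Jacobi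
identity becomes associativity of `∗`, and the three terms of the Leibniz rule of the bracket reduce
to two, giving the links in the chain of equalities. -/
theorem isAlg_assPois_iff (b : (AssPois K).E →ₗ[K] Bil K V)
    (hb : ∀ e x y, b ((AssPois K).swap e) x y = b e y x) :
    IsAlg (AssPois K) b ↔ IsAlg (Pois K) (cochainOps (Pois K) (b ∘ₗ poisGen)) := by
  have h1 : poisGen (bul 0 : Gen K 0 1 1) = dot 0 := by simp [poisGen]
  have h2 : poisGen (brk 0 : Gen K 0 1 1) = dot 1 := by simp [poisGen]
  rw [isAlg_iff_of_eq_stableSpan rfl hb, isAlg_presOps_iff]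
  simp only [Set.mem_insert_iff, Set.mem_singleton_iff, forall_eq_or_imp, forall_eq, assoc, jacobi]
  simp [pres_eval_L hb, pres_eval_M hb, pres_eval_L (presOps_swap _ _),
    pres_eval_M (presOps_swap _ _), h1, h2, -not_forall, -not_exists, -Classical.not_imp]
  simp only [← (Cochain.edge K V).map_add, ← (Cochain.edge K V).map_sub,
    ← (Cochain.edge K V).map_neg, Cochain.edge_eq_zero]
  generalize b (dot 0) = c
  generalize b (dot 1) = a
  constructor
  · rintro ⟨h1, h2, h3, h4, h5, h6⟩
    refine ⟨fun x y z => ⟨?_, h2 z x y, h1 y z x, h1 y x z, h2 x z y, ?_⟩,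
      fun x y z => ⟨?_, ?_, ?_, ?_, ?_, ?_⟩, fun x y z => ⟨?_, ?_, ?_, ?_, ?_, ?_⟩⟩
    · rw [h1, h2, sub_zero]
    · rw [h1, h2, sub_zero]
    · linear_combination (norm := module) h3 x y z
    · linear_combination (norm := module) h3 z x y
    · linear_combination (norm := module) h3 y z x
    · linear_combination (norm := module) -h3 y x z
    · linear_combination (norm := module) -h3 x z y
    · linear_combination (norm := module) -h3 z y x
    · linear_combination (norm := module) -h4 x y z
    · linear_combination (norm := module) h4 z x y + h5 z x y
    · linear_combination (norm := module) h6 y z x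
    · linear_combination (norm := module) h4 y x z + h5 y x z
    · linear_combination (norm := module) -h4 x z y
    · linear_combination (norm := module) h6 z y x
  · rintro ⟨g1, g2, g3⟩
    -- When the two vertices are the last two arguments, a single term of the associator of `•`
    -- survives: this makes `∘` nilpotent.
    refine ⟨fun x y z => (g1 y x z).2.2.2.1, fun x y z => (g1 y z x).2.1, fun x y z => ?_,
      fun x y z => ?_, fun x y z => ?_, fun x y z => ?_⟩
    · linear_combination (norm := module) (g2 x y z).1
    · linear_combination (norm := module) -(g3 x y z).1
    · linear_combination (norm := module) (g3 x y z).1 + (g3 y z x).2.1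
    · linear_combination (norm := module) (g3 z x y).2.2.1

/-- With the edge first, associativity, Jacobi and Leibniz give the Zinbiel, pre-Lie and first mixed
relations. With the edge second, Leibniz gives the other mixed relation. The remaining placements
follow from these. -/
theorem isAlg_prePois_iff (b : (PrePois K).E →ₗ[K] Bil K V)
    (hb : ∀ e x y, b ((PrePois K).swap e) x y = b e y x) :
    IsAlg (PrePois K) b ↔ IsAlg (Pois K) (relOps (Pois K) (b ∘ₗ poisGen)) := by
  have h1 : poisGen (bul 0 : Gen K 0 1 1) = dot 0 := by simp [poisGen]
  have h2 : poisGen (brk 0 : Gen K 0 1 1) = dot 1 := by simp [poisGen]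
  rw [isAlg_iff_of_eq_stableSpan rfl hb, isAlg_presRelOps_iff]
  simp only [Set.mem_insert_iff, Set.mem_singleton_iff, forall_eq_or_imp, forall_eq, assoc, jacobi,
    preLieRel]
  simp [pres_eval_L hb, pres_eval_M hb, pres_eval_L (presRelOps_swap _ _),
    pres_eval_M (presRelOps_swap _ _), pres_eval_dotop hb, h1, h2, -not_forall, -not_exists,
    -Classical.not_imp]
  simp only [← (RelCochain.edge K V).map_add, ← (RelCochain.edge K V).map_sub,
    ← (RelCochain.edge K V).map_neg, RelCochain.edge_eq_zero]
  generalize b (dot 0) = c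
  generalize b (dot 1) = a
  constructor
  · rintro ⟨h1, h2, h3, h4⟩
    refine ⟨fun x y z => ⟨h1 x y z, ?_, ?_⟩, fun x y z => ⟨?_, ?_, ?_⟩,
      fun x y z => ⟨h3 x y z, ?_, ?_⟩⟩
    · linear_combination (norm := module) h1 y x z - h1 y z x
    · linear_combination (norm := module) -h1 z y x
    · linear_combination (norm := module) h2 x y z
    · linear_combination (norm := module) h2 y z x
    · linear_combination (norm := module) h2 z x y
    · linear_combination (norm := module) -h4 x y z
    · linear_combination (norm := module) -h4 x z y
  · rintro ⟨g1, g2, g3⟩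
    refine ⟨fun x y z => (g1 x y z).1, fun x y z => ?_, fun x y z => (g3 x y z).1,
      fun x y z => ?_⟩
    · linear_combination (norm := module) (g2 x y z).1
    · linear_combination (norm := module) -(g3 x y z).2.1

/-- The operations `≺`, `≻` and `∗` induced by a post-Lie structure. -/
def postGen : Gen K 1 0 1 →ₗ[K] Gen K 3 0 0 := genMap ![dot 0] ![-dot 1] ![] ![dot 2]

/-- Jacobi gives associativity of `∗`. The other two post-Lie relators each give three dendriform
relations, every one of them twice, as both are antisymmetric in two of their variables. The sign in
`postGen` is the one in the definition of `≻`. -/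
theorem isAlg_tridend_iff (b : (Tridend K).E →ₗ[K] Bil K V)
    (hb : ∀ e x y, b ((Tridend K).swap e) x y = b e y x) :
    IsAlg (Tridend K) b ↔ IsAlg (PostLie K) (cochainOps (PostLie K) (b ∘ₗ postGen)) := by
  have h1 : postGen (dot 0 : Gen K 1 0 1) = dot 0 := by simp [postGen]
  have h2 : postGen (dotop 0 : Gen K 1 0 1) = -dot 1 := by simp [postGen]
  have h3 : postGen (brk 0 : Gen K 1 0 1) = dot 2 := by simp [postGen]
  rw [isAlg_iff_of_eq_stableSpan rfl hb, isAlg_presOps_iff]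
  simp only [Set.mem_insert_iff, Set.mem_singleton_iff, forall_eq_or_imp, forall_eq, assoc, jacobi]
  simp [pres_eval_L hb, pres_eval_M hb, pres_eval_L (presOps_swap _ _),
    pres_eval_M (presOps_swap _ _), h1, h2, h3, -not_forall, -not_exists, -Classical.not_imp]
  simp only [← (Cochain.edge K V).map_add, ← (Cochain.edge K V).map_sub,
    ← (Cochain.edge K V).map_neg, Cochain.edge_eq_zero]
  generalize b (dot 0) = p
  generalize b (dot 1) = s
  generalize b (dot 2) = a
  constructor
  · rintro ⟨h1, h2, h3, h4, h5, h6, h7⟩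
    refine ⟨fun x y z => ⟨?_, ?_, ?_, ?_, ?_, ?_⟩,
      fun x y z => ⟨?_, ?_, ?_, ?_, ?_, ?_⟩, fun x y z => ⟨?_, ?_, ?_, ?_, ?_, ?_⟩⟩
    · linear_combination (norm := module) h7 x y z
    · linear_combination (norm := module) h7 z x y
    · linear_combination (norm := module) h7 y z x
    · linear_combination (norm := module) -h7 y x z
    · linear_combination (norm := module) -h7 x z y
    · linear_combination (norm := module) -h7 z y x
    · linear_combination (norm := module) h6 x y z
    · linear_combination (norm := module) h4 z x y
    · linear_combination (norm := module) h5 y z x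
    · linear_combination (norm := module) -h6 y x z
    · linear_combination (norm := module) -h5 x z y
    · linear_combination (norm := module) -h4 z y x
    · linear_combination (norm := module) -h1 x y z
    · linear_combination (norm := module) -h2 z x y
    · linear_combination (norm := module) -h3 y z x
    · linear_combination (norm := module) h2 y x z
    · linear_combination (norm := module) h1 x z y
    · linear_combination (norm := module) h3 z y x
  · rintro ⟨g1, g2, g3⟩
    refine ⟨fun x y z => ?_, fun x y z => ?_, fun x y z => ?_, fun x y z => ?_, fun x y z => ?_,
      fun x y z => ?_, fun x y z => ?_⟩
    · linear_combination (norm := module) -(g3 x y z).1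
    · linear_combination (norm := module) -(g3 y z x).2.1
    · linear_combination (norm := module) -(g3 z x y).2.2.1
    · linear_combination (norm := module) (g2 y z x).2.1
    · linear_combination (norm := module) (g2 z x y).2.2.1
    · linear_combination (norm := module) (g2 x y z).1
    · linear_combination (norm := module) (g1 x y z).1

/-- The operations `⋆` and `⊛` induced by a post-Lie structure. -/
def postComGen : Gen K 1 0 1 →ₗ[K] Gen K 1 1 0 := genMap ![dot 0] ![-dotop 0] ![] ![bul 0]

/-- Here `≻` is the opposite of `≺`, because `postComGen` sends `dotop` to minus `dotop`. The
dendriform relations thus collapse to three, and the other placements follow from commutativity of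
`⊛`. -/
theorem isAlg_postCom_iff (b : (PostCom K).E →ₗ[K] Bil K V)
    (hb : ∀ e x y, b ((PostCom K).swap e) x y = b e y x) :
    IsAlg (PostCom K) b ↔ IsAlg (PostLie K) (cochainOps (PostLie K) (b ∘ₗ postComGen)) := by
  have h1 : postComGen (dot 0 : Gen K 1 0 1) = dot 0 := by simp [postComGen]
  have h2 : postComGen (dotop 0 : Gen K 1 0 1) = -dotop 0 := by simp [postComGen]
  have h3 : postComGen (brk 0 : Gen K 1 0 1) = bul 0 := by simp [postComGen]
  have hc := pres_eval_bul hb 0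
  rw [isAlg_iff_of_eq_stableSpan rfl hb, isAlg_presOps_iff]
  simp only [Set.mem_insert_iff, Set.mem_singleton_iff, forall_eq_or_imp, forall_eq, assoc, jacobi]
  simp [pres_eval_L hb, pres_eval_M hb, pres_eval_L (presOps_swap _ _), pres_eval_dotop hb,
    pres_eval_M (presOps_swap _ _), h1, h2, h3, -not_forall, -not_exists, -Classical.not_imp]
  simp only [← (Cochain.edge K V).map_add, ← (Cochain.edge K V).map_sub,
    ← (Cochain.edge K V).map_neg, Cochain.edge_eq_zero]
  generalize b (dot 0) = s
  generalize b (bul 0) = c at hc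
  have hl (x y z : V) : s (c x y) z = s (c y x) z := by rw [hc x y]
  have hr (x y z : V) : s x (c y z) = s x (c z y) := by rw [hc y z]
  constructor
  · rintro ⟨h1, h2, h3⟩
    refine ⟨fun x y z => ⟨?_, ?_, ?_, ?_, ?_, ?_⟩,
      fun x y z => ⟨?_, ?_, ?_, ?_, ?_, ?_⟩, fun x y z => ⟨?_, ?_, ?_, ?_, ?_, ?_⟩⟩
    · linear_combination (norm := module) h1 x y z
    · linear_combination (norm := module) h1 z x y
    · linear_combination (norm := module) h1 y z x
    · linear_combination (norm := module) -h1 y x z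
    · linear_combination (norm := module) -h1 x z y
    · linear_combination (norm := module) -h1 z y x
    · linear_combination (norm := module) h2 x y z
    · linear_combination (norm := module) hc (s x z) y - hl x y z - h2 y x z
    · linear_combination (norm := module) hc (s y z) x + h2 y x z - h2 x y z + hl x y z
    · linear_combination (norm := module) -h2 y x z
    · linear_combination (norm := module) h2 y x z - h2 x y z + hl x y z - hc (s x z) y
    · linear_combination (norm := module) h2 x y z - hl x y z - hc (s y z) x
    · linear_combination (norm := module) -h3 x y z
    · linear_combination (norm := module) h3 x y z - h3 x z y + hr x y z
    · linear_combination (norm := module) h3 x z y - hr x y z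
    · linear_combination (norm := module) h3 x y z - h3 x z y + hr x y z
    · linear_combination (norm := module) h3 x z y
    · linear_combination (norm := module) -h3 x y z - hr x y z
  · rintro ⟨g1, g2, g3⟩
    refine ⟨fun x y z => ?_, fun x y z => (g2 x y z).1, fun x y z => ?_⟩
    · linear_combination (norm := module) (g1 x y z).1
    · linear_combination (norm := module) -(g3 x y z).1

/-- The operations `≺` and `≻` induced by a Lie admissible structure. -/
def admGen : Gen K 1 0 0 →ₗ[K] Gen K 2 0 0 := genMap ![dot 0] ![-dot 1] ![] ![]

/-- The commutator acts on the edge through `≺ + ≻`, and at a mixed placement the Jacobi identity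
loses one term and becomes an associator. -/
theorem isAlg_assAdm_iff (b : (AssAdm K).E →ₗ[K] Bil K V)
    (hb : ∀ e x y, b ((AssAdm K).swap e) x y = b e y x) :
    IsAlg (AssAdm K) b ↔ IsAlg (LieAdm K) (cochainOps (LieAdm K) (b ∘ₗ admGen)) := by
  have h1 : admGen (dot 0 : Gen K 1 0 0) = dot 0 := by simp [admGen]
  have h2 : admGen (dotop 0 : Gen K 1 0 0) = -dot 1 := by simp [admGen]
  rw [isAlg_iff_of_eq_stableSpan rfl hb, isAlg_presOps_iff]
  simp only [Set.mem_singleton_iff, forall_eq, assoc, jacobi]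
  simp [pres_eval_L hb, pres_eval_M hb, pres_eval_L (presOps_swap _ _),
    h1, h2, -not_forall, -not_exists, -Classical.not_imp]
  simp only [← (Cochain.edge K V).map_add, ← (Cochain.edge K V).map_sub,
    ← (Cochain.edge K V).map_neg, Cochain.edge_eq_zero]
  generalize b (dot 0) = p
  generalize b (dot 1) = s
  constructor
  · intro h x y z
    refine ⟨?_, ?_, ?_, ?_, ?_, ?_⟩
    · linear_combination (norm := module) h x y z
    · linear_combination (norm := module) h z x y
    · linear_combination (norm := module) h y z x
    · linear_combination (norm := module) -h y x z
    · linear_combination (norm := module) -h x z y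
    · linear_combination (norm := module) -h z y x
  · intro g x y z
    linear_combination (norm := module) (g x y z).1

/-- On edge, right, right no term of the Jacobi identity is lost; the commutator at the right vertex
splits in two, which yields the pre-Lie relator of `≺ + ≻`. -/
theorem isAlg_preLieAdm_iff (b : (PreLieAdm K).E →ₗ[K] Bil K V)
    (hb : ∀ e x y, b ((PreLieAdm K).swap e) x y = b e y x) :
    IsAlg (PreLieAdm K) b ↔ IsAlg (LieAdm K) (relOps (LieAdm K) (b ∘ₗ admGen)) := by
  have h1 : admGen (dot 0 : Gen K 1 0 0) = dot 0 := by simp [admGen]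
  have h2 : admGen (dotop 0 : Gen K 1 0 0) = -dot 1 := by simp [admGen]
  rw [isAlg_iff_of_eq_stableSpan rfl hb, isAlg_presRelOps_iff]
  simp only [Set.mem_singleton_iff, forall_eq, assoc, jacobi,
    preLieRel]
  simp [pres_eval_L hb, pres_eval_M hb, pres_eval_L (presRelOps_swap _ _),
    h1, h2, -not_forall, -not_exists,
    -Classical.not_imp]
  simp only [← (RelCochain.edge K V).map_add, ← (RelCochain.edge K V).map_sub,
    ← (RelCochain.edge K V).map_neg, RelCochain.edge_eq_zero]
  generalize b (dot 0) = p
  generalize b (dot 1) = s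
  constructor
  · intro h x y z
    refine ⟨?_, ?_, ?_⟩
    · linear_combination (norm := module) h x y z
    · linear_combination (norm := module) h y z x
    · linear_combination (norm := module) h z x y
  · intro g x y z
    linear_combination (norm := module) (g x y z).1

/-- The operation `⋆` induced by a Lie admissible structure. -/
def comAdmGen : Gen K 1 0 0 →ₗ[K] Gen K 1 0 0 := genMap ![dot 0] ![-dotop 0] ![] ![]

theorem isAlg_comAdm_iff (b : (ComAdm K).E →ₗ[K] Bil K V)
    (hb : ∀ e x y, b ((ComAdm K).swap e) x y = b e y x) :
    IsAlg (ComAdm K) b ↔ IsAlg (LieAdm K) (cochainOps (LieAdm K) (b ∘ₗ comAdmGen)) := by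
  have h1 : comAdmGen (dot 0 : Gen K 1 0 0) = dot 0 := by simp [comAdmGen]
  have h2 : comAdmGen (dotop 0 : Gen K 1 0 0) = -dotop 0 := by simp [comAdmGen]
  rw [isAlg_iff_of_eq_stableSpan rfl hb, isAlg_presOps_iff]
  simp only [Set.mem_singleton_iff, forall_eq, assoc, jacobi]
  simp [pres_eval_L hb, pres_eval_M hb, pres_eval_L (presOps_swap _ _), pres_eval_dotop hb,
    h1, h2, -not_forall, -not_exists, -Classical.not_imp]
  simp only [← (Cochain.edge K V).map_add, ← (Cochain.edge K V).map_sub,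
    ← (Cochain.edge K V).map_neg, Cochain.edge_eq_zero]
  generalize b (dot 0) = s
  constructor
  · intro h x y z
    refine ⟨?_, ?_, ?_, ?_, ?_, ?_⟩
    · linear_combination (norm := module) h x y z
    · linear_combination (norm := module) h z x y
    · linear_combination (norm := module) h y z x
    · linear_combination (norm := module) h z x y
    · linear_combination (norm := module) h y z x
    · linear_combination (norm := module) h x y z
  · intro g x y z
    linear_combination (norm := module) (g x y z).1

end Cores

/-! ### Products of operads and the commutative Poisson case -/

section ProdCore

variable {K : Type u} [Field K] {V : Type v} [AddCommGroup V] [Module K V]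

/-- One shape of mixed composites is enough, since the arguments run over all of `V`. -/
theorem isAlg_prod_iff {P Q : Quad K} (b : (prod P Q).E →ₗ[K] Bil K V)
    (hb : ∀ e x y, b ((prod P Q).swap e) x y = b e y x) :
    IsAlg (prod P Q) b ↔ IsAlg P (b ∘ₗ LinearMap.inl K P.E Q.E) ∧
      IsAlg Q (b ∘ₗ LinearMap.inr K P.E Q.E) ∧ ∀ (e : P.E) (f : Q.E) (x y z : V),
        b (e, 0) (b (0, f) x y) z = 0 ∧ b (0, f) (b (e, 0) x y) z = 0 := by
  have hl (e : P.E) (x y : V) : b (P.swap e, 0) x y = b (e, 0) y x := by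
    simpa using hb (e, 0) x y
  have hr (f : Q.E) (x y : V) : b (0, Q.swap f) x y = b (0, f) y x := by
    simpa using hb (0, f) x y
  rw [isAlg_iff_of_eq_stableSpan rfl hb]
  constructor
  · intro h
    refine ⟨⟨hl, fun r hr => ?_⟩, ⟨hr, fun r hr => ?_⟩, fun e f x y z => ⟨?_, ?_⟩⟩
    · rw [forall_fin_three]
      intro x y z
      rw [← evalTern_ternMap]
      exact h _ (Or.inl (Or.inl ⟨r, hr, rfl⟩)) x y z
    · rw [forall_fin_three]
      intro x y z
      rw [← evalTern_ternMap]
      exact h _ (Or.inl (Or.inr ⟨r, hr, rfl⟩)) x y z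
    · simpa [evalTern_eq] using h _ (Or.inr ⟨e, f, 0, Or.inl rfl⟩) x y z
    · simpa [evalTern_eq] using h _ (Or.inr ⟨e, f, 0, Or.inr rfl⟩) x y z
  · rintro ⟨h1, h2, h3⟩ _ ((⟨r, hr, rfl⟩ | ⟨r, hr, rfl⟩) | ⟨e, f, i, rfl | rfl⟩) x y z
    · rw [evalTern_ternMap]
      exact h1.rel r hr _
    · rw [evalTern_ternMap]
      exact h2.rel r hr _
    · fin_cases i <;> simp [evalTern_eq, h3]
    · fin_cases i <;> simp [evalTern_eq, h3]

/-- The bracket `∘` and the product `∗` induced by a Poisson structure. -/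
def comPoisGen : Gen K 0 1 1 →ₗ[K] Gen K 0 0 1 × Gen K 0 1 0 :=
  genMap ![] ![] ![(brk 0, 0)] ![(0, bul 0)]

theorem isAlg_nilLie_prod_com_iff (b : (prod (NilLie K) (Com K)).E →ₗ[K] Bil K V)
    (hb : ∀ e x y, b ((prod (NilLie K) (Com K)).swap e) x y = b e y x) :
    IsAlg (prod (NilLie K) (Com K)) b ↔
      (∀ x y z, b (brk 0, 0) (b (brk 0, 0) x y) z = 0) ∧
      (∀ x y z, b (0, bul 0) (b (0, bul 0) x y) z = b (0, bul 0) x (b (0, bul 0) y z)) ∧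
      (∀ x y z, b (brk 0, 0) (b (0, bul 0) x y) z = 0) ∧
      (∀ x y z, b (0, bul 0) (b (brk 0, 0) x y) z = 0) := by
  have hl : ∀ e x y, (b ∘ₗ LinearMap.inl K (NilLie K).E (Com K).E) ((NilLie K).swap e) x y =
      (b ∘ₗ LinearMap.inl K (NilLie K).E (Com K).E) e y x := by
    intro e x y
    simpa using hb (e, 0) x y
  have hr : ∀ e x y, (b ∘ₗ LinearMap.inr K (NilLie K).E (Com K).E) ((Com K).swap e) x y =
      (b ∘ₗ LinearMap.inr K (NilLie K).E (Com K).E) e y x := by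
    intro f x y
    simpa using hb (0, f) x y
  rw [isAlg_prod_iff b hb, isAlg_iff_of_eq_stableSpan rfl hl, isAlg_iff_of_eq_stableSpan rfl hr]
  simp only [Set.mem_singleton_iff, forall_eq, assoc]
  -- Both generator spaces are one-dimensional, so the mixed relations need only the basic
  -- operations.
  have he (e : Gen K 0 0 1) : ((e, 0) : Gen K 0 0 1 × Gen K 0 1 0) = e.2.2 0 • (brk 0, 0) := by
    refine Prod.ext (Prod.ext (Subsingleton.elim _ _) (Prod.ext (Subsingleton.elim _ _) ?_)) ?_
    · ext i; fin_cases i; simp [brk]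
    · simp
  have hf (f : Gen K 0 1 0) : ((0, f) : Gen K 0 0 1 × Gen K 0 1 0) = f.2.1 0 • (0, bul 0) := by
    refine Prod.ext ?_ (Prod.ext (Subsingleton.elim _ _) (Prod.ext ?_ (Subsingleton.elim _ _)))
    · simp
    · ext i; fin_cases i; simp [bul]
  refine and_congr ?_ (and_congr ?_ ?_)
  · simp [pres_eval_L hl]
  · simp [pres_eval_L hr, pres_eval_M hr, sub_eq_zero]
  · constructor
    · intro h
      exact ⟨fun x y z => (h (brk 0) (bul 0) x y z).1, fun x y z => (h (brk 0) (bul 0) x y z).2⟩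
    · rintro ⟨h1, h2⟩ e f x y z
      have he := he e
      have hf := hf f
      constructor
      · rw [he, hf]; simp only [map_smul, LinearMap.smul_apply, h1, smul_zero]
      · rw [he, hf]; simp only [map_smul, LinearMap.smul_apply, h2, smul_zero]

/-- Associativity of `•` makes the bracket nilpotent and Jacobi makes the product associative. The
mixed composites are all tied to `c (a x y) z`, which is symmetric in `x, y` and antisymmetric in
`y, z`; such a function is its own negative. -/
theorem isAlg_nilLie_prod_com_iff_pois (h2 : (2 : K) ≠ 0)
    (b : (prod (NilLie K) (Com K)).E →ₗ[K] Bil K V)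
    (hb : ∀ e x y, b ((prod (NilLie K) (Com K)).swap e) x y = b e y x) :
    IsAlg (prod (NilLie K) (Com K)) b ↔
      IsAlg (Pois K) (cochainOps (Pois K) (b ∘ₗ comPoisGen)) := by
  have e1 : comPoisGen (bul 0 : Gen K 0 1 1) = (brk 0, 0) := by simp [comPoisGen]
  have e2 : comPoisGen (brk 0 : Gen K 0 1 1) = (0, bul 0) := by simp [comPoisGen]
  have e3 : b (0, -bul 0) = -b (0, bul 0) := by
    rw [← map_neg]
    exact congrArg b (Prod.ext (by simp) rfl)
  have hc (x y : V) : b (brk 0, 0) x y = -b (brk 0, 0) y x := by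
    have h := hb (brk 0, 0) y x
    have hs : (prod (NilLie K) (Com K)).swap (brk 0, 0) = -(brk 0, 0) :=
      Prod.ext (gswap_brk 0) (by simp)
    rw [hs, map_neg] at h
    exact h.symm
  have ha (x y : V) : b (0, bul 0) x y = b (0, bul 0) y x := by
    have h := hb (0, bul 0) y x
    have hs : (prod (NilLie K) (Com K)).swap (0, bul 0) = (0, bul 0) :=
      Prod.ext (by simp) (gswap_bul 0)
    rw [hs] at h
    exact h.symm
  rw [isAlg_nilLie_prod_com_iff b hb, isAlg_presOps_iff]
  simp only [Set.mem_insert_iff, Set.mem_singleton_iff, forall_eq_or_imp, forall_eq, assoc, jacobi]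
  simp [pres_eval_L (presOps_swap _ _), pres_eval_M (presOps_swap _ _), e1, e2, e3,
    -not_forall, -not_exists, -Classical.not_imp]
  simp only [← (Cochain.edge K V).map_add, ← (Cochain.edge K V).map_sub,
    ← (Cochain.edge K V).map_neg, Cochain.edge_eq_zero]
  generalize b (brk 0, 0) = c at hc
  generalize b (0, bul 0) = a at ha
  constructor
  · rintro ⟨k1, k2, k3, k4⟩
    have k5 (x y z : V) : c x (c y z) = 0 := by rw [hc, k1, neg_zero]
    have k6 (x y z : V) : c x (a y z) = 0 := by rw [hc, k3, neg_zero]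
    have k7 (x y z : V) : a x (c y z) = 0 := by rw [ha, k4]
    refine ⟨by simp [k1, k5], fun x y z => ⟨?_, ?_, ?_, ?_, ?_, ?_⟩, by simp [k3, k4, k6, k7]⟩
    · linear_combination (norm := module) k2 x y z
    · linear_combination (norm := module) k2 z x y
    · linear_combination (norm := module) k2 y z x
    · linear_combination (norm := module) -k2 y x z
    · linear_combination (norm := module) -k2 x z y
    · linear_combination (norm := module) -k2 z y x
  · rintro ⟨g1, g2, g3⟩
    have e1 (x y z : V) : a x (c y z) = c (a x y) z := by
      linear_combination (norm := module) (g3 x y z).1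
    have e4 (x y z : V) : a (c x y) z = c (a z x) y := by rw [ha, e1]
    have e5 (x y z : V) : c (a x y) z = -c (a x z) y := by
      rw [← e1, hc y z, map_neg, e1]
    have e6 (x y z : V) : c (a x y) z = c (a y x) z := by rw [ha x y]
    -- Alternating the two symmetries six times returns to the start with sign `(-1)^3`;
    -- characteristic different from two is used here.
    have k3 (x y z : V) : c (a x y) z = 0 := by
      have : (2 : K) • c (a x y) z = 0 := by
        rw [two_smul]
        linear_combination (norm := module) e5 x y z - e6 x z y - e5 z x y + e6 z y x + e5 y z x -
          e6 y x z
      exact (smul_eq_zero.1 this).resolve_left h2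
    refine ⟨fun x y z => (g1 y x z).2.2.2.1, fun x y z => ?_, k3, fun x y z => ?_⟩
    · linear_combination (norm := module) (g2 x y z).1
    · rw [e4, k3]

end ProdCore

/-! ### Generation and equivariance of the maps on generators -/

section Generators

variable {K : Type u} [Field K]

theorem sup_map_gswap_eq_top {p q r : ℕ} {N : Submodule K (Gen K p q r)} (h₁ : ∀ i, dot i ∈ N)
    (h₂ : ∀ i, bul i ∈ N) (h₃ : ∀ i, brk i ∈ N) : N ⊔ N.map gswap = ⊤ :=
  gen_eq_top (fun i => Submodule.mem_sup_left (h₁ i))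
    (fun i => Submodule.mem_sup_right ⟨_, h₁ i, gswap_dot i⟩)
    (fun i => Submodule.mem_sup_left (h₂ i)) (fun i => Submodule.mem_sup_left (h₃ i))

theorem poisGen_generates :
    LinearMap.range (poisGen (K := K)) ⊔
      (LinearMap.range (poisGen (K := K))).map gswap = ⊤ := by
  refine sup_map_gswap_eq_top (fun i => ?_) (fun i => i.elim0)
    (fun i => i.elim0)
  fin_cases i
  · exact ⟨bul 0, by simp [poisGen]⟩
  · exact ⟨brk 0, by simp [poisGen]⟩

theorem postGen_generates :
    LinearMap.range (postGen (K := K)) ⊔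
      (LinearMap.range (postGen (K := K))).map gswap = ⊤ := by
  refine sup_map_gswap_eq_top (fun i => ?_) (fun i => i.elim0)
    (fun i => i.elim0)
  fin_cases i
  · exact ⟨dot 0, by simp [postGen]⟩
  · exact ⟨-dotop 0, by simp [postGen]⟩
  · exact ⟨brk 0, by simp [postGen]⟩

theorem admGen_generates :
    LinearMap.range (admGen (K := K)) ⊔
      (LinearMap.range (admGen (K := K))).map gswap = ⊤ := by
  refine sup_map_gswap_eq_top (fun i => ?_) (fun i => i.elim0)
    (fun i => i.elim0)
  fin_cases i
  · exact ⟨dot 0, by simp [admGen]⟩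
  · exact ⟨-dotop 0, by simp [admGen]⟩

theorem postComGen_surjective : Function.Surjective (postComGen (K := K)) := by
  rw [← LinearMap.range_eq_top]
  refine gen_eq_top (fun i => ⟨dot 0, ?_⟩) (fun i => ⟨-dotop 0, ?_⟩) (fun i => ⟨brk 0, ?_⟩)
    (fun i => i.elim0) <;> fin_cases i <;> simp [postComGen]

theorem comAdmGen_surjective : Function.Surjective (comAdmGen (K := K)) := by
  rw [← LinearMap.range_eq_top]
  refine gen_eq_top (fun i => ⟨dot 0, ?_⟩) (fun i => ⟨-dotop 0, ?_⟩) (fun i => i.elim0)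
    (fun i => i.elim0) <;> fin_cases i <;> simp [comAdmGen]

theorem comPoisGen_surjective : Function.Surjective (comPoisGen (K := K)) := by
  intro e
  have e1 : comPoisGen (bul 0 : Gen K 0 1 1) = (brk 0, 0) := by simp [comPoisGen]
  have e2 : comPoisGen (brk 0 : Gen K 0 1 1) = (0, bul 0) := by simp [comPoisGen]
  refine ⟨e.1.2.2 0 • bul 0 + e.2.2.1 0 • brk 0, ?_⟩
  rw [map_add, map_smul, map_smul, e1, e2]
  refine Prod.ext (Prod.ext (Subsingleton.elim _ _) (Prod.ext (Subsingleton.elim _ _) ?_))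
    (Prod.ext (Subsingleton.elim _ _) (Prod.ext ?_ (Subsingleton.elim _ _)))
  · ext i; fin_cases i; simp [brk]
  · ext i; fin_cases i; simp [bul]

/-- The minus sign is the sign twist of the black product: an anti-commutative bracket becomes a
commutative operation. -/
theorem postComGen_swap (e : (PostLie K).E) :
    postComGen ((PostLie K).swap e) = -(PostCom K).swap (postComGen e) := by
  have : postComGen ∘ₗ gswap = -(gswap ∘ₗ postComGen (K := K)) := by
    refine gen_hom_ext (fun i => ?_) (fun i => ?_) (fun i => i.elim0) (fun i => ?_) <;>
      fin_cases i <;> simp [postComGen]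
  exact LinearMap.congr_fun this e

theorem comAdmGen_swap (e : (LieAdm K).E) :
    comAdmGen ((LieAdm K).swap e) = -(ComAdm K).swap (comAdmGen e) := by
  have : comAdmGen ∘ₗ gswap = -(gswap ∘ₗ comAdmGen (K := K)) := by
    refine gen_hom_ext (fun i => ?_) (fun i => ?_) (fun i => i.elim0) (fun i => i.elim0) <;>
      fin_cases i <;> simp [comAdmGen]
  exact LinearMap.congr_fun this e

theorem comPoisGen_swap (e : (Pois K).E) :
    comPoisGen ((Pois K).swap e) = -(prod (NilLie K) (Com K)).swap (comPoisGen e) := by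
  have : comPoisGen ∘ₗ gswap = -(gswap.prodMap gswap ∘ₗ comPoisGen (K := K)) := by
    refine gen_hom_ext (fun i => i.elim0) (fun i => i.elim0) (fun i => ?_) (fun i => ?_) <;>
      fin_cases i <;> simp [comPoisGen]
  exact LinearMap.congr_fun this e

end Generators

/-! ### Morphisms given by the sums of the operations -/

section Morphisms

variable {K : Type u} [Field K]

/-- The generator is sent to `· - ·^op + [-,-]`. -/
def lieToPostLie : Gen K 0 0 1 →ₗ[K] Gen K 1 0 1 :=
  genMap ![] ![] ![] ![dot 0 - dotop 0 + brk 0]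

/-- The Jacobi sum of the total bracket is the Jacobi relator of `[-,-]` plus the cyclic sums of the
other two post-Lie relators, up to sign. -/
theorem isHom_lieToPostLie : IsHom (Lie K) (PostLie K) lieToPostLie := by
  have h1 : lieToPostLie (brk 0 : Gen K 0 0 1) = dot 0 - dotop 0 + brk 0 := by simp [lieToPostLie]
  have hs : ∀ e, lieToPostLie ((Lie K).swap e) = (PostLie K).swap (lieToPostLie e) := by
    have : lieToPostLie ∘ₗ gswap = gswap ∘ₗ lieToPostLie (K := K) := by
      refine gen_hom_ext (fun i => i.elim0) (fun i => i.elim0) (fun i => i.elim0) (fun i => ?_)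
      fin_cases i
      simp [lieToPostLie]
      abel
    exact LinearMap.congr_fun this
  refine isHom_of_forall_isAlg hs fun V _ _ b h => ?_
  have hb := h.symm
  have hb' : ∀ e x y, (b ∘ₗ lieToPostLie) ((Lie K).swap e) x y = (b ∘ₗ lieToPostLie) e y x := by
    intro e x y
    rw [LinearMap.comp_apply, hs, hb]
    rfl
  have hc := pres_eval_brk hb 0
  rw [isAlg_iff_of_eq_stableSpan rfl hb] at h
  rw [isAlg_iff_of_eq_stableSpan rfl hb']
  simp only [Set.mem_insert_iff, Set.mem_singleton_iff, forall_eq_or_imp, forall_eq, jacobi] at h ⊢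
  simp [pres_eval_L hb, pres_eval_M hb] at h
  simp [pres_eval_L hb', h1, pres_eval_dotop hb]
  obtain ⟨k1, k2, k3⟩ := h
  generalize b (dot 0) = m at *
  generalize b (brk 0) = l at *
  intro x y z
  -- The terms in `hc` exchange `[x, y·z]` with `-[y·z, x]`.
  linear_combination (norm := module) k1 x y z - k3 x y z - k3 y z x - k3 z x y + k2 x y z +
    k2 y z x + k2 z x y + hc x (m y z) + hc y (m z x) + hc z (m x y)

/-- The generator is sent to `≺ + ≻ + ∗`. -/
def assToTridend : Gen K 1 0 0 →ₗ[K] Gen K 3 0 0 :=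
  genMap ![dot 0 + dot 1 + dot 2] ![dotop 0 + dotop 1 + dotop 2] ![] ![]

/-- The seven dendriform relators add up to the associator of the total product. -/
theorem isHom_assToTridend : IsHom (Ass K) (Tridend K) assToTridend := by
  have h1 : assToTridend (dot 0 : Gen K 1 0 0) = dot 0 + dot 1 + dot 2 := by simp [assToTridend]
  have hs : ∀ e, assToTridend ((Ass K).swap e) = (Tridend K).swap (assToTridend e) := by
    have : assToTridend ∘ₗ gswap = gswap ∘ₗ assToTridend (K := K) := by
      refine gen_hom_ext (fun i => ?_) (fun i => ?_) (fun i => i.elim0) (fun i => i.elim0) <;>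
        fin_cases i <;> simp [assToTridend]
    exact LinearMap.congr_fun this
  refine isHom_of_forall_isAlg hs fun V _ _ b h => ?_
  have hb := h.symm
  have hb' : ∀ e x y, (b ∘ₗ assToTridend) ((Ass K).swap e) x y = (b ∘ₗ assToTridend) e y x := by
    intro e x y
    rw [LinearMap.comp_apply, hs, hb]
    rfl
  rw [isAlg_iff_of_eq_stableSpan rfl hb] at h
  rw [isAlg_iff_of_eq_stableSpan rfl hb']
  simp only [Set.mem_insert_iff, Set.mem_singleton_iff, forall_eq_or_imp, forall_eq, assoc] at h ⊢
  simp [pres_eval_L hb, pres_eval_M hb] at h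
  simp [pres_eval_L hb', pres_eval_M hb', h1]
  obtain ⟨k1, k2, k3, k4, k5, k6, k7⟩ := h
  intro x y z
  linear_combination (norm := module) k1 x y z + k2 x y z + k3 x y z + k4 x y z + k5 x y z +
    k6 x y z + k7 x y z

/-- The generator is sent to `⋆ + ⋆^op + ⊛`. -/
def comToPostCom : Gen K 0 1 0 →ₗ[K] Gen K 1 1 0 :=
  genMap ![] ![] ![dot 0 + dotop 0 + bul 0] ![]

/-- With `x ≻ y = y ⋆ x` the seven dendriform relations follow from the post-Com ones, and their sum
is again the associator of the total product. -/
theorem isHom_comToPostCom : IsHom (Com K) (PostCom K) comToPostCom := by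
  have h1 : comToPostCom (bul 0 : Gen K 0 1 0) = dot 0 + dotop 0 + bul 0 := by simp [comToPostCom]
  have hs : ∀ e, comToPostCom ((Com K).swap e) = (PostCom K).swap (comToPostCom e) := by
    have : comToPostCom ∘ₗ gswap = gswap ∘ₗ comToPostCom (K := K) := by
      refine gen_hom_ext (fun i => i.elim0) (fun i => i.elim0) (fun i => ?_) (fun i => i.elim0)
      fin_cases i
      simp [comToPostCom, add_comm]
    exact LinearMap.congr_fun this
  refine isHom_of_forall_isAlg hs fun V _ _ b h => ?_
  have hb := h.symm
  have hb' : ∀ e x y, (b ∘ₗ comToPostCom) ((Com K).swap e) x y = (b ∘ₗ comToPostCom) e y x := by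
    intro e x y
    rw [LinearMap.comp_apply, hs, hb]
    rfl
  have hc := pres_eval_bul hb 0
  rw [isAlg_iff_of_eq_stableSpan rfl hb] at h
  rw [isAlg_iff_of_eq_stableSpan rfl hb']
  simp only [Set.mem_insert_iff, Set.mem_singleton_iff, forall_eq_or_imp, forall_eq, assoc] at h ⊢
  simp [pres_eval_L hb, pres_eval_M hb, pres_eval_dotop hb] at h
  simp [pres_eval_L hb', pres_eval_M hb', h1, pres_eval_dotop hb]
  obtain ⟨k1, k2, k3⟩ := h
  generalize b (dot 0) = s at *
  generalize b (bul 0) = c at *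
  have hl (x y z : V) : s (c x y) z = s (c y x) z := by rw [hc x y]
  have hr (x y z : V) : s x (c y z) = s x (c z y) := by rw [hc y z]
  intro x y z
  linear_combination (norm := module) k1 x y z + k3 x y z - k3 z y x + hr z x y + k3 y x z -
    k3 y z x + hr y x z + k2 x y z + k2 x z y - k2 z x y - hl x z y + hc (s x y) z - k2 z y x +
    hc (s y x) z + hl z y x

end Morphisms

/-! ### The isomorphisms and bijections for each operad -/

section Results

variable (K : Type u) [Field K] (V : Type v) [AddCommGroup V] [Module K V]

theorem isomorphic_assPois : Isomorphic (black (Ass K) (Pois K)) (AssPois K) :=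
  isomorphic_black_ass poisGen (by rw [finrank_gen, finrank_gen]) poisGen_generates
    fun _ _ _ => isAlg_assPois_iff

theorem bijOn_assPois : Set.BijOn
    (fun a : (Pois K).E →ₗ[K] Bil K (Cochain V) =>
      (ofOps ![prec (a (bul 0)), prec (a (brk 0))] ![] ![] : (AssPois K).E →ₗ[K] Bil K V))
    {a | IsAssBullet (Pois K) a} {b | IsAlg (AssPois K) b} := by
  refine bijOn_isAssBullet poisGen_generates
    (fun _ e x y => ofOps_gswap (fun i => i.elim0) (fun i => i.elim0) e x y)
    (fun c => ?_) isAlg_assPois_iff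
  refine gen_hom_ext (fun i => i.elim0) (fun i => i.elim0) (fun i => ?_) (fun i => ?_) <;>
    fin_cases i <;> simp [ofOps_eq_genMap, poisGen]
  · exact prec_cochainOps _ c _
  · exact prec_cochainOps _ c _

theorem isomorphic_prePois : Isomorphic (black (PreLie K) (Pois K)) (PrePois K) :=
  isomorphic_black_preLie poisGen (by rw [finrank_gen, finrank_gen]) poisGen_generates
    fun _ _ _ => isAlg_prePois_iff

theorem bijOn_prePois : Set.BijOn
    (fun a : (Pois K).E →ₗ[K] Bil K (RelCochain V) =>
      (ofOps ![precRel (a (bul 0)), precRel (a (brk 0))] ![] ![] :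
        (PrePois K).E →ₗ[K] Bil K V))
    {a | IsPreLieBullet (Pois K) a} {b | IsAlg (PrePois K) b} := by
  refine bijOn_isPreLieBullet poisGen_generates
    (fun _ e x y => ofOps_gswap (fun i => i.elim0) (fun i => i.elim0) e x y)
    (fun c => ?_) isAlg_prePois_iff
  refine gen_hom_ext (fun i => i.elim0) (fun i => i.elim0) (fun i => ?_) (fun i => ?_) <;>
    fin_cases i <;> simp [ofOps_eq_genMap, poisGen]
  · exact precRel_relOps _ c _
  · exact precRel_relOps _ c _

theorem isomorphic_comPois (h2 : (2 : K) ≠ 0) :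
    Isomorphic (black (Com K) (Pois K)) (prod (NilLie K) (Com K)) :=
  isomorphic_black_com comPoisGen
    (by rw [Module.finrank_prod, finrank_gen, finrank_gen, finrank_gen])
    comPoisGen_surjective comPoisGen_swap fun _ _ _ => isAlg_nilLie_prod_com_iff_pois h2

theorem bijOn_comPois (h2 : (2 : K) ≠ 0) : Set.BijOn
    (fun a : (Pois K).E →ₗ[K] Bil K (Cochain V) =>
      (LinearMap.coprod (ofOps ![] ![] ![prec (a (bul 0))] : (NilLie K).E →ₗ[K] Bil K V)
        (ofOps ![] ![prec (a (brk 0))] ![] : (Com K).E →ₗ[K] Bil K V) :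
        (prod (NilLie K) (Com K)).E →ₗ[K] Bil K V))
    {a | IsComBullet (Pois K) a} {b | IsAlg (prod (NilLie K) (Com K)) b} := by
  refine bijOn_isComBullet comPoisGen_surjective comPoisGen_swap (fun c _ => ?_)
    (isAlg_nilLie_prod_com_iff_pois h2)
  refine gen_hom_ext (fun i => i.elim0) (fun i => i.elim0) (fun i => ?_) (fun i => ?_) <;>
    fin_cases i <;> simp [ofOps_eq_genMap, comPoisGen]
  · exact prec_cochainOps _ c _
  · exact prec_cochainOps _ c _

theorem isomorphic_tridend : Isomorphic (black (Ass K) (PostLie K)) (Tridend K) :=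
  isomorphic_black_ass postGen (by rw [finrank_gen, finrank_gen]) postGen_generates
    fun _ _ _ => isAlg_tridend_iff

theorem succ_cochainOps_pres_dot {p q r : ℕ} (S : Set (Tern K (Gen K p q r)))
    (c : (pres S).E →ₗ[K] Bil K V) (i : Fin p) :
    succ (cochainOps (pres S) c (dot i : Gen K p q r)) = -c (dotop i : Gen K p q r) := by
  rw [succ_cochainOps]
  exact congrArg (fun e => -c e) (gswap_dot i)

theorem succRel_relOps_pres_dot {p q r : ℕ} (S : Set (Tern K (Gen K p q r)))
    (c : (pres S).E →ₗ[K] Bil K V) (i : Fin p) :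
    succRel (relOps (pres S) c (dot i : Gen K p q r)) = -c (dotop i : Gen K p q r) := by
  rw [succRel_relOps]
  exact congrArg (fun e => -c e) (gswap_dot i)

theorem bijOn_tridend : Set.BijOn
    (fun a : (PostLie K).E →ₗ[K] Bil K (Cochain V) =>
      (ofOps ![prec (a (dot 0)), succ (a (dot 0)), prec (a (brk 0))] ![] ![] :
        (Tridend K).E →ₗ[K] Bil K V))
    {a | IsAssBullet (PostLie K) a} {b | IsAlg (Tridend K) b} := by
  refine bijOn_isAssBullet postGen_generates
    (fun _ e x y => ofOps_gswap (fun i => i.elim0) (fun i => i.elim0) e x y)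
    (fun c => ?_) isAlg_tridend_iff
  refine gen_hom_ext (fun i => ?_) (fun i => ?_) (fun i => i.elim0) (fun i => ?_) <;>
    fin_cases i <;> simp [ofOps_eq_genMap, postGen]
  · exact prec_cochainOps _ c _
  -- The sign in `postGen` cancels the sign in the definition of `≻`.
  · exact neg_eq_iff_eq_neg.2 (succ_cochainOps_pres_dot K V _ c 0)
  · exact prec_cochainOps _ c _

theorem isomorphic_postCom : Isomorphic (black (Com K) (PostLie K)) (PostCom K) :=
  isomorphic_black_com postComGen (by rw [finrank_gen, finrank_gen])
    postComGen_surjective postComGen_swap fun _ _ _ => isAlg_postCom_iff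

/-- Triviality of the induced structure lets `≺` alone determine the operation of `dotop`, so `⋆`
suffices in the `Com` cases. -/
theorem neg_flip_eq_of_antisymm {p q r : ℕ} {S : Set (Tern K (Gen K p q r))}
    {c : (pres S).E →ₗ[K] Bil K V} (hc : ∀ e x y, c ((pres S).swap e) x y = -c e y x)
    (i : Fin p) : -(c (dot i : Gen K p q r)).flip = c (dotop i : Gen K p q r) := by
  ext x y
  exact (hc (dot i : Gen K p q r) x y).symm.trans
    (congrArg (fun e => c e x y) (gswap_dot i))

theorem bijOn_postCom : Set.BijOn
    (fun a : (PostLie K).E →ₗ[K] Bil K (Cochain V) =>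
      (ofOps ![prec (a (dot 0))] ![prec (a (brk 0))] ![] : (PostCom K).E →ₗ[K] Bil K V))
    {a | IsComBullet (PostLie K) a} {b | IsAlg (PostCom K) b} := by
  refine bijOn_isComBullet postComGen_surjective postComGen_swap (fun c hc => ?_)
    isAlg_postCom_iff
  refine gen_hom_ext (fun i => ?_) (fun i => ?_) (fun i => i.elim0) (fun i => ?_) <;>
    fin_cases i <;> simp [ofOps_eq_genMap, postComGen]
  · exact prec_cochainOps _ c _
  · exact (congrArg (fun m => -LinearMap.flip m) (prec_cochainOps _ c _)).trans
      (neg_flip_eq_of_antisymm K V hc 0)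
  · exact prec_cochainOps _ c _

theorem isomorphic_assAdm : Isomorphic (black (Ass K) (LieAdm K)) (AssAdm K) :=
  isomorphic_black_ass admGen (by rw [finrank_gen, finrank_gen]) admGen_generates
    fun _ _ _ => isAlg_assAdm_iff

theorem bijOn_assAdm : Set.BijOn
    (fun a : (LieAdm K).E →ₗ[K] Bil K (Cochain V) =>
      (ofOps ![prec (a (dot 0)), succ (a (dot 0))] ![] ![] : (AssAdm K).E →ₗ[K] Bil K V))
    {a | IsAssBullet (LieAdm K) a} {b | IsAlg (AssAdm K) b} := by
  refine bijOn_isAssBullet admGen_generates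
    (fun _ e x y => ofOps_gswap (fun i => i.elim0) (fun i => i.elim0) e x y)
    (fun c => ?_) isAlg_assAdm_iff
  refine gen_hom_ext (fun i => ?_) (fun i => ?_) (fun i => i.elim0) (fun i => i.elim0) <;>
    fin_cases i <;> simp [ofOps_eq_genMap, admGen]
  · exact prec_cochainOps _ c _
  · exact neg_eq_iff_eq_neg.2 (succ_cochainOps_pres_dot K V _ c 0)

theorem isomorphic_comAdm : Isomorphic (black (Com K) (LieAdm K)) (ComAdm K) :=
  isomorphic_black_com comAdmGen (by rw [finrank_gen])
    comAdmGen_surjective comAdmGen_swap fun _ _ _ => isAlg_comAdm_iff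

theorem bijOn_comAdm : Set.BijOn
    (fun a : (LieAdm K).E →ₗ[K] Bil K (Cochain V) =>
      (ofOps ![prec (a (dot 0))] ![] ![] : (ComAdm K).E →ₗ[K] Bil K V))
    {a | IsComBullet (LieAdm K) a} {b | IsAlg (ComAdm K) b} := by
  refine bijOn_isComBullet comAdmGen_surjective comAdmGen_swap (fun c hc => ?_)
    isAlg_comAdm_iff
  refine gen_hom_ext (fun i => ?_) (fun i => ?_) (fun i => i.elim0) (fun i => i.elim0) <;>
    fin_cases i <;> simp [ofOps_eq_genMap, comAdmGen]
  · exact prec_cochainOps _ c _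
  · exact (congrArg (fun m => -LinearMap.flip m) (prec_cochainOps _ c _)).trans
      (neg_flip_eq_of_antisymm K V hc 0)

theorem isomorphic_preLieAdm : Isomorphic (black (PreLie K) (LieAdm K)) (PreLieAdm K) :=
  isomorphic_black_preLie admGen (by rw [finrank_gen, finrank_gen]) admGen_generates
    fun _ _ _ => isAlg_preLieAdm_iff

theorem bijOn_preLieAdm : Set.BijOn
    (fun a : (LieAdm K).E →ₗ[K] Bil K (RelCochain V) =>
      (ofOps ![precRel (a (dot 0)), succRel (a (dot 0))] ![] ![] :
        (PreLieAdm K).E →ₗ[K] Bil K V))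
    {a | IsPreLieBullet (LieAdm K) a} {b | IsAlg (PreLieAdm K) b} := by
  refine bijOn_isPreLieBullet admGen_generates
    (fun _ e x y => ofOps_gswap (fun i => i.elim0) (fun i => i.elim0) e x y)
    (fun c => ?_) isAlg_preLieAdm_iff
  refine gen_hom_ext (fun i => ?_) (fun i => ?_) (fun i => i.elim0) (fun i => i.elim0) <;>
    fin_cases i <;> simp [ofOps_eq_genMap, admGen]
  · exact precRel_relOps _ c _
  · exact neg_eq_iff_eq_neg.2 (succRel_relOps_pres_dot K V _ c 0)

end Results

end BinaryOperad

end

open BinaryOperad in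
theorem mainTheorem10 (K : Type u) [Field K] (V : Type v) [AddCommGroup V] [Module K V] :
    -- products with the Poisson operad
    (Isomorphic (black (Ass K) (Pois K)) (AssPois K) ∧
      Set.BijOn
        (fun a : (Pois K).E →ₗ[K] Bil K (Cochain V) =>
          (ofOps ![prec (a (bul 0)), prec (a (brk 0))] ![] ![] : (AssPois K).E →ₗ[K] Bil K V))
        {a | IsAssBullet (Pois K) a} {b | IsAlg (AssPois K) b}) ∧
    ((2 : K) ≠ 0 →
      Isomorphic (black (Com K) (Pois K)) (prod (NilLie K) (Com K)) ∧
      Set.BijOn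
        (fun a : (Pois K).E →ₗ[K] Bil K (Cochain V) =>
          (LinearMap.coprod (ofOps ![] ![] ![prec (a (bul 0))] : (NilLie K).E →ₗ[K] Bil K V)
            (ofOps ![] ![prec (a (brk 0))] ![] : (Com K).E →ₗ[K] Bil K V) :
            (prod (NilLie K) (Com K)).E →ₗ[K] Bil K V))
        {a | IsComBullet (Pois K) a} {b | IsAlg (prod (NilLie K) (Com K)) b}) ∧
    (Isomorphic (black (PreLie K) (Pois K)) (PrePois K) ∧
      Set.BijOn
        (fun a : (Pois K).E →ₗ[K] Bil K (RelCochain V) =>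
          (ofOps ![precRel (a (bul 0)), precRel (a (brk 0))] ![] ![] :
            (PrePois K).E →ₗ[K] Bil K V))
        {a | IsPreLieBullet (Pois K) a} {b | IsAlg (PrePois K) b}) ∧
    -- products with the post-Lie operad
    (Isomorphic (black (Ass K) (PostLie K)) (Tridend K) ∧
      Set.BijOn
        (fun a : (PostLie K).E →ₗ[K] Bil K (Cochain V) =>
          (ofOps ![prec (a (dot 0)), succ (a (dot 0)), prec (a (brk 0))] ![] ![] :
            (Tridend K).E →ₗ[K] Bil K V))
        {a | IsAssBullet (PostLie K) a} {b | IsAlg (Tridend K) b}) ∧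
    (Isomorphic (black (Com K) (PostLie K)) (PostCom K) ∧
      Set.BijOn
        (fun a : (PostLie K).E →ₗ[K] Bil K (Cochain V) =>
          (ofOps ![prec (a (dot 0))] ![prec (a (brk 0))] ![] : (PostCom K).E →ₗ[K] Bil K V))
        {a | IsComBullet (PostLie K) a} {b | IsAlg (PostCom K) b}) ∧
    -- morphisms induced by the sums of the operations
    ((∃ φ : (Lie K).E →ₗ[K] (PostLie K).E, IsHom (Lie K) (PostLie K) φ ∧
        φ (brk 0) = (dot 0 - dotop 0 + brk 0 : Gen K 1 0 1)) ∧
      (∃ φ : (Ass K).E →ₗ[K] (Tridend K).E, IsHom (Ass K) (Tridend K) φ ∧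
        φ (dot 0) = (dot 0 + dot 1 + dot 2 : Gen K 3 0 0)) ∧
      (∃ φ : (Com K).E →ₗ[K] (PostCom K).E, IsHom (Com K) (PostCom K) φ ∧
        φ (bul 0) = (dot 0 + dotop 0 + bul 0 : Gen K 1 1 0))) ∧
    -- products with the Lie admissible operad
    (Isomorphic (black (Ass K) (LieAdm K)) (AssAdm K) ∧
      Set.BijOn
        (fun a : (LieAdm K).E →ₗ[K] Bil K (Cochain V) =>
          (ofOps ![prec (a (dot 0)), succ (a (dot 0))] ![] ![] : (AssAdm K).E →ₗ[K] Bil K V))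
        {a | IsAssBullet (LieAdm K) a} {b | IsAlg (AssAdm K) b}) ∧
    (Isomorphic (black (Com K) (LieAdm K)) (ComAdm K) ∧
      Set.BijOn
        (fun a : (LieAdm K).E →ₗ[K] Bil K (Cochain V) =>
          (ofOps ![prec (a (dot 0))] ![] ![] : (ComAdm K).E →ₗ[K] Bil K V))
        {a | IsComBullet (LieAdm K) a} {b | IsAlg (ComAdm K) b}) ∧
    (Isomorphic (black (PreLie K) (LieAdm K)) (PreLieAdm K) ∧
      Set.BijOn
        (fun a : (LieAdm K).E →ₗ[K] Bil K (RelCochain V) =>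
          (ofOps ![precRel (a (dot 0)), succRel (a (dot 0))] ![] ![] :
            (PreLieAdm K).E →ₗ[K] Bil K V))
        {a | IsPreLieBullet (LieAdm K) a} {b | IsAlg (PreLieAdm K) b}) :=
  ⟨⟨isomorphic_assPois K, bijOn_assPois K V⟩,
    fun h2 => ⟨isomorphic_comPois K h2, bijOn_comPois K V h2⟩,
    ⟨isomorphic_prePois K, bijOn_prePois K V⟩,
    ⟨isomorphic_tridend K, bijOn_tridend K V⟩,
    ⟨isomorphic_postCom K, bijOn_postCom K V⟩,
    ⟨⟨lieToPostLie, isHom_lieToPostLie, by simp [lieToPostLie]⟩,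
      ⟨assToTridend, isHom_assToTridend, by simp [assToTridend]⟩,
      ⟨comToPostCom, isHom_comToPostCom, by simp [comToPostCom]⟩⟩,
    ⟨isomorphic_assAdm K, bijOn_assAdm K V⟩,
    ⟨isomorphic_comAdm K, bijOn_comAdm K V⟩,
    ⟨isomorphic_preLieAdm K, bijOn_preLieAdm K V⟩⟩
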